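/- Let $\mu$ be a probability measure on $\mathbb R$ with $\int|x|^3\,\mu(dx)<\infty$ and $\mu\neq\delta_0$, and let $p\in(0,1)$. Let $X_1,X_2,\dots$ be i.i.d. with law $\mu$; let $\epsilon_1=1$ and let $\epsilon_2,\epsilon_3,\dots$ be i.i.d. Bernoulli variables with $\mathbb P(\epsilon_n=1)=p$; let $U_2,U_3,\dots$ be independent with $U_n$ uniformly distributed on $\{1,\dots,n-1\}$; and let the three sequences $(X_n)$, $(\epsilon_n)$, $(U_n)$ be independent. Put $\mathrm i(n)=\sum_{j=1}^n\epsilon_j$. Define $\check X_1=X_1$ and, for $n\ge2$, $\check X_n=-\check X_{U_n}$ if $\epsilon_n=0$ and $\check X_n=X_{\mathrm i(n)}$ if $\epsilon_n=1$. Let $\check S_n=\sum_{i=1}^n\check X_i$ be the negatively step-reinforced random walk. With $m_k=\mathbb E(X_1^k)$, set $$\check b=\frac{p\,m_1}{2-p},\qquad \check\sigma=\sqrt{\frac{m_2-\check b^2}{3-2p}}>0,$$ and $$\delta_{2,n}=\begin{cases} n^{-1/2}, & p>1/3,\\ n^{-1/2}\log n, & p=1/3,\\ n^{-3p/2}, &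 0<p<1/3.\end{cases}$$ Then there is a constant $C>0$, depending only on $\mu$ and $p$ (not on $n$), such that $$\sup_{x\in\mathbb R}\left|\mathbb P\left(\frac{\check S_n-\check b n}{\check\sigma\sqrt n}\le x\right)-\Phi(x)\right|\le C\,\delta_{2,n}$$ for every $n\ge1$ (for every $n\ge2$ if $p=1/3$), where $\Phi$ is the standard normal distribution function. -/

import Mathlib

open MeasureTheory ProbabilityTheory

noncomputable section

/-- The innovation counter `i(n) = ∑_{j=1}^n ε_j`. -/
def innovationCount (e : ℕ → ℕ) (n : ℕ) : ℕ := ∑ j ∈ Finset.Icc 1 n, e j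

/-- The steps of the negatively step-reinforced walk along one realisation `x`, `e`, `u` of the
driving sequences (indexed from `1`; the step of index `0` is a dummy). The inner test `u n < n`
always succeeds when `u n ∈ {1, …, n - 1}`, see `negStep_of_two_le`. -/
def negStep (x : ℕ → ℝ) (e u : ℕ → ℕ) : ℕ → ℝ
  | 0 => 0
  | 1 => x 1
  | (n + 2) =>
    if e (n + 2) = 0 then
      if _h : u (n + 2) < n + 2 then - negStep x e u (u (n + 2)) else 0
    else x (innovationCount e (n + 2))

theorem negStep_one (x : ℕ → ℝ) (e u : ℕ → ℕ) : negStep x e u 1 = x 1 := by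
  rw [negStep]

theorem negStep_of_two_le (x : ℕ → ℝ) (e u : ℕ → ℕ) {n : ℕ} (hn : 2 ≤ n) (hu : u n < n) :
    negStep x e u n =
      if e n = 0 then - negStep x e u (u n) else x (innovationCount e n) := by
  obtain ⟨k, rfl⟩ := Nat.exists_eq_add_of_le' hn
  rw [negStep, dif_pos hu]

/-- The negatively step-reinforced walk `Š_n = ∑_{i=1}^n X̌_i` as a random variable. -/
def negWalk {Ω : Type*} (X : ℕ → Ω → ℝ) (ε U : ℕ → Ω → ℕ) (n : ℕ) (ω : Ω) : ℝ :=
  ∑ i ∈ Finset.Icc 1 n,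
    negStep (fun k => X k ω) (fun k => ε k ω) (fun k => U k ω) i

/-- The driving sequences of a step-reinforced walk with step law `μ` and parameter `p`:
`X_1, X_2, …` are i.i.d. with law `μ`; `ε_1 = 1` and `ε_2, ε_3, …` are i.i.d. Bernoulli(`p`);
`U_2, U_3, …` are independent, `U_n` uniform on `{1, …, n - 1}`; and the three sequences are
mutually independent. Other indices play no role. -/
structure IsReinforcementInput {Ω : Type*} [MeasurableSpace Ω] (P : Measure Ω)
    (μ : Measure ℝ) (p : ℝ) (X : ℕ → Ω → ℝ) (ε U : ℕ → Ω → ℕ) : Prop where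
  measurable_X : ∀ n, 1 ≤ n → Measurable (X n)
  map_X : ∀ n, 1 ≤ n → P.map (X n) = μ
  iIndepFun_X : iIndepFun (fun n => X (n + 1)) P
  ε_one : ∀ ω, ε 1 ω = 1
  measurable_ε : ∀ n, 2 ≤ n → Measurable (ε n)
  prob_ε_one : ∀ n, 2 ≤ n → P {ω | ε n ω = 1} = ENNReal.ofReal p
  prob_ε_zero : ∀ n, 2 ≤ n → P {ω | ε n ω = 0} = ENNReal.ofReal (1 - p)
  iIndepFun_ε : iIndepFun (fun n => ε (n + 2)) P
  measurable_U : ∀ n, 2 ≤ n → Measurable (U n)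
  prob_U : ∀ n, 2 ≤ n → ∀ k, 1 ≤ k → k < n →
    P {ω | U n ω = k} = ENNReal.ofReal (1 / ((n : ℝ) - 1))
  iIndepFun_U : iIndepFun (fun n => U (n + 2)) P
  indepFun_X_εU : IndepFun (fun ω n => X (n + 1) ω)
    (fun ω => ((fun n => ε (n + 2) ω : ℕ → ℕ), (fun n => U (n + 2) ω : ℕ → ℕ))) P
  indepFun_ε_U : IndepFun (fun ω n => ε (n + 2) ω) (fun ω n => U (n + 2) ω) P

/-- Kolmogorov distance between `Y` (under `P`) and a standard normal variable. -/
def kolmogorovDistNormal {Ω : Type*} [MeasurableSpace Ω] (P : Measure Ω) (Y : Ω → ℝ) : ℝ :=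
  ⨆ x : ℝ, |P.real {ω | Y ω ≤ x} - cdf (gaussianReal 0 1) x|

/-- The moments `m_k = E(X_1^k)` of the step law. -/
def stepMoment (μ : Measure ℝ) (k : ℕ) : ℝ := ∫ x, x ^ k ∂μ

/-- `b̌ = p m_1 / (2 - p)`. -/
def bCheck (μ : Measure ℝ) (p : ℝ) : ℝ := p * stepMoment μ 1 / (2 - p)

/-- `σ̌`, the nonnegative root of `σ̌² = (m_2 - b̌²) / (3 - 2p)`. -/
def sigmaCheck (μ : Measure ℝ) (p : ℝ) : ℝ :=
  Real.sqrt ((stepMoment μ 2 - bCheck μ p ^ 2) / (3 - 2 * p))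

/-- The rate `δ_{2,n}`. -/
def delta2 (p : ℝ) (n : ℕ) : ℝ :=
  if 1 / 3 < p then (n : ℝ) ^ (-(1 / 2) : ℝ)
  else if p = 1 / 3 then (n : ℝ) ^ (-(1 / 2) : ℝ) * Real.log n
  else (n : ℝ) ^ (-(3 * p / 2) : ℝ)

end

-- The steps form a genealogical forest. Time `n` opens a new tree when `ε n = 1`; otherwise it
-- hangs below the uniform vertex `U n`, with the opposite sign. The tree sizes alone form a Markov
-- chain (`sizeExp`, with q = 1 - p). Given the sizes, the trees are independent random recursive
-- trees (`integral_prod_forest`), and a tree with s vertices, b of them of even height, contributes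
-- (2b - s)X, where X is the innovation drawn at its root. Characteristic functions then identify
-- the law of the walk as a mixture, over the sizes, of laws of independent sums
-- (`real_negWalk_le`).
--
-- Inside a tree, b evolves as a two-colour urn with explicit moments. The signed sum 2b - s has
-- mean 0 unless s = 1, second moment s/3 once s ≥ 3 (1 for s = 1, 0 for s = 2), and third absolute
-- moment at most 2 s^(3/2). So, with N₁ and N₂ the numbers of trees of sizes one and two, the
-- conditional mean of the walk is m₁ N₁ and its conditional variance is affine in N₁ and N₂. A
-- Berry-Esseen inequality for independent summands, proved by Stein's method
-- (`berryEsseen_of_iIndepFun`), gives a conditional error of order Σ s^(3/2) / n^(3/2). The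
-- expectation R of Σ s^(3/2) satisfies R(n+1) ≤ (1 + 3q/(2n)) R(n) + 1, so it is O(n), O(n log n)
-- or O(n^(3q/2)) according as p is above, at or below 1/3. This produces the three regimes of the
-- rate.
--
-- Two further errors are of order n^(-1/2). First, N₁ and N₂ deviate from a₁n and a₂n by O(√n) in
-- mean square, so the conditional variance may be replaced by a constant multiple wn. Second, a
-- normal law with random mean m₁N₁ and variance wn must be compared with a single normal law. As Φ
-- is already smoothed at scale √n, a Lindeberg replacement along the chain suffices
-- (`abs_sizeExp_gaussCDF_treeCount_le`): the centred N₁ contracts by the factor 1 - q/n at each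
-- step, so one transition carries a Gaussian test function to another one up to a small error. The
-- law of total variance, w + m₁² v₁ = σ̌², gives the limiting variance.

/-! ### The standard normal distribution function -/

/-- The standard normal density. -/
noncomputable def gaussPDF (x : ℝ) : ℝ := gaussianPDFReal 0 1 x

/-- The standard normal distribution function. -/
noncomputable def gaussCDF (x : ℝ) : ℝ := cdf (gaussianReal 0 1) x

theorem gaussPDF_eq (x : ℝ) : gaussPDF x = (Real.sqrt (2 * Real.pi))⁻¹ * Real.exp (-x ^ 2 / 2) := by
  simp [gaussPDF, gaussianPDFReal]

theorem gaussPDF_pos (x : ℝ) : 0 < gaussPDF x := gaussianPDFReal_pos _ _ _ one_ne_zero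

theorem gaussPDF_neg (x : ℝ) : gaussPDF (-x) = gaussPDF x := by simp [gaussPDF_eq]

theorem two_le_sqrt_two_pi : 2 ≤ Real.sqrt (2 * Real.pi) := by
  apply Real.le_sqrt_of_sq_le
  nlinarith [Real.pi_gt_three]

theorem sqrt_two_pi_le : Real.sqrt (2 * Real.pi) ≤ 2.6 := by
  rw [Real.sqrt_le_left (by norm_num)]
  nlinarith [Real.pi_lt_d2]

theorem gaussPDF_le_half (x : ℝ) : gaussPDF x ≤ 1 / 2 := by
  rw [gaussPDF_eq]
  have h1 : (Real.sqrt (2 * Real.pi))⁻¹ ≤ 1 / 2 := by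
    rw [one_div]
    exact inv_anti₀ (by norm_num) two_le_sqrt_two_pi
  have h2 : Real.exp (-x ^ 2 / 2) ≤ 1 := Real.exp_le_one_iff.2 (by nlinarith [sq_nonneg x])
  calc (Real.sqrt (2 * Real.pi))⁻¹ * Real.exp (-x ^ 2 / 2) ≤ 1 / 2 * 1 := by gcongr
    _ = 1 / 2 := by norm_num

theorem hasDerivAt_gaussPDF (x : ℝ) : HasDerivAt gaussPDF (-x * gaussPDF x) x := by
  have h : HasDerivAt (fun x : ℝ => (Real.sqrt (2 * Real.pi))⁻¹ * Real.exp (-x ^ 2 / 2))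
      ((Real.sqrt (2 * Real.pi))⁻¹ * (Real.exp (-x ^ 2 / 2) * (-(2 * x) / 2))) x := by
    have h0 : HasDerivAt (fun x : ℝ => -x ^ 2 / 2) (-(2 * x) / 2) x := by
      simpa using ((hasDerivAt_pow 2 x).neg.div_const 2)
    exact (h0.exp).const_mul _
  have h2 : gaussPDF = fun x : ℝ => (Real.sqrt (2 * Real.pi))⁻¹ * Real.exp (-x ^ 2 / 2) :=
    funext gaussPDF_eq
  rw [h2]
  convert h using 1
  ring

theorem continuous_gaussPDF : Continuous gaussPDF :=
  continuous_iff_continuousAt.2 fun x => (hasDerivAt_gaussPDF x).continuousAt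

theorem integrable_gaussPDF : Integrable gaussPDF := integrable_gaussianPDFReal 0 1

theorem gaussCDF_eq_integral (x : ℝ) : gaussCDF x = ∫ t in Set.Iic x, gaussPDF t := by
  rw [gaussCDF, cdf_eq_real, measureReal_def, gaussianReal_apply_eq_integral 0 one_ne_zero,
    ENNReal.toReal_ofReal]
  · rfl
  · exact integral_nonneg fun t => (gaussPDF_pos t).le

theorem gaussCDF_sub (a b : ℝ) : gaussCDF b - gaussCDF a = ∫ t in a..b, gaussPDF t := by
  rw [gaussCDF_eq_integral, gaussCDF_eq_integral,
    intervalIntegral.integral_Iic_sub_Iic integrable_gaussPDF.integrableOn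
      integrable_gaussPDF.integrableOn]

theorem hasDerivAt_gaussCDF (x : ℝ) : HasDerivAt gaussCDF (gaussPDF x) x := by
  have h : HasDerivAt (fun y => gaussCDF 0 + ∫ t in (0 : ℝ)..y, gaussPDF t) (gaussPDF x) x := by
    refine HasDerivAt.const_add _ ?_
    exact intervalIntegral.integral_hasDerivAt_right
      (continuous_gaussPDF.intervalIntegrable _ _)
      (continuous_gaussPDF.stronglyMeasurableAtFilter _ _) continuous_gaussPDF.continuousAt
  refine h.congr_of_eventuallyEq (Filter.Eventually.of_forall fun y => ?_)
  have := gaussCDF_sub 0 y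
  simp only
  linarith

theorem continuous_gaussCDF : Continuous gaussCDF :=
  continuous_iff_continuousAt.2 fun x => (hasDerivAt_gaussCDF x).continuousAt

theorem gaussCDF_nonneg (x : ℝ) : 0 ≤ gaussCDF x := cdf_nonneg _ _

theorem gaussCDF_le_one (x : ℝ) : gaussCDF x ≤ 1 := cdf_le_one _ _

theorem gaussCDF_mono : Monotone gaussCDF := monotone_cdf _

/-- Since φ is even, Φ(y) + Φ(-y) has derivative zero, and it tends to 1 at infinity. -/
theorem gaussCDF_neg (x : ℝ) : gaussCDF (-x) = 1 - gaussCDF x := by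
  have hd : ∀ y, HasDerivAt (fun y => gaussCDF y + gaussCDF (-y)) 0 y := by
    intro y
    have h1 := (hasDerivAt_gaussCDF (-y)).comp y (hasDerivAt_neg y)
    have h2 := (hasDerivAt_gaussCDF y).add h1
    rw [gaussPDF_neg] at h2
    rw [mul_neg_one, add_neg_cancel] at h2
    exact h2
  have hc : ∀ y, gaussCDF y + gaussCDF (-y) = gaussCDF x + gaussCDF (-x) := fun y =>
    is_const_of_deriv_eq_zero (fun y => (hd y).differentiableAt) (fun y => (hd y).deriv) y x
  have ht : Filter.Tendsto (fun y => gaussCDF y + gaussCDF (-y)) Filter.atTop (nhds (1 + 0)) :=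
    (tendsto_cdf_atTop _).add ((tendsto_cdf_atBot _).comp Filter.tendsto_neg_atTop_atBot)
  have : gaussCDF x + gaussCDF (-x) = 1 + 0 :=
    tendsto_nhds_unique (tendsto_const_nhds.congr fun y => (hc y).symm) ht
  linarith

theorem integrable_mul_gaussPDF : Integrable (fun x => -x * gaussPDF x) := by
  have h := (integrable_mul_exp_neg_mul_sq (b := 1 / 2) (by norm_num)).const_mul
    (-(Real.sqrt (2 * Real.pi))⁻¹)
  refine h.congr (Filter.Eventually.of_forall fun x => ?_)
  simp only [gaussPDF_eq]
  have : -x ^ 2 / 2 = -(1 / 2) * x ^ 2 := by ring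
  rw [this]
  ring

theorem tendsto_gaussPDF_atBot : Filter.Tendsto gaussPDF Filter.atBot (nhds 0) := by
  have h1 : Filter.Tendsto (fun x : ℝ => -x ^ 2 / 2) Filter.atBot Filter.atBot := by
    have : Filter.Tendsto (fun x : ℝ => x ^ 2) Filter.atBot Filter.atTop :=
      by
      simpa [Function.comp_def] using
        (Filter.tendsto_pow_atTop (α := ℝ) two_ne_zero).comp Filter.tendsto_abs_atBot_atTop
    exact (Filter.tendsto_neg_atTop_atBot.comp this).atBot_div_const (by norm_num)
  have h2 := (Real.tendsto_exp_atBot.comp h1).const_mul (Real.sqrt (2 * Real.pi))⁻¹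
  rw [mul_zero] at h2
  exact h2.congr fun x => (gaussPDF_eq x).symm

/-- Mills' inequality for the lower tail. -/
theorem neg_mul_gaussCDF_le (w : ℝ) : -w * gaussCDF w ≤ gaussPDF w := by
  have h := integral_Iic_of_hasDerivAt_of_tendsto' (a := w) (m := 0)
    (fun x _ => hasDerivAt_gaussPDF x) integrable_mul_gaussPDF.integrableOn tendsto_gaussPDF_atBot
  rw [sub_zero] at h
  -- φ(w) is the integral of -tφ(t) over t ≤ w, and -w ≤ -t there.
  rw [← h, gaussCDF_eq_integral, ← integral_const_mul]
  refine setIntegral_mono_on (integrable_gaussPDF.integrableOn.const_mul _)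
    integrable_mul_gaussPDF.integrableOn measurableSet_Iic fun x hx => ?_
  have : x ≤ w := hx
  nlinarith [gaussPDF_pos x]

theorem mul_one_sub_gaussCDF_le (w : ℝ) : w * (1 - gaussCDF w) ≤ gaussPDF w := by
  have h := neg_mul_gaussCDF_le (-w)
  rwa [neg_neg, gaussCDF_neg, gaussPDF_neg] at h

/-! ### The solution of Stein's equation for a half line -/

/-- The solution of Stein's equation `f' w - w f w = 1_{w ≤ z} - Φ z`. -/
noncomputable def steinSol (z w : ℝ) : ℝ :=
  (gaussCDF (min w z) - gaussCDF w * gaussCDF z) / gaussPDF w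

/-- The derivative of the Stein solution, as given by Stein's equation. -/
noncomputable def steinDeriv (z w : ℝ) : ℝ :=
  w * steinSol z w + (if w ≤ z then 1 else 0) - gaussCDF z

theorem steinSol_nonneg (z w : ℝ) : 0 ≤ steinSol z w := by
  refine div_nonneg ?_ (gaussPDF_pos w).le
  rcases le_total w z with h | h
  · rw [min_eq_left h]
    nlinarith [gaussCDF_nonneg w, gaussCDF_le_one z]
  · rw [min_eq_right h]
    nlinarith [gaussCDF_nonneg z, gaussCDF_le_one w]

/-- The numerator equals Φ(min w z)(1 - Φ(max w z)), which for fixed w is largest at z = w. -/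
theorem steinSol_le (z w : ℝ) :
    steinSol z w ≤ gaussCDF w * (1 - gaussCDF w) / gaussPDF w := by
  refine div_le_div_of_nonneg_right ?_ (gaussPDF_pos w).le
  rcases le_total w z with h | h
  · rw [min_eq_left h]
    nlinarith [gaussCDF_nonneg w, gaussCDF_mono h]
  · rw [min_eq_right h]
    nlinarith [gaussCDF_le_one w, gaussCDF_mono h]

theorem abs_mul_steinSol_le (z w : ℝ) : |w * steinSol z w| ≤ 1 := by
  have h0 := steinSol_nonneg z w
  have hp := gaussPDF_pos w
  have hn := gaussCDF_nonneg w
  have hl := gaussCDF_le_one w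
  have h1 : |w| * (gaussCDF w * (1 - gaussCDF w)) ≤ gaussPDF w := by
    rcases le_total 0 w with hw | hw
    · rw [abs_of_nonneg hw]
      have := mul_one_sub_gaussCDF_le w
      have h3 : 0 ≤ w * (1 - gaussCDF w) := mul_nonneg hw (by linarith)
      nlinarith
    · rw [abs_of_nonpos hw]
      have := neg_mul_gaussCDF_le w
      have h3 : 0 ≤ -w * gaussCDF w := mul_nonneg (by linarith) hn
      nlinarith
  rw [abs_mul, abs_of_nonneg h0]
  calc |w| * steinSol z w ≤ |w| * (gaussCDF w * (1 - gaussCDF w) / gaussPDF w) :=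
        mul_le_mul_of_nonneg_left (steinSol_le z w) (abs_nonneg w)
    _ = |w| * (gaussCDF w * (1 - gaussCDF w)) / gaussPDF w := by ring
    _ ≤ 1 := by rw [div_le_one hp]; exact h1

/-- For |w| ≥ 1 the bound on w f(w) suffices. For |w| ≤ 1 the numerator is at most 1/4 and the
density at least 1/20. -/
theorem steinSol_le_five (z w : ℝ) : steinSol z w ≤ 5 := by
  have h0 := steinSol_nonneg z w
  rcases le_total 1 |w| with hw | hw
  · have h := abs_mul_steinSol_le z w
    rw [abs_mul, abs_of_nonneg h0] at h
    nlinarith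
  · have h1 := steinSol_le z w
    have hp : 1 / 20 ≤ gaussPDF w := by
      rw [gaussPDF_eq]
      have h2 : (2.6 : ℝ)⁻¹ ≤ (Real.sqrt (2 * Real.pi))⁻¹ :=
        inv_anti₀ (by linarith [two_le_sqrt_two_pi]) sqrt_two_pi_le
      have h3 : 1 - 1 / 2 ≤ Real.exp (-w ^ 2 / 2) := by
        have h4 : w ^ 2 ≤ 1 := by rw [← sq_abs]; nlinarith [abs_nonneg w]
        have := Real.add_one_le_exp (-w ^ 2 / 2)
        linarith
      have h5 : (2.6 : ℝ)⁻¹ * (1 - 1 / 2) ≤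
          (Real.sqrt (2 * Real.pi))⁻¹ * Real.exp (-w ^ 2 / 2) := by gcongr
      have h6 : (2.6 : ℝ)⁻¹ * (1 - 1 / 2) = 5 / 26 := by norm_num
      linarith
    refine h1.trans ?_
    rw [div_le_iff₀ (gaussPDF_pos w)]
    nlinarith [gaussCDF_nonneg w, gaussCDF_le_one w, sq_nonneg (gaussCDF w - 1 / 2)]

theorem abs_steinDeriv_le (z w : ℝ) : |steinDeriv z w| ≤ 2 := by
  have h := abs_le.1 (abs_mul_steinSol_le z w)
  have h1 := gaussCDF_nonneg z
  have h2 := gaussCDF_le_one z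
  rw [abs_le, steinDeriv]
  split_ifs <;> constructor <;> linarith [h.1, h.2]

theorem continuous_steinSol (z : ℝ) : Continuous (steinSol z) := by
  unfold steinSol
  refine Continuous.div ?_ continuous_gaussPDF fun w => (gaussPDF_pos w).ne'
  exact (continuous_gaussCDF.comp (continuous_id.min continuous_const)).sub
    (continuous_gaussCDF.mul continuous_const)

/-- The solution has a kink at z, so only a right derivative exists everywhere; the strict
inequality in the indicator picks the right-hand value at w = z. A right derivative is all that the
mean value inequality needs. -/
theorem hasDerivWithinAt_steinSol (z w : ℝ) :
    HasDerivWithinAt (steinSol z) (w * steinSol z w + (if w < z then 1 else 0) - gaussCDF z)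
      (Set.Ici w) w := by
  have hp := (gaussPDF_pos w).ne'
  split_ifs with h
  · have h1 : HasDerivAt (fun w => (gaussCDF w - gaussCDF w * gaussCDF z) / gaussPDF w)
        (((gaussPDF w - gaussPDF w * gaussCDF z) * gaussPDF w -
          (gaussCDF w - gaussCDF w * gaussCDF z) * (-w * gaussPDF w)) / gaussPDF w ^ 2) w :=
      ((hasDerivAt_gaussCDF w).sub ((hasDerivAt_gaussCDF w).mul_const _)).div
        (hasDerivAt_gaussPDF w) hp
    have h2 : HasDerivAt (steinSol z) _ w := h1.congr_of_eventuallyEq (by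
      filter_upwards [eventually_lt_nhds h] with x hx
      simp only [steinSol, min_eq_left hx.le])
    refine h2.hasDerivWithinAt.congr_deriv ?_
    simp only [steinSol, min_eq_left h.le]
    field_simp
    ring
  · have h' : z ≤ w := not_lt.1 h
    have h1 : HasDerivAt (fun w => (gaussCDF z - gaussCDF w * gaussCDF z) / gaussPDF w)
        (((- (gaussPDF w * gaussCDF z)) * gaussPDF w -
          (gaussCDF z - gaussCDF w * gaussCDF z) * (-w * gaussPDF w)) / gaussPDF w ^ 2) w := by
      have := ((hasDerivAt_gaussCDF w).mul_const (gaussCDF z)).const_sub (gaussCDF z)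
      exact this.div (hasDerivAt_gaussPDF w) hp
    have h2 : HasDerivWithinAt (steinSol z) _ (Set.Ici w) w := h1.hasDerivWithinAt.congr
      (fun x hx => by simp only [steinSol, min_eq_right (h'.trans hx)])
      (by simp only [steinSol, min_eq_right h'])
    refine h2.congr_deriv ?_
    simp only [steinSol, min_eq_right h']
    field_simp
    ring

theorem abs_steinSol_sub_le_of_le (z : ℝ) {a b : ℝ} (hab : a ≤ b) :
    |steinSol z b - steinSol z a| ≤ 2 * (b - a) := by
  have := norm_image_sub_le_of_norm_deriv_right_le_segment (C := 2) (a := a) (b := b)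
    (continuous_steinSol z).continuousOn (fun x _ => hasDerivWithinAt_steinSol z x) (fun x _ => by
      have h := abs_le.1 (abs_mul_steinSol_le z x)
      have h1 := gaussCDF_nonneg z
      have h2 := gaussCDF_le_one z
      rw [Real.norm_eq_abs, abs_le]
      split_ifs <;> constructor <;> linarith [h.1, h.2]) b (Set.right_mem_Icc.2 hab)
  simpa using this

theorem abs_steinSol_sub_le (z a b : ℝ) : |steinSol z b - steinSol z a| ≤ 2 * |b - a| := by
  rcases le_total a b with h | h
  · rw [abs_of_nonneg (sub_nonneg.2 h)]
    exact abs_steinSol_sub_le_of_le z h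
  · rw [abs_sub_comm, abs_sub_comm b a, abs_of_nonneg (sub_nonneg.2 h)]
    exact abs_steinSol_sub_le_of_le z h

theorem abs_mul_steinSol_sub_le (z w x : ℝ) :
    |x * steinSol z x - w * steinSol z w| ≤ |x - w| * (5 + 2 * |w|) := by
  have h1 : x * steinSol z x - w * steinSol z w =
      (x - w) * steinSol z x + w * (steinSol z x - steinSol z w) := by ring
  rw [h1]
  calc _ ≤ |(x - w) * steinSol z x| + |w * (steinSol z x - steinSol z w)| := abs_add_le _ _
    _ = |x - w| * steinSol z x + |w| * |steinSol z x - steinSol z w| := by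
      rw [abs_mul, abs_mul, abs_of_nonneg (steinSol_nonneg z x)]
    _ ≤ |x - w| * 5 + |w| * (2 * |x - w|) := by
      gcongr
      · exact steinSol_le_five z x
      · exact abs_steinSol_sub_le z w x
    _ = _ := by ring

/-- A bound for the increments of the derivative of the Stein solution. -/
noncomputable def steinModulus (z u w : ℝ) : ℝ :=
  |u| * (5 + 2 * |w|) + (if |w - z| ≤ |u| then 1 else 0)

theorem steinModulus_nonneg (z u w : ℝ) : 0 ≤ steinModulus z u w := by
  unfold steinModulus
  split_ifs <;> positivity

/-- In Stein's equation the term w f(w) is locally Lipschitz, and the indicator can change between w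
and w + u only if z lies within |u| of w. -/
theorem abs_steinDeriv_sub_le (z u w : ℝ) :
    |steinDeriv z (w + u) - steinDeriv z w| ≤ steinModulus z u w := by
  have h := abs_mul_steinSol_sub_le z w (w + u)
  rw [add_sub_cancel_left] at h
  have h1 : |((if w + u ≤ z then 1 else 0) - (if w ≤ z then 1 else 0) : ℝ)| ≤
      if |w - z| ≤ |u| then 1 else 0 := by
    by_cases ha : w + u ≤ z <;> by_cases hb : w ≤ z <;> by_cases hc : |w - z| ≤ |u| <;>
      simp [ha, hb, hc]
    · refine absurd ?_ hc
      rw [abs_le]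
      constructor <;> cases abs_cases u <;> linarith
    · refine absurd ?_ hc
      rw [abs_le]
      constructor <;> cases abs_cases u <;> linarith
  have h2 : steinDeriv z (w + u) - steinDeriv z w =
      ((w + u) * steinSol z (w + u) - w * steinSol z w) +
      ((if w + u ≤ z then 1 else 0) - (if w ≤ z then 1 else 0)) := by
    unfold steinDeriv; ring
  rw [h2]
  exact (abs_add_le _ _).trans (add_le_add h h1)

/-- The mean value inequality is applied to x ↦ f(x) - x f'(w): between w and w + u its right
derivative is bounded by the modulus. -/
theorem abs_steinSol_taylor (z u w : ℝ) :
    |steinSol z (w + u) - steinSol z w - u * steinDeriv z w| ≤ |u| * steinModulus z u w := by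
  have key : ∀ a b, a ≤ b → (∀ x ∈ Set.Icc a b, |x - w| ≤ |u|) →
      |(steinSol z b - b * steinDeriv z w) - (steinSol z a - a * steinDeriv z w)| ≤
        steinModulus z u w * (b - a) := by
    intro a b hab hx
    have := norm_image_sub_le_of_norm_deriv_right_le_segment (C := steinModulus z u w)
      (a := a) (b := b) (f := fun x => steinSol z x - x * steinDeriv z w)
      (f' := fun x => x * steinSol z x + (if x < z then 1 else 0) - gaussCDF z - steinDeriv z w)
      (((continuous_steinSol z).sub (continuous_id.mul continuous_const)).continuousOn)
      (fun x _ => (hasDerivWithinAt_steinSol z x).sub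
        (by simpa using (hasDerivWithinAt_id x (Set.Ici x)).mul_const (steinDeriv z w)))
      (fun x hx' => by
        have hxu := hx x ⟨hx'.1, hx'.2.le⟩
        have h := abs_mul_steinSol_sub_le z w x
        have h1 : |((if x < z then 1 else 0) - (if w ≤ z then 1 else 0) : ℝ)| ≤
            if |w - z| ≤ |u| then 1 else 0 := by
          rw [abs_le] at hxu
          by_cases ha : x < z <;> by_cases hb : w ≤ z <;> by_cases hc : |w - z| ≤ |u| <;>
            simp [ha, hb, hc]
          · refine absurd ?_ hc
            rw [abs_le]
            constructor <;> linarith [hxu.1, hxu.2, abs_nonneg u]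
          · refine absurd ?_ hc
            rw [abs_le]
            constructor <;> linarith [hxu.1, hxu.2, abs_nonneg u]
        have h2 : x * steinSol z x + (if x < z then 1 else 0) - gaussCDF z - steinDeriv z w =
            (x * steinSol z x - w * steinSol z w) +
            ((if x < z then 1 else 0) - (if w ≤ z then 1 else 0)) := by
          unfold steinDeriv; ring
        rw [h2, Real.norm_eq_abs]
        refine (abs_add_le _ _).trans (add_le_add (h.trans ?_) h1)
        gcongr) b (Set.right_mem_Icc.2 hab)
    simpa using this
  rcases le_total 0 u with hu | hu
  · have := key w (w + u) (by linarith) (fun x hx => by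
      rw [abs_of_nonneg hu, abs_of_nonneg (by linarith [hx.1])]; linarith [hx.2])
    rw [abs_of_nonneg hu]
    convert this using 1
    · congr 1; ring
    · ring
  · have := key (w + u) w (by linarith) (fun x hx => by
      rw [abs_of_nonpos hu, abs_of_nonpos (by linarith [hx.2])]; linarith [hx.1])
    rw [abs_of_nonpos hu, abs_sub_comm] at *
    convert this using 1
    · rw [← abs_neg]; congr 1; ring
    · ring

/-! ### A concentration inequality for sums of independent variables -/

/-- The function with slope one on `[a - δ, b + δ]` and constant elsewhere. -/
noncomputable def clampAt (a b δ w : ℝ) : ℝ :=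
  max (-((b - a) / 2 + δ)) (min ((b - a) / 2 + δ) (w - (a + b) / 2))

theorem continuous_clampAt (a b δ : ℝ) : Continuous (clampAt a b δ) := by
  unfold clampAt
  fun_prop

theorem abs_clampAt_le {a b δ : ℝ} (hab : a ≤ b) (hδ : 0 ≤ δ) (w : ℝ) :
    |clampAt a b δ w| ≤ (b - a) / 2 + δ := by
  unfold clampAt
  rw [abs_le]
  exact ⟨le_max_left _ _, max_le (by linarith) (min_le_left _ _)⟩

/-- The clamp is monotone, so the right side is never negative. When v lies in [a, b], the clamp has
slope one up to distance δ from v, so it moves by at least min(δ, |x|). -/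
theorem le_mul_clampAt_sub {a b δ : ℝ} (hδ : 0 ≤ δ) (v x : ℝ) :
    (if a ≤ v ∧ v ≤ b then |x| * min δ |x| else 0) ≤
      x * (clampAt a b δ v - clampAt a b δ (v - x)) := by
  have hmono : Monotone (clampAt a b δ) := by
    intro w w' h
    unfold clampAt
    gcongr
  split_ifs with h
  · obtain ⟨h1, h2⟩ := h
    have hv : clampAt a b δ v = v - (a + b) / 2 := by
      unfold clampAt
      rw [min_eq_right (by linarith), max_eq_right (by linarith)]
    rcases le_total 0 x with hx | hx
    · rw [abs_of_nonneg hx]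
      refine mul_le_mul_of_nonneg_left ?_ hx
      rw [hv]
      have : clampAt a b δ (v - x) ≤ max (-((b - a) / 2 + δ)) (v - x - (a + b) / 2) := by
        unfold clampAt
        gcongr
        exact min_le_right _ _
      rcases le_max_iff.1 this with h3 | h3
      · exact (min_le_left _ _).trans (by linarith)
      · exact (min_le_right _ _).trans (by linarith)
    · rw [abs_of_nonpos hx]
      have h4 : min δ (-x) ≤ clampAt a b δ (v - x) - clampAt a b δ v := by
        rw [hv]
        have : min ((b - a) / 2 + δ) (v - x - (a + b) / 2) ≤ clampAt a b δ (v - x) :=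
          le_max_right _ _
        rcases min_le_iff.1 this with h3 | h3
        · exact (min_le_left _ _).trans (by linarith)
        · exact (min_le_right _ _).trans (by linarith)
      have := mul_le_mul_of_nonneg_left h4 (neg_nonneg.2 hx)
      linarith
  · rcases le_total 0 x with hx | hx
    · exact mul_nonneg hx (sub_nonneg.2 (hmono (by linarith)))
    · exact mul_nonneg_of_nonpos_of_nonpos hx (sub_nonpos.2 (hmono (by linarith)))

/-- By completing the square, t - t²/(4δ) is at most δ; it is trivially at most t. -/
theorem sq_sub_le_mul_min {δ : ℝ} (hδ : 0 < δ) (x : ℝ) :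
    x ^ 2 - |x| ^ 3 / (4 * δ) ≤ |x| * min δ |x| := by
  rw [← sq_abs x]
  have hx := abs_nonneg x
  have h1 : |x| ^ 2 - |x| ^ 3 / (4 * δ) = |x| * (|x| - |x| ^ 2 / (4 * δ)) := by ring
  rw [h1]
  refine mul_le_mul_of_nonneg_left (le_min ?_ ?_) hx
  · have : |x| - |x| ^ 2 / (4 * δ) = δ - (|x| - 2 * δ) ^ 2 / (4 * δ) := by field_simp; ring
    rw [this]
    have : 0 ≤ (|x| - 2 * δ) ^ 2 / (4 * δ) := by positivity
    linarith
  · have : 0 ≤ |x| ^ 2 / (4 * δ) := by positivity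
    linarith

section Independent

variable {Ω : Type*} [MeasurableSpace Ω] {P : Measure Ω} {ι : Type*}

theorem integrable_abs_pow_three {X : Ω → ℝ} (h : MemLp X 3 P) :
    Integrable (fun ω => |X ω| ^ 3) P := by
  simpa using h.integrable_norm_pow (p := 3) (by norm_num)

theorem measurable_finsetSum_apply {ξ : ι → Ω → ℝ} (hm : ∀ i, Measurable (ξ i)) (s : Finset ι) :
    Measurable (∑ i ∈ s, ξ i) := by
  have := Finset.measurable_sum s fun i _ => hm i
  convert this using 1
  ext ω
  simp

variable [IsProbabilityMeasure P]

theorem MeasureTheory.MemLp.two_of_three {X : Ω → ℝ} (h : MemLp X 3 P) : MemLp X 2 P :=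
  h.mono_exponent (by norm_num)

theorem integral_sq_sum_of_iIndepFun {ξ : ι → Ω → ℝ} (hm : ∀ i, Measurable (ξ i))
    (hind : iIndepFun ξ P) (h2 : ∀ i, MemLp (ξ i) 2 P) (h0 : ∀ i, ∫ ω, ξ i ω ∂P = 0)
    (s : Finset ι) :
    ∫ ω, (∑ i ∈ s, ξ i ω) ^ 2 ∂P = ∑ i ∈ s, ∫ ω, ξ i ω ^ 2 ∂P := by
  have hv := IndepFun.variance_sum (s := s) (fun i _ => h2 i)
    (fun i _ j _ hij => hind.indepFun hij)
  rw [variance_of_integral_eq_zero] at hv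
  · simp only [Finset.sum_apply] at hv
    rw [hv]
    exact Finset.sum_congr rfl fun i _ =>
      variance_of_integral_eq_zero (hm i).aemeasurable (h0 i)
  · exact (measurable_finsetSum_apply hm s).aemeasurable
  · simp only [Finset.sum_apply]
    rw [integral_finsetSum s fun i _ => (h2 i).integrable (by norm_num)]
    exact Finset.sum_eq_zero fun i _ => h0 i

theorem integral_abs_le_of_integral_sq_le {X : Ω → ℝ} (h : MemLp X 2 P) {c : ℝ} (hc : 0 < c)
    (hX : ∫ ω, X ω ^ 2 ∂P ≤ c ^ 2) : ∫ ω, |X ω| ∂P ≤ c := by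
  have hp : ∀ ω, |X ω| ≤ (c + X ω ^ 2 / c) / 2 := by
    intro ω
    rw [← sq_abs (X ω), le_div_iff₀ (by norm_num), ← sub_nonneg]
    have : c + |X ω| ^ 2 / c - |X ω| * 2 = (c - |X ω|) ^ 2 / c := by field_simp; ring
    rw [this]
    positivity
  have hint : Integrable (fun ω => (c + X ω ^ 2 / c) / 2) P :=
    ((integrable_const c).add (h.integrable_sq.div_const c)).div_const 2
  calc ∫ ω, |X ω| ∂P ≤ ∫ ω, (c + X ω ^ 2 / c) / 2 ∂P :=
        integral_mono (h.integrable (by norm_num)).abs hint hp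
    _ = (c + (∫ ω, X ω ^ 2 ∂P) / c) / 2 := by
        rw [integral_div, integral_add (integrable_const c) (h.integrable_sq.div_const c),
          integral_div]
        simp
    _ ≤ (c + c ^ 2 / c) / 2 := by gcongr
    _ = c := by field_simp; ring

/-- Sums of independent centred variables with variance between `3/4` and `1` put mass at most
`(b - a) + 4 γ` on `[a, b]`, where `γ` bounds the sum of the third absolute moments. -/
theorem concentration_of_iIndepFun {ξ : ι → Ω → ℝ} (hm : ∀ i, Measurable (ξ i))
    (hind : iIndepFun ξ P) (h3 : ∀ i, MemLp (ξ i) 3 P) (h0 : ∀ i, ∫ ω, ξ i ω ∂P = 0)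
    (s : Finset ι) (hlo : 3 / 4 ≤ ∑ i ∈ s, ∫ ω, ξ i ω ^ 2 ∂P)
    (hhi : ∑ i ∈ s, ∫ ω, ξ i ω ^ 2 ∂P ≤ 1) {γ : ℝ} (hγ : 0 < γ)
    (h3γ : ∑ i ∈ s, ∫ ω, |ξ i ω| ^ 3 ∂P ≤ γ) {a b : ℝ} (hab : a ≤ b) :
    P.real {ω | a ≤ ∑ i ∈ s, ξ i ω ∧ ∑ i ∈ s, ξ i ω ≤ b} ≤ (b - a) + 4 * γ := by
  classical
  set V : Ω → ℝ := fun ω => ∑ i ∈ s, ξ i ω with hV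
  have hVm : Measurable V := Finset.measurable_sum s fun i _ => hm i
  set B : Set Ω := {ω | a ≤ V ω ∧ V ω ≤ b} with hB
  have hBm : MeasurableSet B :=
    (measurableSet_le measurable_const hVm).inter (measurableSet_le hVm measurable_const)
  have h2 : ∀ i, MemLp (ξ i) 2 P := fun i => (h3 i).two_of_three
  have h1 : ∀ i, Integrable (ξ i) P := fun i => (h2 i).integrable (by norm_num)
  set f := clampAt a b γ with hf
  have hfc : Continuous f := continuous_clampAt a b γ
  have hfb : ∀ w, |f w| ≤ (b - a) / 2 + γ := abs_clampAt_le hab hγ.le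
  set t : ι → Ω → ℝ := fun i ω => |ξ i ω| * min γ |ξ i ω| with ht
  have htm : ∀ i, Measurable (t i) := fun i => (hm i).abs.mul (measurable_const.min (hm i).abs)
  have htnn : ∀ i ω, 0 ≤ t i ω := fun i ω =>
    mul_nonneg (abs_nonneg _) (le_min hγ.le (abs_nonneg _))
  have htle : ∀ i ω, t i ω ≤ γ * |ξ i ω| := fun i ω => by
    rw [mul_comm γ]
    exact mul_le_mul_of_nonneg_left (min_le_left _ _) (abs_nonneg _)
  have ht2 : ∀ i, MemLp (t i) 2 P := fun i =>
    MemLp.of_le_mul (h2 i) (htm i).aestronglyMeasurable (c := γ)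
      (Filter.Eventually.of_forall fun ω => by
        rw [Real.norm_eq_abs, Real.norm_eq_abs, abs_of_nonneg (htnn i ω)]
        exact htle i ω)
  have ht1 : ∀ i, Integrable (t i) P := fun i => (ht2 i).integrable (by norm_num)
  set T : Ω → ℝ := fun ω => ∑ i ∈ s, t i ω with hT
  have hT2 : MemLp T 2 P := memLp_finsetSum s fun i _ => ht2 i
  have hT1 : Integrable T P := hT2.integrable (by norm_num)
  have hVf : Integrable (fun ω => V ω * f (V ω)) P := by
    have := Integrable.bdd_mul (integrable_finsetSum s fun i _ => h1 i)
      (hfc.measurable.comp hVm).aestronglyMeasurable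
      (Filter.Eventually.of_forall fun ω => hfb (V ω))
    refine this.congr (Filter.Eventually.of_forall fun ω => ?_)
    simp only [Function.comp, hV]
    ring
  -- the Stein-type lower bound
  have hlower : ∫ ω in B, T ω ∂P ≤ ∫ ω, V ω * f (V ω) ∂P := by
    -- V - ξ_i involves only the other variables, so it is independent of the centred ξ_i.
    have hsplit : ∀ i ∈ s, ∫ ω, ξ i ω * f (V ω - ξ i ω) ∂P = 0 := by
      intro i hi
      have hi' := hind.indepFun_finsetSum_of_notMem hm (Finset.notMem_erase i s)
      have hcomp := hi'.symm.comp (φ := fun x : ℝ => x) (ψ := f) measurable_id hfc.measurable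
      have := hcomp.integral_mul_eq_mul_integral (hm i).aestronglyMeasurable
        (hfc.measurable.comp (measurable_finsetSum_apply hm _)).aestronglyMeasurable
      have h0' : ∫ ω, ((fun x : ℝ => x) ∘ ξ i) ω ∂P = 0 := h0 i
      rw [h0', zero_mul] at this
      rw [← this]
      refine integral_congr_ae (Filter.Eventually.of_forall fun ω => ?_)
      simp only [Pi.mul_apply, Function.comp, Finset.sum_apply, hV]
      rw [← Finset.add_sum_erase s _ hi, add_sub_cancel_left]
    have hint1 : ∀ i, Integrable (fun ω => ξ i ω * f (V ω)) P := fun i => by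
      have := Integrable.bdd_mul (h1 i) (hfc.measurable.comp hVm).aestronglyMeasurable
        (Filter.Eventually.of_forall fun ω => hfb (V ω))
      exact this.congr (Filter.Eventually.of_forall fun ω => mul_comm _ _)
    have hint2 : ∀ i, Integrable (fun ω => ξ i ω * f (V ω - ξ i ω)) P := fun i => by
      have := Integrable.bdd_mul (h1 i)
        (hfc.measurable.comp (hVm.sub (hm i))).aestronglyMeasurable
        (Filter.Eventually.of_forall fun ω => hfb (V ω - ξ i ω))
      exact this.congr (Filter.Eventually.of_forall fun ω => mul_comm _ _)
    have e1 : ∫ ω, V ω * f (V ω) ∂P =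
        ∑ i ∈ s, ∫ ω, ξ i ω * (f (V ω) - f (V ω - ξ i ω)) ∂P := by
      simp only [mul_sub]
      rw [Finset.sum_congr rfl fun i hi => by
        rw [integral_sub (hint1 i) (hint2 i), hsplit i hi, sub_zero]]
      rw [← integral_finsetSum s fun i _ => hint1 i]
      simp only [hV, Finset.sum_mul]
    rw [e1, hT, integral_finsetSum s fun i _ => (ht1 i).integrableOn]
    refine Finset.sum_le_sum fun i _ => ?_
    rw [← integral_indicator hBm]
    refine integral_mono ((ht1 i).indicator hBm) ?_ fun ω => ?_
    · simp only [mul_sub]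
      exact (hint1 i).sub (hint2 i)
    · have := le_mul_clampAt_sub (a := a) (b := b) hγ.le (V ω) (ξ i ω)
      simpa only [Set.indicator, hB, Set.mem_ofPred_eq] using this
  have hupper : ∫ ω, V ω * f (V ω) ∂P ≤ (b - a) / 2 + γ := by
    have hc : 0 < (b - a) / 2 + γ := by linarith
    have hV2 : MemLp V 2 P := memLp_finsetSum s fun i _ => h2 i
    have hVabs : ∫ ω, |V ω| ∂P ≤ 1 := integral_abs_le_of_integral_sq_le hV2 one_pos (by
      rw [hV, integral_sq_sum_of_iIndepFun hm hind h2 h0 s]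
      simpa using hhi)
    calc ∫ ω, V ω * f (V ω) ∂P ≤ ∫ ω, |V ω| * ((b - a) / 2 + γ) ∂P := by
          refine integral_mono hVf ((hV2.integrable (by norm_num)).abs.mul_const _) fun ω => ?_
          refine (le_abs_self _).trans ?_
          rw [abs_mul]
          exact mul_le_mul_of_nonneg_left (hfb _) (abs_nonneg _)
      _ = (∫ ω, |V ω| ∂P) * ((b - a) / 2 + γ) := integral_mul_const _ _
      _ ≤ 1 * ((b - a) / 2 + γ) := by gcongr
      _ = _ := one_mul _
  -- The variance is at least 3/4, and the correction Σ E|ξ_i|³ / (4γ) costs at most 1/4.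
  have hET : 1 / 2 ≤ ∫ ω, T ω ∂P := by
    rw [hT, integral_finsetSum s fun i _ => ht1 i]
    have : ∀ i ∈ s, ∫ ω, ξ i ω ^ 2 ∂P - (∫ ω, |ξ i ω| ^ 3 ∂P) / (4 * γ) ≤ ∫ ω, t i ω ∂P := by
      intro i _
      rw [← integral_div, ← integral_sub (h2 i).integrable_sq
        ((integrable_abs_pow_three (h3 i)).div_const _)]
      exact integral_mono ((h2 i).integrable_sq.sub
        ((integrable_abs_pow_three (h3 i)).div_const _)) (ht1 i)
        fun ω => sq_sub_le_mul_min hγ (ξ i ω)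
    refine le_trans ?_ (Finset.sum_le_sum this)
    rw [Finset.sum_sub_distrib, ← Finset.sum_div]
    have : (∑ i ∈ s, ∫ ω, |ξ i ω| ^ 3 ∂P) / (4 * γ) ≤ 1 / 4 := by
      rw [div_le_iff₀ (by positivity)]
      linarith
    linarith
  -- T is a sum of independent terms bounded by γ|ξ_i|, so its variance is at most γ².
  have hdev : ∫ ω, |T ω - ∫ ω', T ω' ∂P| ∂P ≤ γ := by
    refine integral_abs_le_of_integral_sq_le (hT2.sub (memLp_const _)) hγ ?_
    simp only [Pi.sub_apply]
    rw [← variance_eq_integral hT1.aemeasurable]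
    have hTeq : T = ∑ i ∈ s, t i := by ext ω; simp [hT]
    have htind : iIndepFun t P :=
      hind.comp (fun _ x => |x| * min γ |x|) fun _ => by fun_prop
    rw [hTeq, IndepFun.variance_sum (fun i _ => ht2 i) fun i _ j _ hij => htind.indepFun hij]
    calc ∑ i ∈ s, variance (t i) P ≤ ∑ i ∈ s, γ ^ 2 * ∫ ω, ξ i ω ^ 2 ∂P := by
          refine Finset.sum_le_sum fun i _ => ?_
          refine (variance_le_expectation_sq (htm i).aestronglyMeasurable).trans ?_
          rw [← integral_const_mul]
          refine integral_mono (ht2 i).integrable_sq ((h2 i).integrable_sq.const_mul _) fun ω => ?_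
          simp only [Pi.pow_apply]
          rw [← sq_abs (ξ i ω), ← mul_pow]
          exact pow_le_pow_left₀ (htnn i ω) (htle i ω) 2
      _ = γ ^ 2 * ∑ i ∈ s, ∫ ω, ξ i ω ^ 2 ∂P := by rw [Finset.mul_sum]
      _ ≤ γ ^ 2 * 1 := by gcongr
      _ = γ ^ 2 := mul_one _
  -- On B, T is replaced by its mean at cost γ. With `hlower` and `hupper` this gives P(B)/2 - γ ≤
  -- (b - a)/2 + γ.
  have hBT : P.real B * (1 / 2) - γ ≤ ∫ ω in B, T ω ∂P := by
    have e : ∫ ω in B, T ω ∂P =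
        P.real B * (∫ ω, T ω ∂P) + ∫ ω in B, (T ω - ∫ ω', T ω' ∂P) ∂P := by
      rw [integral_sub hT1.integrableOn integrableOn_const]
      simp
    have e2 : -γ ≤ ∫ ω in B, (T ω - ∫ ω', T ω' ∂P) ∂P := by
      have hd : Integrable (fun ω => T ω - ∫ ω', T ω' ∂P) P := hT1.sub (integrable_const _)
      have := (abs_integral_le_integral_abs (f := fun ω => T ω - ∫ ω', T ω' ∂P)
        (μ := P.restrict B)).trans (setIntegral_le_integral hd.abs
          (Filter.Eventually.of_forall fun ω => abs_nonneg _))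
      exact (abs_le.1 (this.trans hdev)).1
    rw [e]
    have := mul_le_mul_of_nonneg_left hET (measureReal_nonneg (μ := P) (s := B))
    linarith
  linarith

-- Stein's method and the Berry-Esseen inequality.

theorem integral_le_integral_of_indepFun {U V : Ω → ℝ} (hU : Measurable U) (hV : Measurable V)
    (hUV : IndepFun U V P) {h : ℝ → ℝ → ℝ} (hh : Measurable (Function.uncurry h))
    (hint : Integrable (fun ω => h (U ω) (V ω)) P) {B : ℝ → ℝ} (hB : Measurable B)
    (hBint : Integrable (fun ω => B (U ω)) P) (hle : ∀ u, ∫ ω, h u (V ω) ∂P ≤ B u) :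
    ∫ ω, h (U ω) (V ω) ∂P ≤ ∫ ω, B (U ω) ∂P := by
  have hmap := (indepFun_iff_map_prod_eq_prod_map_map hU.aemeasurable hV.aemeasurable).1 hUV
  have hUVm : AEMeasurable (fun ω => (U ω, V ω)) P := (hU.prodMk hV).aemeasurable
  have e1 : ∫ ω, h (U ω) (V ω) ∂P =
      ∫ z, Function.uncurry h z ∂((P.map U).prod (P.map V)) := by
    rw [← hmap, integral_map hUVm hh.aestronglyMeasurable]
    rfl
  have hint' : Integrable (Function.uncurry h) ((P.map U).prod (P.map V)) := by
    rw [← hmap, integrable_map_measure hh.aestronglyMeasurable hUVm]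
    exact hint
  have e2 : ∫ ω, B (U ω) ∂P = ∫ u, B u ∂(P.map U) :=
    (integral_map hU.aemeasurable hB.aestronglyMeasurable).symm
  have := Measure.isProbabilityMeasure_map (μ := P) hU.aemeasurable
  have := Measure.isProbabilityMeasure_map (μ := P) hV.aemeasurable
  rw [e1, e2, integral_prod _ hint']
  refine integral_mono hint'.integral_prod_left ?_ fun u => ?_
  · rw [integrable_map_measure hB.aestronglyMeasurable hU.aemeasurable]
    exact hBint
  · simp only [Function.uncurry]
    have hhu : Measurable (h u) := hh.comp (measurable_const.prodMk measurable_id)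
    rw [integral_map hV.aemeasurable hhu.aestronglyMeasurable]
    exact hle u

theorem measurable_steinModulus (z : ℝ) :
    Measurable (Function.uncurry fun u w => steinModulus z u w) := by
  unfold steinModulus Function.uncurry
  refine Measurable.add (by fun_prop) (Measurable.ite ?_ measurable_const measurable_const)
  exact measurableSet_le (by fun_prop) (by fun_prop)

theorem steinModulus_le (z u w : ℝ) : steinModulus z u w ≤ |u| * (5 + 2 * |w|) + 1 := by
  unfold steinModulus
  split_ifs <;> linarith

theorem measurable_steinDeriv (z : ℝ) : Measurable (steinDeriv z) := by
  unfold steinDeriv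
  refine Measurable.sub (Measurable.add ?_ ?_) measurable_const
  · exact measurable_id.mul (continuous_steinSol z).measurable
  · exact Measurable.ite measurableSet_Iic measurable_const measurable_const

/-- With t = E|X|, integrating x²t ≤ (2x³ + t³)/3 and the tangent inequality 3t²x - 2t³ ≤ x³ at x =
|X| gives the claim. It turns products of lower moments in Stein's error into third moments. -/
theorem integral_mul_integral_sq_le {X : Ω → ℝ} (h : MemLp X 3 P) :
    (∫ ω, X ω ^ 2 ∂P) * (∫ ω, |X ω| ∂P) ≤ ∫ ω, |X ω| ^ 3 ∂P := by
  have h3 := integrable_abs_pow_three h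
  have h2 := h.two_of_three.integrable_sq
  have h1 := (h.two_of_three.integrable (by norm_num)).abs
  set t := ∫ ω, |X ω| ∂P with ht
  have ht0 : 0 ≤ t := integral_nonneg fun ω => abs_nonneg _
  have ha : t ^ 3 ≤ ∫ ω, |X ω| ^ 3 ∂P := by
    have : ∫ ω, (3 * t ^ 2 * |X ω| - 2 * t ^ 3) ∂P ≤ ∫ ω, |X ω| ^ 3 ∂P := by
      refine integral_mono ((h1.const_mul _).sub (integrable_const _)) h3 fun ω => ?_
      have hx := abs_nonneg (X ω)
      have : 0 ≤ (|X ω| - t) ^ 2 * (|X ω| + 2 * t) := by positivity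
      simp only
      linarith
    rw [integral_sub (h1.const_mul _) (integrable_const _), integral_const_mul, ← ht] at this
    simp only [integral_const, probReal_univ, one_smul] at this
    linarith
  have hb : (∫ ω, X ω ^ 2 ∂P) * t ≤ (2 * (∫ ω, |X ω| ^ 3 ∂P) + t ^ 3) / 3 := by
    have : ∫ ω, X ω ^ 2 * t ∂P ≤ ∫ ω, (2 * |X ω| ^ 3 + t ^ 3) / 3 ∂P := by
      refine integral_mono (h2.mul_const _)
        (((h3.const_mul 2).add (integrable_const _)).div_const 3) fun ω => ?_
      have hx := abs_nonneg (X ω)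
      have : 0 ≤ (|X ω| - t) ^ 2 * (2 * |X ω| + t) := by positivity
      simp only
      rw [← sq_abs]
      linarith
    rw [integral_mul_const, integral_div, integral_add (h3.const_mul 2) (integrable_const _),
      integral_const_mul] at this
    simpa using this
  linarith

/-- The inequality x² ≤ (4/3)x³ + 1/12 for x ≥ 0, tight at x = 1/2, is integrated. It ensures that
removing one summand leaves variance at least 3/4. -/
theorem integral_sq_le_quarter {X : Ω → ℝ} (h : MemLp X 3 P)
    (h3 : ∫ ω, |X ω| ^ 3 ∂P ≤ 1 / 8) : ∫ ω, X ω ^ 2 ∂P ≤ 1 / 4 := by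
  have hi := integrable_abs_pow_three h
  have : ∫ ω, X ω ^ 2 ∂P ≤ ∫ ω, (4 / 3 * |X ω| ^ 3 + 1 / 12) ∂P := by
    refine integral_mono h.two_of_three.integrable_sq
      ((hi.const_mul _).add (integrable_const _)) fun ω => ?_
    have hx := abs_nonneg (X ω)
    have : 0 ≤ (|X ω| - 1 / 2) ^ 2 * (2 * |X ω| + 1 / 2) := by positivity
    simp only
    rw [← sq_abs]
    linarith
  rw [integral_add (hi.const_mul _) (integrable_const _), integral_const_mul] at this
  simp only [integral_const, probReal_univ, one_smul] at this
  linarith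

/-- One term of the Stein identity for a sum `V + U` with independent parts. -/
theorem abs_stein_term_le {U V : Ω → ℝ} (hU : Measurable U) (hV : Measurable V)
    (hUV : IndepFun U V P) (hU3 : MemLp U 3 P) (hU0 : ∫ ω, U ω ∂P = 0) (hV1 : Integrable V P)
    {z γ : ℝ} (hmod : ∀ u, ∫ ω, steinModulus z u (V ω) ∂P ≤ 9 * |u| + 4 * γ) :
    |(∫ ω, U ω ^ 2 ∂P) * (∫ ω, steinDeriv z (V ω + U ω) ∂P) -
      ∫ ω, U ω * steinSol z (V ω + U ω) ∂P| ≤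
      18 * (∫ ω, |U ω| ^ 3 ∂P) + 8 * γ * ∫ ω, U ω ^ 2 ∂P := by
  have hi3 := integrable_abs_pow_three hU3
  have hi2 := hU3.two_of_three.integrable_sq
  have hi1 : Integrable U P := hU3.two_of_three.integrable (by norm_num)
  have hdb : ∀ Y : Ω → ℝ, Measurable Y → Integrable (fun ω => steinDeriv z (Y ω)) P :=
    fun Y hY => Integrable.of_bound ((measurable_steinDeriv z).comp hY).aestronglyMeasurable 2
      (Filter.Eventually.of_forall fun ω => abs_steinDeriv_le z (Y ω))
  have hVU : Measurable fun ω => V ω + U ω := hV.add hU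
  have hmm : Measurable fun ω => steinModulus z (U ω) (V ω) :=
    (measurable_steinModulus z).comp (hU.prodMk hV)
  have hUV1 : Integrable (fun ω => |U ω| * |V ω|) P :=
    (hUV.comp measurable_abs measurable_abs).integrable_mul hi1.abs hV1.abs
  have hUV3 : Integrable (fun ω => |U ω| ^ 3 * |V ω|) P :=
    (hUV.comp (φ := fun x => |x| ^ 3) (by fun_prop) measurable_abs).integrable_mul hi3 hV1.abs
  have hm1 : Integrable (fun ω => steinModulus z (U ω) (V ω)) P := by
    refine Integrable.mono' (g := fun ω => 5 * |U ω| + 2 * (|U ω| * |V ω|) + 1)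
      (((hi1.abs.const_mul 5).add (hUV1.const_mul 2)).add (integrable_const 1))
      hmm.aestronglyMeasurable (Filter.Eventually.of_forall fun ω => ?_)
    rw [Real.norm_eq_abs, abs_of_nonneg (steinModulus_nonneg _ _ _)]
    have := steinModulus_le z (U ω) (V ω)
    linarith
  have hm2 : Integrable (fun ω => U ω ^ 2 * steinModulus z (U ω) (V ω)) P := by
    refine Integrable.mono' (g := fun ω => 5 * |U ω| ^ 3 + 2 * (|U ω| ^ 3 * |V ω|) + U ω ^ 2)
      (((hi3.const_mul 5).add (hUV3.const_mul 2)).add hi2)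
      ((hU.pow_const 2).mul hmm).aestronglyMeasurable (Filter.Eventually.of_forall fun ω => ?_)
    rw [Real.norm_eq_abs, abs_of_nonneg (mul_nonneg (sq_nonneg _) (steinModulus_nonneg _ _ _))]
    have := mul_le_mul_of_nonneg_left (steinModulus_le z (U ω) (V ω)) (sq_nonneg (U ω))
    rw [← sq_abs (U ω)] at this ⊢
    linarith
  have b1 : ∫ ω, steinModulus z (U ω) (V ω) ∂P ≤ 9 * (∫ ω, |U ω| ∂P) + 4 * γ := by
    have := integral_le_integral_of_indepFun hU hV hUV (measurable_steinModulus z) hm1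
      (B := fun u => 9 * |u| + 4 * γ) (by fun_prop)
      ((hi1.abs.const_mul 9).add (integrable_const _)) hmod
    rw [integral_add (hi1.abs.const_mul 9) (integrable_const _), integral_const_mul] at this
    simpa using this
  have b2 : ∫ ω, U ω ^ 2 * steinModulus z (U ω) (V ω) ∂P ≤
      9 * (∫ ω, |U ω| ^ 3 ∂P) + 4 * γ * ∫ ω, U ω ^ 2 ∂P := by
    have hsm : Measurable (Function.uncurry fun u w => u ^ 2 * steinModulus z u w) := by
      have := (measurable_fst.pow_const 2).mul (measurable_steinModulus z)
      convert this using 1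
      ext x
      rfl
    have := integral_le_integral_of_indepFun hU hV hUV
      (h := fun u w => u ^ 2 * steinModulus z u w)
      hsm hm2
      (B := fun u => 9 * |u| ^ 3 + 4 * γ * u ^ 2) (by fun_prop)
      ((hi3.const_mul 9).add (hi2.const_mul _)) (fun u => by
        rw [integral_const_mul]
        refine (mul_le_mul_of_nonneg_left (hmod u) (sq_nonneg u)).trans (le_of_eq ?_)
        rw [← sq_abs]
        ring)
    rwa [integral_add (hi3.const_mul 9) (hi2.const_mul _), integral_const_mul,
      integral_const_mul] at this
  -- This is the cost of decoupling f' from U; it is later multiplied by E U², and E U² E|U| ≤ E|U|³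
  -- makes it as small as the Taylor error `c2`.
  have c1 : |∫ ω, steinDeriv z (V ω + U ω) ∂P - ∫ ω, steinDeriv z (V ω) ∂P| ≤
      9 * (∫ ω, |U ω| ∂P) + 4 * γ := by
    rw [← integral_sub (hdb _ hVU) (hdb _ hV)]
    refine (abs_integral_le_integral_abs).trans (le_trans ?_ b1)
    exact integral_mono ((hdb _ hVU).sub (hdb _ hV)).abs hm1
      fun ω => abs_steinDeriv_sub_le z (U ω) (V ω)
  have hfs : ∀ Y : Ω → ℝ, Measurable Y → Integrable (fun ω => U ω * steinSol z (Y ω)) P := by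
    intro Y hY
    have := Integrable.bdd_mul hi1 ((continuous_steinSol z).measurable.comp hY).aestronglyMeasurable
      (Filter.Eventually.of_forall fun ω => show ‖(steinSol z ∘ Y) ω‖ ≤ 5 by
        rw [Function.comp, Real.norm_eq_abs, abs_of_nonneg (steinSol_nonneg _ _)]
        exact steinSol_le_five _ _)
    exact this.congr (Filter.Eventually.of_forall fun ω => mul_comm _ _)
  have hi2d : Integrable (fun ω => U ω ^ 2 * steinDeriv z (V ω)) P := by
    have := Integrable.bdd_mul hi2 ((measurable_steinDeriv z).comp hV).aestronglyMeasurable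
      (Filter.Eventually.of_forall fun ω => abs_steinDeriv_le z (V ω))
    exact this.congr (Filter.Eventually.of_forall fun ω => mul_comm _ _)
  have d1 : ∫ ω, U ω * steinSol z (V ω) ∂P = 0 := by
    have := (hUV.comp (φ := fun x => x) measurable_id
      (continuous_steinSol z).measurable).integral_fun_mul_eq_mul_integral
      hU.aestronglyMeasurable ((continuous_steinSol z).measurable.comp hV).aestronglyMeasurable
    have h0' : ∫ ω, ((fun x : ℝ => x) ∘ U) ω ∂P = 0 := hU0
    rw [h0', zero_mul] at this
    exact this
  have d2 : ∫ ω, U ω ^ 2 * steinDeriv z (V ω) ∂P =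
      (∫ ω, U ω ^ 2 ∂P) * ∫ ω, steinDeriv z (V ω) ∂P :=
    (hUV.comp (φ := fun x => x ^ 2) (by fun_prop)
      (measurable_steinDeriv z)).integral_fun_mul_eq_mul_integral
      (hU.pow_const 2).aestronglyMeasurable
      ((measurable_steinDeriv z).comp hV).aestronglyMeasurable
  -- Independence and E U = 0 allow U f(V) to be subtracted for free, so the difference is an
  -- integrated first order Taylor remainder of f at V.
  have c2 : |(∫ ω, U ω ^ 2 ∂P) * (∫ ω, steinDeriv z (V ω) ∂P) -
      ∫ ω, U ω * steinSol z (V ω + U ω) ∂P| ≤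
      9 * (∫ ω, |U ω| ^ 3 ∂P) + 4 * γ * ∫ ω, U ω ^ 2 ∂P := by
    have e : ∫ ω, U ω * steinSol z (V ω + U ω) ∂P -
        (∫ ω, U ω ^ 2 ∂P) * (∫ ω, steinDeriv z (V ω) ∂P) =
        ∫ ω, (U ω * steinSol z (V ω + U ω) - U ω * steinSol z (V ω) -
          U ω ^ 2 * steinDeriv z (V ω)) ∂P := by
      rw [integral_sub (f := fun ω => U ω * steinSol z (V ω + U ω) - U ω * steinSol z (V ω))
        ((hfs _ hVU).sub (hfs _ hV)) hi2d, integral_sub (hfs _ hVU) (hfs _ hV), d1, d2, sub_zero]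
    rw [abs_sub_comm, e]
    refine (abs_integral_le_integral_abs).trans (le_trans ?_ b2)
    refine integral_mono (((hfs _ hVU).sub (hfs _ hV)).sub hi2d).abs hm2 fun ω => ?_
    have h := abs_steinSol_taylor z (U ω) (V ω)
    have e2 : U ω * steinSol z (V ω + U ω) - U ω * steinSol z (V ω) -
          U ω ^ 2 * steinDeriv z (V ω) =
        U ω * (steinSol z (V ω + U ω) - steinSol z (V ω) - U ω * steinDeriv z (V ω)) := by ring
    simp only [e2, abs_mul]
    refine (mul_le_mul_of_nonneg_left h (abs_nonneg _)).trans (le_of_eq ?_)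
    rw [← sq_abs]
    ring
  have hs2 : 0 ≤ ∫ ω, U ω ^ 2 ∂P := integral_nonneg fun ω => sq_nonneg _
  have c3 := mul_le_mul_of_nonneg_left c1 hs2
  rw [← abs_of_nonneg hs2, ← abs_mul, abs_of_nonneg hs2] at c3
  have c4 := integral_mul_integral_sq_le hU3
  have c5 := (abs_add_le _ _).trans (add_le_add c3 c2)
  have e3 : (∫ ω, U ω ^ 2 ∂P) * (∫ ω, steinDeriv z (V ω + U ω) ∂P) -
      ∫ ω, U ω * steinSol z (V ω + U ω) ∂P =
      (∫ ω, U ω ^ 2 ∂P) * (∫ ω, steinDeriv z (V ω + U ω) ∂P - ∫ ω, steinDeriv z (V ω) ∂P) +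
      ((∫ ω, U ω ^ 2 ∂P) * (∫ ω, steinDeriv z (V ω) ∂P) -
      ∫ ω, U ω * steinSol z (V ω + U ω) ∂P) := by ring
  rw [e3]
  linarith

/-- The Berry-Esseen inequality for independent summands with total variance one. -/
theorem berryEsseen_of_iIndepFun [Fintype ι] {ξ : ι → Ω → ℝ} (hm : ∀ i, Measurable (ξ i))
    (hind : iIndepFun ξ P) (h3 : ∀ i, MemLp (ξ i) 3 P) (h0 : ∀ i, ∫ ω, ξ i ω ∂P = 0)
    (hvar : ∑ i, ∫ ω, ξ i ω ^ 2 ∂P = 1) {γ : ℝ} (hγ : 0 < γ)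
    (h3γ : ∑ i, ∫ ω, |ξ i ω| ^ 3 ∂P ≤ γ) (z : ℝ) :
    |P.real {ω | ∑ i, ξ i ω ≤ z} - gaussCDF z| ≤ 26 * γ := by
  classical
  -- For γ > 1/8 the bound 26γ exceeds one and there is nothing to prove.
  rcases lt_or_ge (1 / 8) γ with hbig | hsmall
  · have h1 := measureReal_nonneg (μ := P) (s := {ω | ∑ i, ξ i ω ≤ z})
    have h2 := measureReal_le_one (μ := P) (s := {ω | ∑ i, ξ i ω ≤ z})
    have h3 := gaussCDF_nonneg z
    have h4 := gaussCDF_le_one z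
    rw [abs_le]
    constructor <;> linarith
  have h2 : ∀ i, MemLp (ξ i) 2 P := fun i => (h3 i).two_of_three
  set W : Ω → ℝ := fun ω => ∑ i, ξ i ω with hW
  have hWm : Measurable W := Finset.measurable_sum _ fun i _ => hm i
  set V : ι → Ω → ℝ := fun i ω => ∑ j ∈ Finset.univ.erase i, ξ j ω with hV
  have hVm : ∀ i, Measurable (V i) := fun i => Finset.measurable_sum _ fun j _ => hm j
  have hVW : ∀ i ω, V i ω + ξ i ω = W ω := fun i ω =>
    Finset.sum_erase_add _ _ (Finset.mem_univ i)
  have hV2 : ∀ i, MemLp (V i) 2 P := fun i => memLp_finsetSum _ fun j _ => h2 j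
  have hsq : ∀ i, 0 ≤ ∫ ω, ξ i ω ^ 2 ∂P := fun i => integral_nonneg fun ω => sq_nonneg _
  have hcu : ∀ i, 0 ≤ ∫ ω, |ξ i ω| ^ 3 ∂P := fun i => integral_nonneg fun ω => by positivity
  have hcuγ : ∀ i, ∫ ω, |ξ i ω| ^ 3 ∂P ≤ γ := fun i =>
    (Finset.single_le_sum (fun j _ => hcu j) (Finset.mem_univ i)).trans h3γ
  have hVar : ∀ i, ∑ j ∈ Finset.univ.erase i, ∫ ω, ξ j ω ^ 2 ∂P = 1 - ∫ ω, ξ i ω ^ 2 ∂P := by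
    intro i
    rw [← hvar, ← Finset.sum_erase_add _ _ (Finset.mem_univ i)]
    ring
  -- The Lipschitz part contributes (5 + 2 E|V_i|)|u| ≤ 7|u|, and concentration on the window of
  -- length 2|u| around z contributes 2|u| + 4γ.
  have hmod : ∀ i u, ∫ ω, steinModulus z u (V i ω) ∂P ≤ 9 * |u| + 4 * γ := by
    intro i u
    have hab : ∫ ω, |V i ω| ∂P ≤ 1 := integral_abs_le_of_integral_sq_le (hV2 i) one_pos (by
      rw [hV, integral_sq_sum_of_iIndepFun hm hind h2 h0, hVar i]
      linarith [hsq i])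
    have hconc := concentration_of_iIndepFun hm hind h3 h0 (Finset.univ.erase i)
      (by rw [hVar i]; linarith [integral_sq_le_quarter (h3 i) ((hcuγ i).trans hsmall)])
      (by rw [hVar i]; linarith [hsq i]) hγ
      ((Finset.sum_le_sum_of_subset_of_nonneg (Finset.erase_subset _ _)
        fun j _ _ => hcu j).trans h3γ) (a := z - |u|) (b := z + |u|)
      (by linarith [abs_nonneg u])
    have hset : {ω | |V i ω - z| ≤ |u|} = {ω | z - |u| ≤ V i ω ∧ V i ω ≤ z + |u|} := by
      ext ω
      simp only [Set.mem_ofPred_eq, abs_le]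
      constructor <;> rintro ⟨h1, h2⟩ <;> constructor <;> linarith
    have hms : MeasurableSet {ω | |V i ω - z| ≤ |u|} :=
      measurableSet_le ((hVm i).sub_const z).abs measurable_const
    have hiV : Integrable (fun ω => |V i ω|) P := ((hV2 i).integrable (by norm_num)).abs
    have e : ∫ ω, steinModulus z u (V i ω) ∂P =
        |u| * (5 + 2 * ∫ ω, |V i ω| ∂P) + P.real {ω | |V i ω - z| ≤ |u|} := by
      have e1 : (fun ω => steinModulus z u (V i ω)) = fun ω => |u| * (5 + 2 * |V i ω|) +
          Set.indicator {ω | |V i ω - z| ≤ |u|} (fun _ => (1 : ℝ)) ω := by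
        ext ω
        simp [steinModulus, Set.indicator]
      rw [e1, integral_add, integral_const_mul, integral_add (integrable_const _)
        (hiV.const_mul 2), integral_const_mul, integral_indicator hms]
      · simp
      · exact ((integrable_const _).add (hiV.const_mul 2)).const_mul _
      · exact (integrable_const _).indicator hms
    rw [e, hset]
    have : |u| * (5 + 2 * ∫ ω, |V i ω| ∂P) ≤ |u| * (5 + 2 * 1) := by gcongr
    linarith
  have hterm : ∀ i, |(∫ ω, ξ i ω ^ 2 ∂P) * (∫ ω, steinDeriv z (W ω) ∂P) -
      ∫ ω, ξ i ω * steinSol z (W ω) ∂P| ≤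
      18 * (∫ ω, |ξ i ω| ^ 3 ∂P) + 8 * γ * ∫ ω, ξ i ω ^ 2 ∂P := by
    intro i
    have hi := (hind.indepFun_finsetSum_of_notMem hm (Finset.notMem_erase i Finset.univ)).symm
    have hVeq : V i = ∑ j ∈ Finset.univ.erase i, ξ j := by ext ω; simp [hV]
    rw [← hVeq] at hi
    have := abs_stein_term_le (hm i) (hVm i) hi (h3 i) (h0 i) ((hV2 i).integrable (by norm_num))
      (hmod i)
    simpa only [hVW] using this
  have hsum := (Finset.abs_sum_le_sum_abs _ Finset.univ).trans
    (Finset.sum_le_sum fun i _ => hterm i)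
  have hfi : ∀ i, Integrable (fun ω => ξ i ω * steinSol z (W ω)) P := by
    intro i
    have := Integrable.bdd_mul ((h2 i).integrable (by norm_num))
      ((continuous_steinSol z).measurable.comp hWm).aestronglyMeasurable
      (Filter.Eventually.of_forall fun ω => show ‖(steinSol z ∘ W) ω‖ ≤ 5 by
        rw [Function.comp, Real.norm_eq_abs, abs_of_nonneg (steinSol_nonneg _ _)]
        exact steinSol_le_five _ _)
    exact this.congr (Filter.Eventually.of_forall fun ω => mul_comm _ _)
  -- Stein's equation integrated at W, with E f'(W) distributed over the indices in proportion to
  -- their variances, which sum to one.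
  have hmain : P.real {ω | W ω ≤ z} - gaussCDF z =
      ∑ i, ((∫ ω, ξ i ω ^ 2 ∂P) * (∫ ω, steinDeriv z (W ω) ∂P) -
      ∫ ω, ξ i ω * steinSol z (W ω) ∂P) := by
    rw [Finset.sum_sub_distrib, ← Finset.sum_mul, hvar, one_mul,
      ← integral_finsetSum _ fun i _ => hfi i, ← integral_sub]
    · have e1 : ∀ ω, steinDeriv z (W ω) - ∑ i, ξ i ω * steinSol z (W ω) =
          Set.indicator {ω | W ω ≤ z} (fun _ => (1 : ℝ)) ω - gaussCDF z := by
        intro ω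
        rw [← Finset.sum_mul]
        simp only [steinDeriv, hW, Set.indicator, Set.mem_ofPred_eq]
        ring
      have hms : MeasurableSet {ω | W ω ≤ z} := measurableSet_le hWm measurable_const
      simp only [e1]
      rw [integral_sub ((integrable_const _).indicator hms) (integrable_const _),
        integral_indicator hms]
      simp
    · exact Integrable.of_bound ((measurable_steinDeriv z).comp hWm).aestronglyMeasurable 2
        (Filter.Eventually.of_forall fun ω => abs_steinDeriv_le z (W ω))
    · exact integrable_finsetSum _ fun i _ => hfi i
  rw [hmain]
  refine hsum.trans ?_
  rw [Finset.sum_add_distrib, ← Finset.mul_sum, ← Finset.mul_sum, hvar]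
  linarith

end Independent

/-! ### The chain of tree sizes -/

section SizeChain

open scoped NNReal
open Finset Function

variable {V : Type*} [AddCommMonoid V] [Module ℝ≥0 V]

/-- The expectation of `G` applied to the vector of tree sizes at time `n + 1`; the tree rooted at
the vertex `k` is listed at index `k`. A new vertex is a new root with weight `p` and joins a
uniformly chosen vertex with weight `q`. -/
noncomputable def sizeExp (p q : ℝ≥0) : ℕ → ((ℕ → ℕ) → V) → V
  | 0, G => G (update 0 1 1)
  -- The last transition is averaged first, so the recursion acts on the test function. Values in a
  -- module let the same operator serve for real and complex expectations and for mixtures of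
  -- measures.
  | n + 1, G => sizeExp p q n fun s => p • G (update s (n + 2) 1) +
      ∑ j ∈ Icc 1 (n + 1), (q * s j / (n + 1)) • G (update s j (s j + 1))

/-- The vectors of tree sizes that can occur at time `n + 1`. -/
def IsSizeVector (n : ℕ) (s : ℕ → ℕ) : Prop :=
  (∀ k, k ∉ Icc 1 (n + 1) → s k = 0) ∧ ∑ k ∈ Icc 1 (n + 1), s k = n + 1

theorem Icc_succ_eq_insert (n : ℕ) : Icc 1 (n + 1 + 1) = insert (n + 2) (Icc 1 (n + 1)) := by
  ext k
  simp only [mem_Icc, mem_insert]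
  omega

theorem succ_succ_notMem_Icc (n : ℕ) : n + 2 ∉ Icc 1 (n + 1) := by simp

theorem sum_Icc_update_new {M : Type*} [AddCommMonoid M] (f : ℕ → M) (n : ℕ) (s : ℕ → ℕ) :
    ∑ k ∈ Icc 1 (n + 1 + 1), f (update s (n + 2) 1 k) = f 1 + ∑ k ∈ Icc 1 (n + 1), f (s k) := by
  rw [Icc_succ_eq_insert, sum_insert (succ_succ_notMem_Icc n), update_self]
  congr 1
  refine sum_congr rfl fun k hk => ?_
  rw [update_of_ne]
  rintro rfl
  exact succ_succ_notMem_Icc n hk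

theorem sum_Icc_update_old {M : Type*} [AddCommGroup M] (f : ℕ → M) (h0 : f 0 = 0) {n : ℕ}
    {s : ℕ → ℕ} (hs : IsSizeVector n s) {j : ℕ} (hj : j ∈ Icc 1 (n + 1)) :
    ∑ k ∈ Icc 1 (n + 1 + 1), f (update s j (s j + 1) k) =
      ∑ k ∈ Icc 1 (n + 1), f (s k) + (f (s j + 1) - f (s j)) := by
  have hne : n + 2 ≠ j := by
    rintro rfl
    exact succ_succ_notMem_Icc n hj
  rw [Icc_succ_eq_insert, sum_insert (succ_succ_notMem_Icc n), update_of_ne hne,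
    hs.1 _ (succ_succ_notMem_Icc n), h0, zero_add, ← add_sum_erase _ _ hj, update_self,
    ← add_sum_erase (Icc 1 (n + 1)) (fun k => f (s k)) hj]
  have : ∑ k ∈ (Icc 1 (n + 1)).erase j, f (update s j (s j + 1) k) =
      ∑ k ∈ (Icc 1 (n + 1)).erase j, f (s k) :=
    sum_congr rfl fun k hk => by rw [update_of_ne (ne_of_mem_erase hk)]
  rw [this]
  abel

theorem isSizeVector_zero : IsSizeVector 0 (update 0 1 1) := by
  refine ⟨fun k hk => ?_, by simp⟩
  rw [update_of_ne]
  · rfl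
  · rintro rfl
    simp at hk

theorem IsSizeVector.update_new {n : ℕ} {s : ℕ → ℕ} (hs : IsSizeVector n s) :
    IsSizeVector (n + 1) (update s (n + 2) 1) := by
  refine ⟨fun k hk => ?_, ?_⟩
  · rw [Icc_succ_eq_insert, mem_insert, not_or] at hk
    rw [update_of_ne hk.1]
    exact hs.1 k hk.2
  · rw [sum_Icc_update_new (fun k => k), hs.2]
    ring

theorem IsSizeVector.update_old {n : ℕ} {s : ℕ → ℕ} (hs : IsSizeVector n s) {j : ℕ}
    (hj : j ∈ Icc 1 (n + 1)) : IsSizeVector (n + 1) (update s j (s j + 1)) := by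
  refine ⟨fun k hk => ?_, ?_⟩
  · rw [Icc_succ_eq_insert, mem_insert, not_or] at hk
    rw [update_of_ne]
    · exact hs.1 k hk.2
    · rintro rfl
      exact hk.2 hj
  · have h := sum_Icc_update_old (fun k => (k : ℤ)) (by simp) hs hj
    have h2 : ((∑ k ∈ Icc 1 (n + 1), s k : ℕ) : ℤ) = n + 1 := by rw [hs.2]; push_cast; ring
    push_cast at h2
    have : ((∑ k ∈ Icc 1 (n + 1 + 1), update s j (s j + 1) k : ℕ) : ℤ) = ((n + 1 + 1 : ℕ) : ℤ) := by
      push_cast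
      rw [h, h2]
      push_cast
      ring
    exact_mod_cast this

/-- Both transitions preserve `IsSizeVector`, so the conservation law Σ s = n + 1 may be used under
the expectation. -/
theorem sizeExp_congr (p q : ℝ≥0) {n : ℕ} {G H : (ℕ → ℕ) → V}
    (h : ∀ s, IsSizeVector n s → G s = H s) : sizeExp p q n G = sizeExp p q n H := by
  induction n generalizing G H with
  | zero => exact h _ isSizeVector_zero
  | succ n ih =>
    refine ih fun s hs => ?_
    rw [h _ hs.update_new]
    congr 1
    exact sum_congr rfl fun j hj => by rw [h _ (hs.update_old hj)]

theorem sizeExp_add (p q : ℝ≥0) (n : ℕ) (G H : (ℕ → ℕ) → V) :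
    sizeExp p q n (fun s => G s + H s) = sizeExp p q n G + sizeExp p q n H := by
  induction n generalizing G H with
  | zero => rfl
  | succ n ih =>
    simp only [sizeExp]
    rw [← ih]
    refine sizeExp_congr _ _ fun s _ => ?_
    simp only [smul_add, sum_add_distrib]
    abel

theorem sizeExp_const {p q : ℝ≥0} (hpq : p + q = 1) (n : ℕ) (c : V) :
    sizeExp p q n (fun _ => c) = c := by
  induction n with
  | zero => rfl
  | succ n ih =>
    rw [sizeExp, sizeExp_congr p q (H := fun _ => c)]
    · exact ih
    · intro s hs
      rw [← sum_smul, ← add_smul]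
      have : ∑ j ∈ Icc 1 (n + 1), q * (s j : ℝ≥0) / (n + 1) = q := by
        rw [← sum_div, ← mul_sum, ← Nat.cast_sum, hs.2]
        push_cast
        field_simp
      rw [this, hpq, one_smul]

theorem sizeExp_map {V' : Type*} [AddCommMonoid V'] [Module ℝ≥0 V'] (L : V →ₗ[ℝ≥0] V')
    (p q : ℝ≥0) (n : ℕ) (G : (ℕ → ℕ) → V) :
    L (sizeExp p q n G) = sizeExp p q n fun s => L (G s) := by
  induction n generalizing G with
  | zero => rfl
  | succ n ih =>
    simp only [sizeExp]
    rw [ih]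
    simp

theorem sizeExp_succ_real (p q : ℝ≥0) (n : ℕ) (G : (ℕ → ℕ) → ℝ) :
    sizeExp p q (n + 1) G = sizeExp p q n fun s => p * G (update s (n + 2) 1) +
      q / (n + 1) * ∑ j ∈ Icc 1 (n + 1), s j * G (update s j (s j + 1)) := by
  rw [sizeExp]
  refine sizeExp_congr _ _ fun s _ => ?_
  simp only [NNReal.smul_def, smul_eq_mul, mul_sum]
  congr 1
  refine sum_congr rfl fun j _ => ?_
  push_cast
  ring

theorem sizeExp_mono (p q : ℝ≥0) {n : ℕ} {G H : (ℕ → ℕ) → ℝ}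
    (h : ∀ s, IsSizeVector n s → G s ≤ H s) : sizeExp p q n G ≤ sizeExp p q n H := by
  induction n generalizing G H with
  | zero => exact h _ isSizeVector_zero
  | succ n ih =>
    rw [sizeExp_succ_real, sizeExp_succ_real]
    refine ih fun s hs => ?_
    have h1 := h _ hs.update_new
    have h2 : ∀ j ∈ Icc 1 (n + 1), G (update s j (s j + 1)) ≤ H (update s j (s j + 1)) :=
      fun j hj => h _ (hs.update_old hj)
    gcongr with j hj
    exact h2 j hj

theorem sizeExp_const_mul (p q : ℝ≥0) (n : ℕ) (c : ℝ) (G : (ℕ → ℕ) → ℝ) :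
    sizeExp p q n (fun s => c * G s) = c * sizeExp p q n G :=
  (sizeExp_map ((LinearMap.mulLeft ℝ c).restrictScalars ℝ≥0) p q n G).symm

theorem sizeExp_sub (p q : ℝ≥0) (n : ℕ) (G H : (ℕ → ℕ) → ℝ) :
    sizeExp p q n (fun s => G s - H s) = sizeExp p q n G - sizeExp p q n H := by
  have := sizeExp_add p q n (fun s => G s - H s) H
  simp only [sub_add_cancel] at this
  linarith

theorem abs_sizeExp_le (p q : ℝ≥0) {n : ℕ} {G H : (ℕ → ℕ) → ℝ}
    (h : ∀ s, IsSizeVector n s → |G s| ≤ H s) : |sizeExp p q n G| ≤ sizeExp p q n H := by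
  rw [abs_le]
  constructor
  · have := sizeExp_mono p q (n := n) (G := fun s => -1 * H s) (H := G) fun s hs => by
      linarith [(abs_le.1 (h s hs)).1]
    rw [sizeExp_const_mul] at this
    linarith
  · exact sizeExp_mono p q fun s hs => (abs_le.1 (h s hs)).2

/-- The number of trees of size `r` at time `n + 1`. -/
noncomputable def treeCount (r n : ℕ) (s : ℕ → ℕ) : ℝ :=
  ∑ k ∈ Icc 1 (n + 1), if s k = r then 1 else 0

theorem treeCount_nonneg (r n : ℕ) (s : ℕ → ℕ) : 0 ≤ treeCount r n s :=
  sum_nonneg fun k _ => by split_ifs <;> norm_num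

theorem IsSizeVector.sum_cast {n : ℕ} {s : ℕ → ℕ} (hs : IsSizeVector n s) :
    ∑ k ∈ Icc 1 (n + 1), (s k : ℝ) = n + 1 := by
  rw [← Nat.cast_sum, hs.2]
  push_cast
  ring

theorem treeCount_one_add_two_le {n : ℕ} {s : ℕ → ℕ} (hs : IsSizeVector n s) :
    treeCount 1 n s + 2 * treeCount 2 n s ≤ n + 1 := by
  rw [← hs.sum_cast, treeCount, treeCount, mul_sum, ← sum_add_distrib]
  refine sum_le_sum fun k _ => ?_
  split_ifs with h1 h2 h2
  · omega
  · rw [h1]; norm_num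
  · rw [h2]; norm_num
  · simp

/-- The transition of the numbers of trees of sizes one and two. -/
theorem sizeExp_succ_treeCount (p q : ℝ≥0) (n : ℕ) (G : ℝ → ℝ → ℝ) :
    sizeExp p q (n + 1) (fun s => G (treeCount 1 (n + 1) s) (treeCount 2 (n + 1) s)) =
    sizeExp p q n fun s => p * G (treeCount 1 n s + 1) (treeCount 2 n s) +
      q / (n + 1) * (treeCount 1 n s * G (treeCount 1 n s - 1) (treeCount 2 n s + 1) +
        2 * treeCount 2 n s * G (treeCount 1 n s) (treeCount 2 n s - 1) +
        (n + 1 - treeCount 1 n s - 2 * treeCount 2 n s) *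
          G (treeCount 1 n s) (treeCount 2 n s)) := by
  rw [sizeExp_succ_real]
  refine sizeExp_congr _ _ fun s hs => ?_
  have e1 : treeCount 1 (n + 1) (update s (n + 2) 1) = treeCount 1 n s + 1 := by
    unfold treeCount
    rw [sum_Icc_update_new (fun k => if k = 1 then (1 : ℝ) else 0), add_comm]
    simp
  have e2 : treeCount 2 (n + 1) (update s (n + 2) 1) = treeCount 2 n s := by
    unfold treeCount
    rw [sum_Icc_update_new (fun k => if k = 2 then (1 : ℝ) else 0)]
    simp
  rw [e1, e2]
  congr 2
  have hsum : (n : ℝ) + 1 - treeCount 1 n s - 2 * treeCount 2 n s =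
      ∑ k ∈ Icc 1 (n + 1), ((s k : ℝ) - (if s k = 1 then 1 else 0) -
        2 * (if s k = 2 then 1 else 0)) := by
    rw [sum_sub_distrib, sum_sub_distrib, hs.sum_cast, ← mul_sum]
    rfl
  -- Growing a tree of size one turns it into one of size two, growing one of size two removes it
  -- from both counts, and larger trees change neither. The two counts therefore form a Markov chain
  -- by themselves.
  have hj : ∀ j ∈ Icc 1 (n + 1), (s j : ℝ) * G (treeCount 1 (n + 1) (update s j (s j + 1)))
      (treeCount 2 (n + 1) (update s j (s j + 1))) =
      (if s j = 1 then 1 else 0) * G (treeCount 1 n s - 1) (treeCount 2 n s + 1) +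
      2 * (if s j = 2 then 1 else 0) * G (treeCount 1 n s) (treeCount 2 n s - 1) +
      ((s j : ℝ) - (if s j = 1 then 1 else 0) - 2 * (if s j = 2 then 1 else 0)) *
        G (treeCount 1 n s) (treeCount 2 n s) := by
    intro j hj
    have e3 : treeCount 1 (n + 1) (update s j (s j + 1)) = treeCount 1 n s +
        ((if s j + 1 = 1 then (1 : ℝ) else 0) - if s j = 1 then 1 else 0) :=
      sum_Icc_update_old (fun k => if k = 1 then (1 : ℝ) else 0) (by simp) hs hj
    have e4 : treeCount 2 (n + 1) (update s j (s j + 1)) = treeCount 2 n s +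
        ((if s j + 1 = 2 then (1 : ℝ) else 0) - if s j = 2 then 1 else 0) :=
      sum_Icc_update_old (fun k => if k = 2 then (1 : ℝ) else 0) (by simp) hs hj
    rw [e3, e4]
    generalize s j = r
    match r with
    | 0 => simp
    | 1 => simp [sub_eq_add_neg]
    | 2 => simp [sub_eq_add_neg]
    | r + 3 => simp
  rw [sum_congr rfl hj, hsum, sum_add_distrib, sum_add_distrib, ← sum_mul, ← sum_mul, ← sum_mul,
    ← mul_sum]
  rfl

end SizeChain

-- Moments of the tree counts and of the sum of sizes to the power 3/2.

section SizeMoments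

open scoped NNReal
open Finset Function

theorem treeCount_one_init : treeCount 1 0 (update 0 1 1) = 1 := by
  rw [treeCount, zero_add, Icc_self, sum_singleton, update_self, if_pos rfl]

theorem treeCount_two_init : treeCount 2 0 (update 0 1 1) = 0 := by
  rw [treeCount, zero_add, Icc_self, sum_singleton, update_self, if_neg (by norm_num)]

/-- The drift of N₁ is p - q N₁/N, and a₁ is the slope at which it balances. The centred count is
thus multiplied by 1 - q/N in conditional mean, and the conditional variance p + qx - (p - qx)²,
where x = N₁/N, is at most 1; the second moment grows by at most one per step. -/
theorem sizeExp_treeCount_one_sq_le {p q : ℝ≥0} (hpq : p + q = 1) {a₁ : ℝ}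
    (h₁ : a₁ * (1 + q) = p) (n : ℕ) :
    sizeExp p q n (fun s => (treeCount 1 n s - a₁ * (n + 1)) ^ 2) ≤ (n + 1 : ℝ) := by
  have hq0 : (0 : ℝ) ≤ q := q.2
  have hp0 : (0 : ℝ) ≤ p := p.2
  have hpq' : (p : ℝ) + q = 1 := by exact_mod_cast hpq
  have ha0 : 0 ≤ a₁ := by
    by_contra h
    nlinarith
  have ha1 : a₁ ≤ 1 := by nlinarith
  induction n with
  | zero =>
    simp only [sizeExp, treeCount_one_init]
    push_cast
    nlinarith
  | succ n ih =>
    have := sizeExp_succ_treeCount p q n (fun x _ => (x - a₁ * ((n + 1 : ℕ) + 1)) ^ 2)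
    rw [this]
    have hb : ∀ s, IsSizeVector n s →
        p * (treeCount 1 n s + 1 - a₁ * ((n + 1 : ℕ) + 1)) ^ 2 +
      q / (n + 1) * (treeCount 1 n s * (treeCount 1 n s - 1 - a₁ * ((n + 1 : ℕ) + 1)) ^ 2 +
        2 * treeCount 2 n s * (treeCount 1 n s - a₁ * ((n + 1 : ℕ) + 1)) ^ 2 +
        (n + 1 - treeCount 1 n s - 2 * treeCount 2 n s) *
          (treeCount 1 n s - a₁ * ((n + 1 : ℕ) + 1)) ^ 2) ≤
        (treeCount 1 n s - a₁ * (n + 1)) ^ 2 + 1 := by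
      intro s hs
      have hle := treeCount_one_add_two_le hs
      have h1 := treeCount_nonneg 1 n s
      have h2 := treeCount_nonneg 2 n s
      set N : ℝ := n + 1 with hN
      have hN1 : 1 ≤ N := by rw [hN]; linarith [Nat.cast_nonneg (α := ℝ) n]
      have hN0 : (0 : ℝ) < N := by linarith
      set x := treeCount 1 n s / N with hx
      have hxN : treeCount 1 n s = x * N := by rw [hx]; field_simp
      have hx0 : 0 ≤ x := by positivity
      have hx1 : x ≤ 1 := by rw [hx, div_le_one hN0]; linarith
      set r : ℝ := q / N with hr
      have hrN : (q : ℝ) = r * N := by rw [hr]; field_simp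
      have hr0 : 0 ≤ r := by positivity
      have hr1 : r ≤ 1 := by rw [hr, div_le_one hN0]; linarith
      push_cast
      rw [hxN, ← hN]
      have hp' : (p : ℝ) = 1 - q := by linarith
      have key : p * (x * N + 1 - a₁ * (N + 1)) ^ 2 +
          r * (x * N * (x * N - 1 - a₁ * (N + 1)) ^ 2 +
          2 * treeCount 2 n s * (x * N - a₁ * (N + 1)) ^ 2 +
          (N - x * N - 2 * treeCount 2 n s) * (x * N - a₁ * (N + 1)) ^ 2) =
          (1 - r) ^ 2 * (x * N - a₁ * N) ^ 2 + (p + q * x - (p - q * x) ^ 2) := by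
        have ha : a₁ * (1 + r * N) = 1 - r * N := by rw [← hrN, h₁, hp']
        rw [hp', hrN]
        linear_combination (-((2 - r) * (x * N - a₁ * N) - a₁ + 1 - r * N - r * N * x)) * ha
      rw [key]
      have : (1 - r) ^ 2 ≤ 1 := by nlinarith
      have : (1 - r) ^ 2 * (x * N - a₁ * N) ^ 2 ≤ 1 * (x * N - a₁ * N) ^ 2 := by gcongr
      nlinarith [sq_nonneg ((p : ℝ) - q * x)]
    refine (sizeExp_mono p q hb).trans ?_
    rw [sizeExp_add, sizeExp_const hpq]
    push_cast
    linarith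

/-- In conditional mean the deviation u of N₂ becomes (1 - 2q/N)u + (q/N)v, where v is the deviation
of N₁. The earlier bound on E v² limits the feedback from v to 1/2 per step, the noise adds at most
1, and 4 leaves room. -/
theorem sizeExp_treeCount_two_sq_le {p q : ℝ≥0} (hpq : p + q = 1) {a₁ a₂ : ℝ}
    (h₁ : a₁ * (1 + q) = p) (h₂ : a₂ * (1 + 2 * q) = q * a₁) (n : ℕ) :
    sizeExp p q n (fun s => (treeCount 2 n s - a₂ * (n + 1)) ^ 2) ≤ (4 * (n + 1) : ℝ) := by
  have hq0 : (0 : ℝ) ≤ q := q.2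
  have hp0 : (0 : ℝ) ≤ p := p.2
  have hpq' : (p : ℝ) + q = 1 := by exact_mod_cast hpq
  have ha0 : 0 ≤ a₁ := by
    by_contra h
    nlinarith
  have ha1 : a₁ ≤ 1 := by nlinarith
  have hb0 : 0 ≤ a₂ := by
    by_contra h
    nlinarith
  have hb1 : a₂ ≤ 1 := by nlinarith
  -- The contraction factor 1 - 2q/N must be nonnegative, so the induction starts at N = 2.
  rcases n with _ | n
  · simp only [sizeExp, treeCount_two_init]
    push_cast
    nlinarith
  induction n with
  | zero =>
    refine (sizeExp_mono p q (H := fun _ => (4 : ℝ)) fun s hs => ?_).trans ?_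
    · have hle := treeCount_one_add_two_le hs
      have h1 := treeCount_nonneg 1 (0 + 1) s
      have h2 := treeCount_nonneg 2 (0 + 1) s
      push_cast at hle ⊢
      nlinarith
    · rw [sizeExp_const hpq]
      norm_num
  | succ n ih =>
    generalize hm : n + 1 = m at ih
    have := sizeExp_succ_treeCount p q m (fun _ x => (x - a₂ * ((m + 1 : ℕ) + 1)) ^ 2)
    rw [this]
    have hb : ∀ s, IsSizeVector m s →
        p * (treeCount 2 m s - a₂ * ((m + 1 : ℕ) + 1)) ^ 2 +
      q / (m + 1) * (treeCount 1 m s * (treeCount 2 m s + 1 - a₂ * ((m + 1 : ℕ) + 1)) ^ 2 +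
        2 * treeCount 2 m s * (treeCount 2 m s - 1 - a₂ * ((m + 1 : ℕ) + 1)) ^ 2 +
        (m + 1 - treeCount 1 m s - 2 * treeCount 2 m s) *
          (treeCount 2 m s - a₂ * ((m + 1 : ℕ) + 1)) ^ 2) ≤
        (treeCount 2 m s - a₂ * (m + 1)) ^ 2 +
          (1 / (2 * (m + 1)) * (treeCount 1 m s - a₁ * (m + 1)) ^ 2 + 1) := by
      intro s hs
      have hle := treeCount_one_add_two_le hs
      have h1 := treeCount_nonneg 1 m s
      have h2 := treeCount_nonneg 2 m s
      set N : ℝ := m + 1 with hN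
      have hN1 : 2 ≤ N := by
        rw [hN, ← hm]
        push_cast
        linarith [Nat.cast_nonneg (α := ℝ) n]
      have hN0 : (0 : ℝ) < N := by linarith
      set x := treeCount 1 m s / N with hx
      have hxN : treeCount 1 m s = x * N := by rw [hx]; field_simp
      have hx0 : 0 ≤ x := by positivity
      set y := treeCount 2 m s / N with hy
      have hyN : treeCount 2 m s = y * N := by rw [hy]; field_simp
      have hy0 : 0 ≤ y := by positivity
      have hxy : x + 2 * y ≤ 1 := by
        have : (x + 2 * y) * N ≤ 1 * N := by rw [hxN, hyN] at hle; linarith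
        exact le_of_mul_le_mul_right this hN0
      set r : ℝ := q / N with hr
      have hrN : (q : ℝ) = r * N := by rw [hr]; field_simp
      have hr0 : 0 ≤ r := by positivity
      have hr1 : 2 * r ≤ 1 := by
        rw [hr, ← mul_div_assoc, div_le_one hN0]
        linarith
      have hr2 : r / 2 ≤ 1 / (2 * N) := by
        rw [hr, div_div, mul_comm N 2]
        gcongr
        linarith
      push_cast
      rw [hxN, hyN, ← hN]
      have hp' : (p : ℝ) = 1 - q := by linarith
      have key : p * (y * N - a₂ * (N + 1)) ^ 2 +
          r * (x * N * (y * N + 1 - a₂ * (N + 1)) ^ 2 +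
          2 * (y * N) * (y * N - 1 - a₂ * (N + 1)) ^ 2 +
          (N - x * N - 2 * (y * N)) * (y * N - a₂ * (N + 1)) ^ 2) =
          ((1 - 2 * r) * (y * N - a₂ * N) + r * (x * N - a₁ * N)) ^ 2 +
            (q * x + 2 * q * y - (q * x - 2 * q * y) ^ 2) := by
        have ha : a₂ * (1 + 2 * (r * N)) = r * N * a₁ := by rw [← hrN, h₂]
        rw [hp', hrN]
        linear_combination (-((2 - 2 * r) * (y * N - a₂ * N) - a₂ + r * N * x - 2 * (r * N * y) +
          r * (x * N - a₁ * N))) * ha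
      rw [key]
      set u := y * N - a₂ * N
      set v := x * N - a₁ * N
      -- Convexity of the square for the weights 1 - 2r and 2r at the points u and v/2.
      have c1 : ((1 - 2 * r) * u + r * v) ^ 2 ≤ (1 - 2 * r) * u ^ 2 + r / 2 * v ^ 2 := by
        have : 0 ≤ (1 - 2 * r) * (2 * r) * (u - v / 2) ^ 2 :=
          mul_nonneg (mul_nonneg (by linarith) (by linarith)) (sq_nonneg _)
        have e : (1 - 2 * r) * u ^ 2 + r / 2 * v ^ 2 - ((1 - 2 * r) * u + r * v) ^ 2 =
            (1 - 2 * r) * (2 * r) * (u - v / 2) ^ 2 := by ring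
        linarith
      have c2 : r / 2 * v ^ 2 ≤ 1 / (2 * N) * v ^ 2 := by gcongr
      have c3 : (q : ℝ) * x + 2 * q * y ≤ 1 := by
        have : (q : ℝ) * (x + 2 * y) ≤ 1 * 1 := by
          gcongr
          linarith
        linarith
      have c4 : 0 ≤ 2 * r * u ^ 2 := by positivity
      linarith [sq_nonneg ((q : ℝ) * x - 2 * q * y)]
    refine (sizeExp_mono p q hb).trans ?_
    rw [sizeExp_add, sizeExp_add, sizeExp_const hpq, sizeExp_const_mul]
    have h := sizeExp_treeCount_one_sq_le hpq h₁ m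
    have h' : 1 / (2 * ((m : ℝ) + 1)) *
        sizeExp p q m (fun s => (treeCount 1 m s - a₁ * (m + 1)) ^ 2) ≤
        1 / (2 * ((m : ℝ) + 1)) * (m + 1) := by gcongr
    have h'' : 1 / (2 * ((m : ℝ) + 1)) * (m + 1) = 1 / 2 := by field_simp
    push_cast
    linarith

/-- The sum of the sizes to the power `3/2`. -/
noncomputable def sizeThreeHalves (n : ℕ) (s : ℕ → ℕ) : ℝ :=
  ∑ k ∈ Icc 1 (n + 1), (s k : ℝ) * Real.sqrt (s k)

theorem sizeThreeHalves_nonneg (n : ℕ) (s : ℕ → ℕ) : 0 ≤ sizeThreeHalves n s :=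
  sum_nonneg fun _ _ => by positivity

/-- It follows from √(r + 1) ≤ √r + 1/(2√r). The leading coefficient 3/2 must be exact, since it
fixes the growth exponent 3q/2. -/
theorem mul_threeHalves_succ_sub_le (r : ℕ) :
    (r : ℝ) * (((r + 1 : ℕ) : ℝ) * Real.sqrt ((r + 1 : ℕ) : ℝ) - r * Real.sqrt r) ≤
      3 / 2 * (r * Real.sqrt r) + 3 / 4 * r := by
  rcases Nat.eq_zero_or_pos r with rfl | hr
  · simp
  have hr1 : (1 : ℝ) ≤ r := by exact_mod_cast hr
  set a := Real.sqrt r with ha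
  set b := Real.sqrt ((r + 1 : ℕ) : ℝ) with hb
  have ha2 : a ^ 2 = r := Real.sq_sqrt (by positivity)
  have hb2 : b ^ 2 = r + 1 := by rw [hb, Real.sq_sqrt (by positivity)]; push_cast; ring
  have ha1 : 1 ≤ a := by rw [ha]; exact Real.one_le_sqrt.2 hr1
  have hb0 : 0 ≤ b := Real.sqrt_nonneg _
  have hbd : b ≤ a + 1 / (2 * a) := by
    refine abs_le_of_sq_le_sq' ?_ (by positivity) |>.2
    have : (a + 1 / (2 * a)) ^ 2 = a ^ 2 + 1 + (1 / (2 * a)) ^ 2 := by field_simp; ring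
    rw [this, hb2, ha2]
    nlinarith [sq_nonneg (1 / (2 * a))]
  have hinv : 1 / (2 * a) ≤ 1 / 2 := by
    apply one_div_le_one_div_of_le <;> linarith
  have h1 : ((r + 1 : ℕ) : ℝ) * b - r * a ≤ 3 / 2 * a + 3 / 4 := by
    have e : ((r + 1 : ℕ) : ℝ) = a ^ 2 + 1 := by rw [ha2]; push_cast; ring
    rw [e, ← ha2]
    have : (a ^ 2 + 1) * b ≤ (a ^ 2 + 1) * (a + 1 / (2 * a)) := by gcongr
    have e2 : (a ^ 2 + 1) * (a + 1 / (2 * a)) = a ^ 2 * a + 3 / 2 * a + 1 / (2 * a) := by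
      field_simp
      ring
    linarith
  nlinarith

/-- A tree of size r grows with probability q r/N. A new tree adds p, and the lower order terms add
at most 3q/4, together at most 1. -/
theorem sizeExp_succ_sizeThreeHalves_le {p q : ℝ≥0} (hpq : p + q = 1) (n : ℕ) :
    sizeExp p q (n + 1) (sizeThreeHalves (n + 1)) ≤
      (1 + 3 / 2 * q / (n + 1)) * sizeExp p q n (sizeThreeHalves n) + 1 := by
  have hpq' : (p : ℝ) + q = 1 := by exact_mod_cast hpq
  rw [sizeExp_succ_real, ← sizeExp_const_mul]
  have hc := sizeExp_const hpq n (1 : ℝ)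
  rw [← hc, ← sizeExp_add, hc]
  refine sizeExp_mono p q fun s hs => ?_
  have e1 : sizeThreeHalves (n + 1) (update s (n + 2) 1) = 1 + sizeThreeHalves n s := by
    unfold sizeThreeHalves
    rw [sum_Icc_update_new (fun k => (k : ℝ) * Real.sqrt k)]
    simp
  have e2 : ∀ j ∈ Icc 1 (n + 1), (s j : ℝ) * sizeThreeHalves (n + 1) (update s j (s j + 1)) ≤
      s j * sizeThreeHalves n s + (3 / 2 * (s j * Real.sqrt (s j)) + 3 / 4 * s j) := by
    intro j hj
    unfold sizeThreeHalves
    rw [sum_Icc_update_old (fun k => (k : ℝ) * Real.sqrt k) (by simp) hs hj, mul_add]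
    gcongr
    exact mul_threeHalves_succ_sub_le (s j)
  have e3 := sum_le_sum e2
  rw [sum_add_distrib, sum_add_distrib, ← sum_mul, ← mul_sum, ← mul_sum, hs.sum_cast] at e3
  change _ ≤ _ + (3 / 2 * sizeThreeHalves n s + _) at e3
  set R := sizeThreeHalves n s
  have hN : (0 : ℝ) < n + 1 := by positivity
  rw [e1]
  have e4 := mul_le_mul_of_nonneg_left e3 (show (0 : ℝ) ≤ q / (n + 1) by positivity)
  have e5 : (q : ℝ) / (n + 1) * ((n + 1) * R + (3 / 2 * R + 3 / 4 * (n + 1))) =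
      q * R + 3 / 2 * q / (n + 1) * R + 3 / 4 * q := by
    field_simp
    ring
  rw [e5] at e4
  have e6 : (p : ℝ) * R + q * R = R := by rw [← add_mul, hpq', one_mul]
  have hq0 : (0 : ℝ) ≤ q := q.2
  linarith

theorem sizeExp_zero_sizeThreeHalves (p q : ℝ≥0) : sizeExp p q 0 (sizeThreeHalves 0) = 1 := by
  rw [sizeExp, sizeThreeHalves, zero_add, Icc_self, sum_singleton, update_self]
  simp

theorem growth_of_lt_one {α : ℝ} (hα0 : 0 ≤ α) (hα : α < 1) {r : ℕ → ℝ} (h0 : r 0 = 1)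
    (hr : ∀ n : ℕ, r (n + 1) ≤ (1 + α / (n + 1)) * r n + 1) (n : ℕ) :
    r n ≤ (1 - α)⁻¹ * (n + 1) := by
  have h1 : 0 < 1 - α := by linarith
  have hK : (1 - α)⁻¹ * (1 - α) = 1 := inv_mul_cancel₀ h1.ne'
  have hK0 : 0 < (1 - α)⁻¹ := by positivity
  set K := (1 - α)⁻¹
  induction n with
  | zero =>
    rw [h0]
    push_cast
    nlinarith
  | succ n ih =>
    have hN : (0 : ℝ) < n + 1 := by positivity
    have : (1 + α / (n + 1)) * r n ≤ (1 + α / (n + 1)) * (K * (n + 1)) := by gcongr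
    have e : (1 + α / (n + 1)) * (K * (n + 1)) = K * (n + 1) + K * α := by field_simp
    push_cast
    linarith [hr n]

/-- N(1 + log N) is a supersolution because log(N + 1) - log N ≥ 1/(N + 1). -/
theorem growth_of_eq_one {r : ℕ → ℝ} (h0 : r 0 = 1)
    (hr : ∀ n : ℕ, r (n + 1) ≤ (1 + 1 / (n + 1)) * r n + 1) (n : ℕ) :
    r n ≤ (n + 1) * (1 + Real.log (n + 1)) := by
  induction n with
  | zero => simp [h0]
  | succ n ih =>
    have hN : (0 : ℝ) < n + 1 := by positivity
    have h1 : (1 + 1 / ((n : ℝ) + 1)) * r n ≤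
        (1 + 1 / ((n : ℝ) + 1)) * ((n + 1) * (1 + Real.log (n + 1))) := by gcongr
    have e : (1 + 1 / ((n : ℝ) + 1)) * ((n + 1) * (1 + Real.log (n + 1))) =
        (n + 1 + 1) * (1 + Real.log (n + 1)) := by field_simp
    have h2 := Real.one_sub_inv_le_log_of_pos (show (0 : ℝ) < (n + 1 + 1) / (n + 1) by positivity)
    rw [Real.log_div (by positivity) (by positivity), inv_div] at h2
    have e2 : 1 - ((n : ℝ) + 1) / (n + 1 + 1) = 1 / (n + 1 + 1) := by field_simp; ring
    rw [e2, div_le_iff₀ (by positivity)] at h2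
    push_cast
    linarith [hr n]

theorem growth_of_one_lt {α : ℝ} (hα : 1 < α) {r : ℕ → ℝ} (h0 : r 0 = 1)
    (hr : ∀ n : ℕ, r (n + 1) ≤ (1 + α / (n + 1)) * r n + 1) (n : ℕ) :
    r n ≤ (1 + (α - 1)⁻¹) * ((n : ℝ) + 1) ^ α := by
  have h1 : 0 < α - 1 := by linarith
  have hL : (α - 1)⁻¹ * (α - 1) = 1 := inv_mul_cancel₀ h1.ne'
  have hL0 : 0 < (α - 1)⁻¹ := by positivity
  set L := (α - 1)⁻¹
  -- The negative linear term absorbs the source term 1, since L(α - 1) = 1; Bernoulli's inequality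
  -- makes N^α a supersolution of the homogeneous recursion.
  have main : r n ≤ (1 + L) * ((n : ℝ) + 1) ^ α - L * (n + 1) := by
    induction n with
    | zero => simp [h0]
    | succ n ih =>
      have hN : (0 : ℝ) < n + 1 := by positivity
      have h2 : (1 + α / (n + 1)) * r n ≤
          (1 + α / (n + 1)) * ((1 + L) * ((n : ℝ) + 1) ^ α - L * (n + 1)) := by gcongr
      have h3 : (1 + α / ((n : ℝ) + 1)) * ((n : ℝ) + 1) ^ α ≤ ((n : ℝ) + 1 + 1) ^ α := by
        have hb := one_add_mul_self_le_rpow_one_add (s := 1 / ((n : ℝ) + 1))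
          (by have : (0 : ℝ) ≤ 1 / (n + 1) := by positivity
              linarith) hα.le
        have e : ((n : ℝ) + 1 + 1) ^ α = (1 + 1 / ((n : ℝ) + 1)) ^ α * ((n : ℝ) + 1) ^ α := by
          rw [← Real.mul_rpow (by positivity) (by positivity)]
          congr 1
          field_simp
        rw [e]
        gcongr
        rw [mul_one_div] at hb
        exact hb
      have e : (1 + α / ((n : ℝ) + 1)) * ((1 + L) * ((n : ℝ) + 1) ^ α - L * (n + 1)) =
          (1 + L) * ((1 + α / ((n : ℝ) + 1)) * ((n : ℝ) + 1) ^ α) - L * (n + 1) - L * α := by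
        field_simp
        ring
      have h4 := mul_le_mul_of_nonneg_left h3 (show 0 ≤ 1 + L by linarith)
      push_cast
      linarith [hr n]
  have : 0 ≤ L * ((n : ℝ) + 1) := by positivity
  linarith

end SizeMoments

/-! ### Expansions of the normal distribution function -/

section GaussianExpansion

theorem sq_mul_gaussPDF_le (x : ℝ) : x ^ 2 * gaussPDF x ≤ 1 := by
  have h1 : x ^ 2 / 2 * Real.exp (-x ^ 2 / 2) ≤ 1 := by
    have := Real.add_one_le_exp (x ^ 2 / 2)
    have e : Real.exp (-x ^ 2 / 2) = (Real.exp (x ^ 2 / 2))⁻¹ := by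
      rw [← Real.exp_neg]; congr 1; ring
    rw [e, ← div_eq_mul_inv, div_le_one (Real.exp_pos _)]
    linarith
  have h2 : (Real.sqrt (2 * Real.pi))⁻¹ ≤ 1 / 2 := by
    rw [one_div]
    exact inv_anti₀ (by norm_num) two_le_sqrt_two_pi
  have h3 : 0 ≤ x ^ 2 / 2 * Real.exp (-x ^ 2 / 2) := by positivity
  rw [gaussPDF_eq]
  have h4 : (Real.sqrt (2 * Real.pi))⁻¹ * (x ^ 2 / 2 * Real.exp (-x ^ 2 / 2)) ≤ 1 / 2 * 1 := by
    gcongr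
  linarith

theorem pow_four_mul_gaussPDF_le (x : ℝ) : x ^ 4 * gaussPDF x ≤ 8 := by
  have h1 : x ^ 4 * Real.exp (-x ^ 2 / 2) ≤ 16 := by
    have := Real.add_one_le_exp (x ^ 2 / 4)
    have e : Real.exp (-x ^ 2 / 2) = (Real.exp (x ^ 2 / 4) ^ 2)⁻¹ := by
      rw [← Real.exp_nat_mul, ← Real.exp_neg]; congr 1; push_cast; ring
    have h0 := Real.exp_pos (x ^ 2 / 4)
    rw [e, ← div_eq_mul_inv, div_le_iff₀ (by positivity)]
    have h2 : x ^ 2 / 4 ≤ Real.exp (x ^ 2 / 4) := by linarith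
    have h3 : (x ^ 2 / 4) ^ 2 ≤ Real.exp (x ^ 2 / 4) ^ 2 := by gcongr
    nlinarith
  have h2 : (Real.sqrt (2 * Real.pi))⁻¹ ≤ 1 / 2 := by
    rw [one_div]
    exact inv_anti₀ (by norm_num) two_le_sqrt_two_pi
  rw [gaussPDF_eq]
  have h4 : (Real.sqrt (2 * Real.pi))⁻¹ * (x ^ 4 * Real.exp (-x ^ 2 / 2)) ≤ 1 / 2 * 16 := by
    gcongr
  linarith

theorem abs_mul_gaussPDF_le (x : ℝ) : |x * gaussPDF x| ≤ 1 := by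
  have h := gaussPDF_pos x
  have h1 := sq_mul_gaussPDF_le x
  have h2 := gaussPDF_le_half x
  rw [abs_le]
  constructor <;> nlinarith [mul_nonneg (sq_nonneg (x + 1)) h.le, mul_nonneg (sq_nonneg (x - 1)) h.le]

theorem abs_pow_three_mul_gaussPDF_le (x : ℝ) : |x ^ 3 * gaussPDF x| ≤ 5 := by
  have h := gaussPDF_pos x
  have h1 := sq_mul_gaussPDF_le x
  have h2 := pow_four_mul_gaussPDF_le x
  have e1 : 0 ≤ (x ^ 2 + x) ^ 2 * gaussPDF x := by positivity
  have e2 : 0 ≤ (x ^ 2 - x) ^ 2 * gaussPDF x := by positivity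
  rw [abs_le]
  constructor <;> nlinarith

/-- If `|f'| ≤ C |x - z| ^ k` between `z` and `x`, then `|f x - f z| ≤ C |x - z| ^ (k + 1)`. -/
theorem abs_sub_le_of_abs_deriv_le_pow {f f' : ℝ → ℝ} {z x C : ℝ} (k : ℕ) (hC : 0 ≤ C)
    (hf : ∀ y ∈ Set.uIcc z x, HasDerivAt f (f' y) y)
    (hb : ∀ y ∈ Set.uIcc z x, |f' y| ≤ C * |y - z| ^ k) :
    |f x - f z| ≤ C * |x - z| ^ (k + 1) := by
  have := (convex_uIcc z x).norm_image_sub_le_of_norm_hasDerivWithin_le (C := C * |x - z| ^ k)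
    (fun y hy => (hf y hy).hasDerivWithinAt) (fun y hy => ?_) Set.left_mem_uIcc Set.right_mem_uIcc
  · rw [pow_succ, ← mul_assoc]
    exact this
  · refine (hb y hy).trans ?_
    have : |y - z| ≤ |x - z| := Set.abs_sub_left_of_mem_uIcc hy
    gcongr

theorem hasDerivAt_mul_gaussPDF (x : ℝ) :
    HasDerivAt (fun x => x * gaussPDF x) ((1 - x ^ 2) * gaussPDF x) x := by
  have h := (hasDerivAt_id x).mul (hasDerivAt_gaussPDF x)
  refine h.congr_deriv ?_
  simp
  ring

/-- The Lipschitz bound for xφ(x) = -φ'(x) is integrated twice. -/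
theorem abs_gaussCDF_taylor (z h : ℝ) :
    |gaussCDF (z + h) - gaussCDF z - h * gaussPDF z + h ^ 2 / 2 * (z * gaussPDF z)| ≤ |h| ^ 3 := by
  have s1 : ∀ x, |x * gaussPDF x - z * gaussPDF z| ≤ 1 * |x - z| ^ (0 + 1) := fun x =>
    abs_sub_le_of_abs_deriv_le_pow 0 zero_le_one (fun y _ => hasDerivAt_mul_gaussPDF y)
      (fun y _ => by
        have h1 := sq_mul_gaussPDF_le y
        have h2 := gaussPDF_le_half y
        have h3 := gaussPDF_pos y
        have h4 : 0 ≤ y ^ 2 * gaussPDF y := by positivity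
        rw [pow_zero, mul_one, abs_le]
        constructor <;> linarith)
  have s2 : ∀ x, |gaussPDF x - gaussPDF z + (x - z) * (z * gaussPDF z)| ≤ 1 * |x - z| ^ 2 := by
    intro x
    have := abs_sub_le_of_abs_deriv_le_pow (f := fun x => gaussPDF x + x * (z * gaussPDF z))
      (f' := fun x => -x * gaussPDF x + z * gaussPDF z) (z := z) (x := x) 1 zero_le_one
      (fun y _ => by
        have := (hasDerivAt_gaussPDF y).add ((hasDerivAt_id y).mul_const (z * gaussPDF z))
        exact this.congr_deriv (by simp))
      (fun y _ => by
        rw [← abs_neg]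
        convert s1 y using 2
        ring)
    convert this using 2
    ring
  have := abs_sub_le_of_abs_deriv_le_pow
    (f := fun x => gaussCDF x - x * gaussPDF z + (x - z) ^ 2 / 2 * (z * gaussPDF z))
    (f' := fun x => gaussPDF x - gaussPDF z + (x - z) * (z * gaussPDF z)) (z := z) (x := z + h) 2
    zero_le_one
    (fun y _ => by
      have h1 := (hasDerivAt_gaussCDF y).sub ((hasDerivAt_id y).mul_const (gaussPDF z))
      have h2 := ((((hasDerivAt_id y).sub_const z).pow 2).div_const 2).mul_const (z * gaussPDF z)
      refine (h1.add h2).congr_deriv ?_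
      simp)
    (fun y _ => s2 y)
  simp only [add_sub_cancel_left, sub_self, one_mul] at this
  convert this using 2
  ring

theorem abs_gaussCDF_sub_le (x y : ℝ) : |gaussCDF x - gaussCDF y| ≤ |x - y| := by
  have := abs_sub_le_of_abs_deriv_le_pow (z := y) (x := x) (C := 1) 0 zero_le_one
    (fun t _ => hasDerivAt_gaussCDF t) (fun t _ => by
      rw [abs_of_pos (gaussPDF_pos t)]
      linarith [gaussPDF_le_half t])
  simpa using this

theorem hasDerivAt_div_sqrt (y : ℝ) {t : ℝ} (ht : 0 < t) :
    HasDerivAt (fun t => y / Real.sqrt t) (-(y / Real.sqrt t) / (2 * t)) t := by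
  have hs := Real.sqrt_pos.2 ht
  have h := ((Real.hasDerivAt_sqrt ht.ne').inv hs.ne').const_mul y
  refine (h.congr_deriv ?_)
  have h2 : Real.sqrt t ^ 2 = t := Real.sq_sqrt ht.le
  rw [h2]
  field_simp

theorem hasDerivAt_gaussCDF_div_sqrt (y : ℝ) {t : ℝ} (ht : 0 < t) :
    HasDerivAt (fun t => gaussCDF (y / Real.sqrt t))
      (-(y / Real.sqrt t * gaussPDF (y / Real.sqrt t)) / (2 * t)) t := by
  have h := (hasDerivAt_gaussCDF (y / Real.sqrt t)).comp t (hasDerivAt_div_sqrt y ht)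
  refine h.congr_deriv ?_
  ring

theorem abs_gaussCDF_div_sqrt_sub_le (y : ℝ) {c s t : ℝ} (hc : 0 < c) (hs : c ≤ s) (ht : c ≤ t) :
    |gaussCDF (y / Real.sqrt t) - gaussCDF (y / Real.sqrt s)| ≤ 1 / (2 * c) * |t - s| := by
  have := abs_sub_le_of_abs_deriv_le_pow (z := s) (x := t) (C := 1 / (2 * c))
    (f := fun t => gaussCDF (y / Real.sqrt t)) 0 (by positivity)
    (fun u hu => hasDerivAt_gaussCDF_div_sqrt y (hc.trans_le ((le_inf hs ht).trans hu.1)))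
    (fun u hu => by
      have hcu : c ≤ u := (le_inf hs ht).trans hu.1
      have hu0 : 0 < u := hc.trans_le hcu
      rw [abs_div, abs_neg, abs_of_pos (by positivity : 0 < 2 * u), pow_zero, mul_one]
      calc _ ≤ 1 / (2 * u) := by gcongr; exact abs_mul_gaussPDF_le _
        _ ≤ 1 / (2 * c) := by gcongr)
  simpa using this

/-- With u = y/√t, the first derivative of Φ(y/√t) in t is -uφ(u)/(2t), half the second derivative
in y (heat equation), and the second derivative in t is at most 2/t². Hence adding variance v has
the same leading effect as averaging over a centred shift of variance v. -/
theorem abs_gaussCDF_div_sqrt_taylor (y : ℝ) {t v : ℝ} (ht : 0 < t) (hv : 0 ≤ v) :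
    |gaussCDF (y / Real.sqrt (t + v)) - gaussCDF (y / Real.sqrt t) +
      v / (2 * t) * (y / Real.sqrt t * gaussPDF (y / Real.sqrt t))| ≤ 2 * v ^ 2 / t ^ 2 := by
  set K' : ℝ → ℝ := fun t => -(y / Real.sqrt t * gaussPDF (y / Real.sqrt t)) / (2 * t) with hK'
  have hpos : ∀ u ∈ Set.uIcc t (t + v), t ≤ u := fun u hu => by
    rw [Set.uIcc_of_le (by linarith)] at hu
    exact hu.1
  have s1 : ∀ x, t ≤ x → |K' x - K' t| ≤ 2 / t ^ 2 * |x - t| ^ (0 + 1) := by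
    intro x hx
    refine abs_sub_le_of_abs_deriv_le_pow 0 (by positivity)
      (f' := fun u => (2 * (y / Real.sqrt u * gaussPDF (y / Real.sqrt u)) +
        y / Real.sqrt u * ((1 - (y / Real.sqrt u) ^ 2) * gaussPDF (y / Real.sqrt u))) /
          (4 * u ^ 2)) (fun u hu => ?_) (fun u hu => ?_)
    · rw [Set.uIcc_of_le hx] at hu
      have hu0 : 0 < u := ht.trans_le hu.1
      have h1 := (hasDerivAt_mul_gaussPDF (y / Real.sqrt u)).comp u (hasDerivAt_div_sqrt y hu0)
      have h2 : HasDerivAt K' _ u :=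
        h1.neg.div ((hasDerivAt_id u).const_mul 2) (by simpa using hu0.ne')
      refine h2.congr_deriv ?_
      have hs := Real.sqrt_pos.2 hu0
      change (-((1 - (y / Real.sqrt u) ^ 2) * gaussPDF (y / Real.sqrt u) *
        (-(y / Real.sqrt u) / (2 * u))) * (2 * u) -
        -(y / Real.sqrt u * gaussPDF (y / Real.sqrt u)) * (2 * 1)) / (2 * u) ^ 2 = _
      generalize gaussPDF (y / Real.sqrt u) = g
      generalize y / Real.sqrt u = w
      field_simp
      ring
    · rw [Set.uIcc_of_le hx] at hu
      have hu0 : 0 < u := ht.trans_le hu.1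
      generalize y / Real.sqrt u = w
      have h1 := abs_le.1 (abs_mul_gaussPDF_le w)
      have h3 := abs_le.1 (abs_pow_three_mul_gaussPDF_le w)
      rw [abs_div, abs_of_pos (by positivity : 0 < 4 * u ^ 2), pow_zero, mul_one]
      calc _ ≤ 8 / (4 * u ^ 2) := by
            gcongr
            rw [abs_le]
            constructor <;> linarith [h1.1, h1.2, h3.1, h3.2]
        _ = 2 / u ^ 2 := by field_simp; norm_num
        _ ≤ 2 / t ^ 2 := by have := hu.1; gcongr
  have := abs_sub_le_of_abs_deriv_le_pow (z := t) (x := t + v) (C := 2 / t ^ 2)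
    (f := fun s => gaussCDF (y / Real.sqrt s) - s * K' t) (f' := fun s => K' s - K' t) 1
    (by positivity)
    (fun u hu => by
      have h1 := (hasDerivAt_gaussCDF_div_sqrt y (ht.trans_le (hpos u hu))).sub
        ((hasDerivAt_id u).mul_const (K' t))
      exact h1.congr_deriv (by simp [hK']))
    (fun u hu => s1 u (hpos u hu))
  simp only [add_sub_cancel_left] at this
  convert this using 1
  · congr 1
    simp only [hK']
    field_simp
    ring
  · simp [sq_abs]
    ring

/-- Replacing a small centred three-valued increment by a Gaussian one of nearby variance. -/
theorem abs_gaussCDF_threePoint_le {τ v M : ℝ} (hτ : 0 < τ) (hv : 0 ≤ v) (y : ℝ)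
    {w₁ w₂ w₃ h₁ h₂ h₃ : ℝ} (hw₁ : 0 ≤ w₁) (hw₂ : 0 ≤ w₂) (hw₃ : 0 ≤ w₃) (hw : w₁ + w₂ + w₃ = 1)
    (hmean : w₁ * h₁ + w₂ * h₂ + w₃ * h₃ = 0)
    (hb₁ : |h₁| ≤ M) (hb₂ : |h₂| ≤ M) (hb₃ : |h₃| ≤ M) :
    |w₁ * gaussCDF ((y - h₁) / Real.sqrt τ) + w₂ * gaussCDF ((y - h₂) / Real.sqrt τ) +
      w₃ * gaussCDF ((y - h₃) / Real.sqrt τ) - gaussCDF (y / Real.sqrt (τ + v))| ≤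
      M ^ 3 / (τ * Real.sqrt τ) +
        |w₁ * h₁ ^ 2 + w₂ * h₂ ^ 2 + w₃ * h₃ ^ 2 - v| / (2 * τ) + 2 * v ^ 2 / τ ^ 2 := by
  have hs := Real.sqrt_pos.2 hτ
  have hs2 : Real.sqrt τ ^ 2 = τ := Real.sq_sqrt hτ.le
  set u := y / Real.sqrt τ with hu
  have hT : ∀ h, |h| ≤ M → |gaussCDF ((y - h) / Real.sqrt τ) - gaussCDF u +
      h / Real.sqrt τ * gaussPDF u + h ^ 2 / (2 * τ) * (u * gaussPDF u)| ≤
      M ^ 3 / (τ * Real.sqrt τ) := by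
    intro h hh
    have := abs_gaussCDF_taylor u (-h / Real.sqrt τ)
    have e1 : u + -h / Real.sqrt τ = (y - h) / Real.sqrt τ := by rw [hu]; ring
    rw [e1] at this
    have e2 : |-h / Real.sqrt τ| ^ 3 = |h| ^ 3 / (τ * Real.sqrt τ) := by
      rw [abs_div, abs_neg, abs_of_pos hs, div_pow]
      congr 1
      nth_rewrite 2 [← hs2]
      ring
    rw [e2] at this
    have e3 : (-h / Real.sqrt τ) ^ 2 / 2 = h ^ 2 / (2 * τ) := by
      rw [div_pow, hs2]
      ring
    rw [e3] at this
    refine le_trans (le_of_eq ?_) (this.trans ?_)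
    · congr 1
      ring
    · gcongr
  have t1 := mul_le_mul_of_nonneg_left (hT h₁ hb₁) hw₁
  have t2 := mul_le_mul_of_nonneg_left (hT h₂ hb₂) hw₂
  have t3 := mul_le_mul_of_nonneg_left (hT h₃ hb₃) hw₃
  rw [← abs_of_nonneg hw₁, ← abs_mul, abs_of_nonneg hw₁] at t1
  rw [← abs_of_nonneg hw₂, ← abs_mul, abs_of_nonneg hw₂] at t2
  rw [← abs_of_nonneg hw₃, ← abs_mul, abs_of_nonneg hw₃] at t3
  have t4 := abs_gaussCDF_div_sqrt_taylor y hτ hv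
  rw [← hu] at t4
  set D := w₁ * h₁ ^ 2 + w₂ * h₂ ^ 2 + w₃ * h₃ ^ 2 - v with hD
  have t5 : |D / (2 * τ) * (u * gaussPDF u)| ≤ |D| / (2 * τ) := by
    rw [abs_mul, abs_div, abs_of_pos (by positivity : 0 < 2 * τ)]
    exact mul_le_of_le_one_right (by positivity) (abs_mul_gaussPDF_le u)
  set E := M ^ 3 / (τ * Real.sqrt τ)
  set g₁ := gaussCDF ((y - h₁) / Real.sqrt τ)
  set g₂ := gaussCDF ((y - h₂) / Real.sqrt τ)
  set g₃ := gaussCDF ((y - h₃) / Real.sqrt τ)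
  set g := gaussCDF (y / Real.sqrt (τ + v))
  -- The first order terms cancel because the shift is centred, and the second order terms cancel
  -- against the variance expansion up to the mismatch `D`.
  have key : w₁ * g₁ + w₂ * g₂ + w₃ * g₃ - g =
      w₁ * (g₁ - gaussCDF u + h₁ / Real.sqrt τ * gaussPDF u + h₁ ^ 2 / (2 * τ) * (u * gaussPDF u)) +
      w₂ * (g₂ - gaussCDF u + h₂ / Real.sqrt τ * gaussPDF u + h₂ ^ 2 / (2 * τ) * (u * gaussPDF u)) +
      w₃ * (g₃ - gaussCDF u + h₃ / Real.sqrt τ * gaussPDF u + h₃ ^ 2 / (2 * τ) * (u * gaussPDF u)) -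
      (g - gaussCDF u + v / (2 * τ) * (u * gaussPDF u)) - D / (2 * τ) * (u * gaussPDF u) := by
    have e1 : w₃ = 1 - w₁ - w₂ := by linarith
    have e2 : w₃ * h₃ = -(w₁ * h₁) - w₂ * h₂ := by linarith
    rw [hD]
    linear_combination gaussCDF u * hw - gaussPDF u / Real.sqrt τ * hmean
  have hE : w₁ * E + w₂ * E + w₃ * E = E := by rw [← add_mul, ← add_mul, hw, one_mul]
  rw [key, abs_le]
  rw [abs_le] at t1 t2 t3 t4 t5
  constructor <;> linarith [t1.1, t1.2, t2.1, t2.2, t3.1, t3.2, t4.1, t4.2, t5.1, t5.2]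

end GaussianExpansion

-- The number of trees of size one tested against smoothed Gaussian functions.

section SingletonCLT

open scoped NNReal
open Finset Function

theorem sizeExp_abs_treeCount_one_le {p q : ℝ≥0} (hpq : p + q = 1) {a₁ : ℝ}
    (h₁ : a₁ * (1 + q) = p) (n : ℕ) :
    sizeExp p q n (fun s => |treeCount 1 n s - a₁ * (n + 1)|) ≤ Real.sqrt (n + 1) := by
  have h := sizeExp_treeCount_one_sq_le hpq h₁ n
  have hN : (0 : ℝ) < n + 1 := by positivity
  have hs := Real.sqrt_pos.2 hN
  have hs2 : Real.sqrt ((n : ℝ) + 1) ^ 2 = n + 1 := Real.sq_sqrt hN.le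
  set c := Real.sqrt ((n : ℝ) + 1)
  have hm : sizeExp p q n (fun s => |treeCount 1 n s - a₁ * (n + 1)|) ≤
      sizeExp p q n (fun s => c / 2 + 1 / (2 * c) * (treeCount 1 n s - a₁ * (n + 1)) ^ 2) := by
    refine sizeExp_mono p q fun s _ => ?_
    set x := treeCount 1 n s - a₁ * (n + 1)
    rw [← sq_abs x, ← sub_nonneg]
    have : c / 2 + 1 / (2 * c) * |x| ^ 2 - |x| = (c - |x|) ^ 2 / (2 * c) := by field_simp; ring
    rw [this]
    positivity
  refine hm.trans ?_
  rw [sizeExp_add, sizeExp_const hpq, sizeExp_const_mul]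
  have : 1 / (2 * c) * sizeExp p q n (fun s => (treeCount 1 n s - a₁ * (n + 1)) ^ 2) ≤
      1 / (2 * c) * c ^ 2 := by rw [hs2]; gcongr
  have e : 1 / (2 * c) * c ^ 2 = c / 2 := by field_simp
  linarith

/-- The increment of N₁ is +1, -1 or 0 with probabilities p, qx, q(1 - x), centred by p - qx. At x =
a₁ its variance is v₁(1 + 2q). The value v differs from m² times this by m² v₁ q²/N, a correction
that makes the variances of the Gaussian approximations match exactly. -/
theorem abs_increment_variance_sub_le {p q a₁ v₁ x N v : ℝ} (hq0 : 0 ≤ q) (hp0 : 0 ≤ p)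
    (hpq' : p + q = 1) (ha0 : 0 ≤ a₁) (ha1 : a₁ ≤ 1) (hv0 : 0 ≤ v₁) (hv1 : v₁ ≤ 1)
    (h₁ : a₁ * (1 + q) = p) (hv₁ : v₁ * (1 + 2 * q) = a₁ * (1 + 2 * q) - a₁ ^ 2)
    (hx0 : 0 ≤ x) (hx1 : x ≤ 1) (hN0 : 0 < N) (m : ℝ)
    (hv : v = m ^ 2 * (v₁ * (1 + 2 * q - q * (q / N)))) :
    |p * (m * (1 - p + q * x)) ^ 2 + q * x * (m * (-1 - p + q * x)) ^ 2 +
      q * (1 - x) * (m * (0 - p + q * x)) ^ 2 - v| ≤ m ^ 2 * (3 * |x - a₁| + 1 / N) := by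
  have hqx0 : 0 ≤ q * x := by positivity
  have hqx1 : q * x ≤ q := mul_le_of_le_one_right hq0 hx1
  have hq1 : q ≤ 1 := by linarith
  have e : p * (m * (1 - p + q * x)) ^ 2 + q * x * (m * (-1 - p + q * x)) ^ 2 +
      q * (1 - x) * (m * (0 - p + q * x)) ^ 2 - v =
      m ^ 2 * (q * (x - a₁) * (1 + 2 * p - q * x - q * a₁) + v₁ * (q * (q / N))) := by
    rw [hv]
    have hp' : p = 1 - q := by linarith
    rw [hp'] at h₁ ⊢
    linear_combination (-m ^ 2) * hv₁ - m ^ 2 * (q - a₁ + a₁ * q) * h₁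
  rw [e, abs_mul, abs_of_nonneg (sq_nonneg m)]
  have hqa : q * a₁ ≤ q := mul_le_of_le_one_right hq0 ha1
  have hqa0 : 0 ≤ q * a₁ := by positivity
  gcongr
  refine (abs_add_le _ _).trans (add_le_add ?_ ?_)
  · rw [mul_right_comm, abs_mul]
    gcongr
    rw [abs_mul, abs_of_nonneg hq0]
    have : |1 + 2 * p - q * x - q * a₁| ≤ 3 := by
      rw [abs_le]
      constructor <;> linarith
    calc q * |1 + 2 * p - q * x - q * a₁| ≤ 1 * 3 := by gcongr
      _ = 3 := one_mul 3
  · rw [abs_of_nonneg (by positivity)]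
    have : v₁ * (q * (q / N)) = v₁ * (q * q) / N := by ring
    rw [this]
    gcongr
    have : q * q ≤ 1 := by nlinarith
    calc v₁ * (q * q) ≤ 1 * 1 := by gcongr
      _ = 1 := one_mul 1

/-- Since τ ≥ τ₀, the error v²/τ² is absorbed into the order τ^(-3/2). -/
theorem taylor_error_le {m τ τ₀ v : ℝ} (hτ₀ : 0 < τ₀) (hτ : τ₀ ≤ τ) (hv00 : 0 ≤ v)
    (hv3 : v ≤ 3 * m ^ 2) :
    (2 * |m|) ^ 3 / (τ * Real.sqrt τ) + 2 * v ^ 2 / τ ^ 2 ≤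
      (8 * |m| ^ 3 + 18 * m ^ 4 / Real.sqrt τ₀) / (τ * Real.sqrt τ) := by
  have hτp : 0 < τ := hτ₀.trans_le hτ
  have hst := Real.sqrt_pos.2 hτp
  have hs0 := Real.sqrt_pos.2 hτ₀
  have hm4 : 0 ≤ m ^ 4 := by positivity
  rw [add_div]
  refine add_le_add (le_of_eq (by ring)) ?_
  have hst2 : Real.sqrt τ ^ 2 = τ := Real.sq_sqrt hτp.le
  have c1 : 2 * v ^ 2 / τ ^ 2 ≤ 18 * m ^ 4 / τ ^ 2 := by
    refine div_le_div_of_nonneg_right ?_ (sq_nonneg τ)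
    calc 2 * v ^ 2 ≤ 2 * (3 * m ^ 2) ^ 2 := by gcongr
      _ = 18 * m ^ 4 := by ring
  refine c1.trans ?_
  have c2 : 18 * m ^ 4 / τ ^ 2 = 18 * m ^ 4 / Real.sqrt τ / (τ * Real.sqrt τ) := by
    rw [div_div]
    congr 1
    nth_rewrite 1 [sq, ← hst2]
    nth_rewrite 2 [← hst2]
    rw [hst2]
    nth_rewrite 1 [← hst2]
    ring
  rw [c2]
  gcongr

/-- The error profile closes the induction: raising N by one in N/τ^(3/2) pays for the Taylor error,
raising it in √N/τ pays for the variance mismatch through √(N+1) - √N ≥ 1/(3√N), and 1/√τ carries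
the initial error. Enlarging τ only decreases the profile. -/
theorem clt_error_step_le {K A m N τ τ' : ℝ} (hN1 : 1 ≤ N) (hτp : 0 < τ) (hττ' : τ ≤ τ')
    (hA0 : 0 ≤ A) (hK : K = A + 6 * m ^ 2 + |m|) :
    K * (N / (τ' * Real.sqrt τ') + Real.sqrt N / τ' + 1 / Real.sqrt τ') +
      (A / (τ * Real.sqrt τ) + 2 * m ^ 2 / (Real.sqrt N * τ)) ≤
      K * ((N + 1) / (τ * Real.sqrt τ) + Real.sqrt (N + 1) / τ + 1 / Real.sqrt τ) := by
  have hN0 : 0 < N := by linarith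
  have hst := Real.sqrt_pos.2 hτp
  have hK0 : 0 ≤ K := by rw [hK]; positivity
  have hτ'p : 0 < τ' := hτp.trans_le hττ'
  have d1 : N / (τ' * Real.sqrt τ') ≤ N / (τ * Real.sqrt τ) := by gcongr
  have d2 : Real.sqrt N / τ' ≤ Real.sqrt N / τ := by gcongr
  have d3 : 1 / Real.sqrt τ' ≤ 1 / Real.sqrt τ := by gcongr
  have d4 : A / (τ * Real.sqrt τ) ≤ K * (1 / (τ * Real.sqrt τ)) := by
    rw [mul_one_div]
    gcongr
    have := abs_nonneg m
    have := sq_nonneg m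
    linarith
  have hsN0 : 0 < Real.sqrt N := Real.sqrt_pos.2 hN0
  have hsN2 : Real.sqrt N ^ 2 = N := Real.sq_sqrt hN0.le
  have hsM2 : Real.sqrt (N + 1) ^ 2 = N + 1 := Real.sq_sqrt (by linarith)
  have hsM0 : 0 < Real.sqrt (N + 1) := Real.sqrt_pos.2 (by linarith)
  have hsM : Real.sqrt (N + 1) ≤ 2 * Real.sqrt N := by
    refine abs_le_of_sq_le_sq' ?_ (by positivity) |>.2
    rw [mul_pow, hsN2, hsM2]
    linarith
  have d5 : 1 / (3 * Real.sqrt N) ≤ Real.sqrt (N + 1) - Real.sqrt N := by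
    rw [div_le_iff₀ (by positivity)]
    nlinarith
  have d6 : 2 * m ^ 2 / (Real.sqrt N * τ) ≤
      K * ((Real.sqrt (N + 1) - Real.sqrt N) / τ) := by
    have e : 2 * m ^ 2 / (Real.sqrt N * τ) = 6 * m ^ 2 * (1 / (3 * Real.sqrt N) / τ) := by
      field_simp
      ring
    rw [e]
    have : 0 ≤ 1 / (3 * Real.sqrt N) := by positivity
    gcongr
    have := abs_nonneg m
    linarith
  have d7 := mul_le_mul_of_nonneg_left (add_le_add (add_le_add d1 d2) d3) hK0
  have e1 : K * ((N + 1) / (τ * Real.sqrt τ) + Real.sqrt (N + 1) / τ + 1 / Real.sqrt τ) =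
      K * (N / (τ * Real.sqrt τ) + Real.sqrt N / τ + 1 / Real.sqrt τ) +
      K * (1 / (τ * Real.sqrt τ)) + K * ((Real.sqrt (N + 1) - Real.sqrt N) / τ) := by ring
  rw [e1]
  linarith

/-- The mismatch is proportional to |N₁ - a₁N|/N, whose expectation is at most 1/√N. -/
theorem sizeExp_step_error_le {p q : ℝ≥0} (hpq : p + q = 1) {a₁ : ℝ}
    (h₁ : a₁ * (1 + q) = p) (n : ℕ) (E m : ℝ) {τ : ℝ} (hτp : 0 < τ) :
    sizeExp p q n (fun s => (E + m ^ 2 / (2 * (n + 1) * τ)) +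
      3 * m ^ 2 / (2 * (n + 1) * τ) * |treeCount 1 n s - a₁ * (n + 1)|) ≤
      E + 2 * m ^ 2 / (Real.sqrt (n + 1) * τ) := by
  set N : ℝ := n + 1 with hN
  have hN1 : 1 ≤ N := by rw [hN]; linarith [Nat.cast_nonneg (α := ℝ) n]
  have hN0 : 0 < N := by linarith
  rw [sizeExp_add, sizeExp_const hpq, sizeExp_const_mul]
  have h := sizeExp_abs_treeCount_one_le hpq h₁ n
  rw [← hN] at h
  have hsN : 1 ≤ Real.sqrt N := Real.one_le_sqrt.2 hN1
  have hsN0 : 0 < Real.sqrt N := by linarith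
  have hsN2 : Real.sqrt N ^ 2 = N := Real.sq_sqrt hN0.le
  have c1 : 3 * m ^ 2 / (2 * N * τ) *
      sizeExp p q n (fun s => |treeCount 1 n s - a₁ * N|) ≤
      3 * m ^ 2 / (2 * N * τ) * Real.sqrt N := by gcongr
  have c2 : 3 * m ^ 2 / (2 * N * τ) * Real.sqrt N = 3 / 2 * (m ^ 2 / (Real.sqrt N * τ)) := by
    nth_rewrite 1 [← hsN2]
    field_simp
  have c3 : m ^ 2 / (2 * N * τ) ≤ 1 / 2 * (m ^ 2 / (Real.sqrt N * τ)) := by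
    have : m ^ 2 / (2 * N * τ) = 1 / 2 * (m ^ 2 / (N * τ)) := by field_simp
    rw [this]
    gcongr
    nlinarith
  have c4 : 2 * m ^ 2 / (Real.sqrt N * τ) = 2 * (m ^ 2 / (Real.sqrt N * τ)) := by ring
  linarith

set_option maxHeartbeats 400000 in
/-- A smoothed central limit theorem, with rate, for the number of trees of size one. -/
theorem abs_sizeExp_gaussCDF_treeCount_le {p q : ℝ≥0} (hpq : p + q = 1) (hp : 0 < p) {a₁ v₁ : ℝ}
    (h₁ : a₁ * (1 + q) = p) (hv₁ : v₁ * (1 + 2 * q) = a₁ * (1 + 2 * q) - a₁ ^ 2) (m : ℝ) {τ₀ : ℝ}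
    (hτ₀ : 0 < τ₀) (n : ℕ) (y τ : ℝ) (hτ : τ₀ ≤ τ) :
    |sizeExp p q n (fun s => gaussCDF ((y - m * (treeCount 1 n s - a₁ * (n + 1))) / Real.sqrt τ)) -
      gaussCDF (y / Real.sqrt (τ + m ^ 2 * v₁ * (n + 1)))| ≤
      (8 * |m| ^ 3 + 18 * m ^ 4 / Real.sqrt τ₀ + 6 * m ^ 2 + |m|) *
        ((n + 1) / (τ * Real.sqrt τ) + Real.sqrt (n + 1) / τ + 1 / Real.sqrt τ) := by
  have hq0 : (0 : ℝ) ≤ q := q.2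
  have hp0 : (0 : ℝ) < p := hp
  have hpq' : (p : ℝ) + q = 1 := by exact_mod_cast hpq
  have hq1 : (q : ℝ) < 1 := by linarith
  have ha0 : 0 ≤ a₁ := by
    by_contra h
    nlinarith
  have ha1 : a₁ ≤ 1 := by nlinarith
  have hv0 : 0 ≤ v₁ := by
    by_contra h
    have : v₁ * (1 + 2 * q) < 0 := mul_neg_of_neg_of_pos (not_le.1 h) (by linarith)
    nlinarith
  have hv1 : v₁ ≤ 1 := by
    have : v₁ * (1 + 2 * q) ≤ 1 * (1 + 2 * q) := by nlinarith
    exact le_of_mul_le_mul_right this (by linarith)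
  set A := 8 * |m| ^ 3 + 18 * m ^ 4 / Real.sqrt τ₀ with hA
  have hs0 := Real.sqrt_pos.2 hτ₀
  have hA0 : 0 ≤ A := by positivity
  have hm4 : 0 ≤ m ^ 4 := by positivity
  set K := A + 6 * m ^ 2 + |m| with hK
  have hK0 : 0 ≤ K := by positivity
  induction n generalizing y τ with
  | zero =>
    have hτp : 0 < τ := hτ₀.trans_le hτ
    have hst := Real.sqrt_pos.2 hτp
    simp only [sizeExp, treeCount_one_init, Nat.cast_zero, zero_add, mul_one, Real.sqrt_one]
    have b1 := abs_gaussCDF_sub_le ((y - m * (1 - a₁)) / Real.sqrt τ) (y / Real.sqrt τ)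
    have e1 : (y - m * (1 - a₁)) / Real.sqrt τ - y / Real.sqrt τ =
        -(m * (1 - a₁)) / Real.sqrt τ := by ring
    rw [e1, abs_div, abs_neg, abs_mul, abs_of_pos hst, abs_of_nonneg (by linarith : 0 ≤ 1 - a₁)]
      at b1
    have b2 : |m| * (1 - a₁) / Real.sqrt τ ≤ K * (1 / Real.sqrt τ) := by
      rw [mul_one_div]
      gcongr
      have : |m| * (1 - a₁) ≤ |m| * 1 := by gcongr; linarith
      have : 0 ≤ 6 * m ^ 2 := by positivity
      linarith
    have b3 := abs_gaussCDF_div_sqrt_sub_le y hτp (le_add_of_nonneg_right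
      (mul_nonneg (sq_nonneg m) hv0) : τ ≤ τ + m ^ 2 * v₁) le_rfl
    have b4 : 1 / (2 * τ) * |τ - (τ + m ^ 2 * v₁)| ≤ K * (1 / τ) := by
      have e : τ - (τ + m ^ 2 * v₁) = -(m ^ 2 * v₁) := by ring
      rw [e, abs_neg, abs_of_nonneg (mul_nonneg (sq_nonneg m) hv0)]
      have : m ^ 2 * v₁ ≤ m ^ 2 * 1 := by gcongr
      have e2 : 1 / (2 * τ) * (m ^ 2 * v₁) = (m ^ 2 * v₁ / 2) * (1 / τ) := by field_simp
      rw [e2]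
      gcongr
      have := abs_nonneg m
      have : 0 ≤ m ^ 2 := sq_nonneg m
      linarith
    have b5 : 0 ≤ K * (1 / (τ * Real.sqrt τ)) := by positivity
    have := abs_sub_le (gaussCDF ((y - m * (1 - a₁)) / Real.sqrt τ)) (gaussCDF (y / Real.sqrt τ))
      (gaussCDF (y / Real.sqrt (τ + m ^ 2 * v₁)))
    linarith
  | succ n ih =>
    have hτp : 0 < τ := hτ₀.trans_le hτ
    have hst := Real.sqrt_pos.2 hτp
    set N : ℝ := n + 1 with hN
    have hN1 : 1 ≤ N := by rw [hN]; linarith [Nat.cast_nonneg (α := ℝ) n]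
    have hN0 : 0 < N := by linarith
    set r : ℝ := q / N with hr
    have hrN : (q : ℝ) = r * N := by rw [hr]; field_simp
    have hr0 : 0 ≤ r := by positivity
    have hrq : r ≤ q := by rw [hr]; exact div_le_self hq0 hN1
    have hr1 : 0 < 1 - r := by linarith
    -- This variance solves m²v₁(N + 1) = (1 - r)² m²v₁N + v.
    set v := m ^ 2 * (v₁ * (1 + 2 * q - q * r)) with hv
    have hc1 : (q : ℝ) * r ≤ 1 := by nlinarith
    have hv00 : 0 ≤ v := by
      refine mul_nonneg (sq_nonneg m) (mul_nonneg hv0 ?_)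
      linarith
    have hv3 : v ≤ 3 * m ^ 2 := by
      have : v₁ * (1 + 2 * q - q * r) ≤ 1 * 3 := by
        have : 0 ≤ (q : ℝ) * r := by positivity
        gcongr
        · linarith
        · linarith
      have := mul_le_mul_of_nonneg_left this (sq_nonneg m)
      linarith
    -- One transition shrinks the centred count by 1 - r and adds variance v. Dividing by 1 - r
    -- restores the form of the test function, so the induction hypothesis is used at y/(1 - r) and
    -- τ'; the choice of v makes the target (`htgt`) exact.
    set τ' := (τ + v) / (1 - r) ^ 2 with hτ'
    have hsq1 : (1 - r) ^ 2 ≤ 1 := by nlinarith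
    have hττ' : τ ≤ τ' := by
      rw [hτ', le_div_iff₀ (by positivity)]
      nlinarith
    have hih := ih (y / (1 - r)) τ' (hτ.trans hττ')
    have hτvp : 0 < τ + v := by linarith
    have hsτ' : Real.sqrt τ' = Real.sqrt (τ + v) / (1 - r) := by
      rw [hτ', Real.sqrt_div hτvp.le, Real.sqrt_sq hr1.le]
    have harg : ∀ Z : ℝ, (y / (1 - r) - m * Z) / Real.sqrt τ' =
        (y - m * ((1 - r) * Z)) / Real.sqrt (τ + v) := by
      intro Z
      have := Real.sqrt_pos.2 hτvp
      rw [hsτ']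
      field_simp
    have htgt : y / (1 - r) / Real.sqrt (τ' + m ^ 2 * v₁ * N) =
        y / Real.sqrt (τ + m ^ 2 * v₁ * (N + 1)) := by
      have e : τ' + m ^ 2 * v₁ * N = (τ + m ^ 2 * v₁ * (N + 1)) / (1 - r) ^ 2 := by
        rw [eq_div_iff (by positivity), hτ', add_mul, div_mul_cancel₀ _ (by positivity), hv, hrN]
        ring
      have h0 : 0 < τ + m ^ 2 * v₁ * (N + 1) := by
        have : 0 ≤ m ^ 2 * v₁ * (N + 1) := by positivity
        linarith
      have := Real.sqrt_pos.2 h0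
      rw [e, Real.sqrt_div h0.le, Real.sqrt_sq hr1.le]
      field_simp
    simp only [harg] at hih
    rw [htgt] at hih
    have hstep := sizeExp_succ_treeCount p q n
      (fun x _ => gaussCDF ((y - m * (x - a₁ * ((n + 1 : ℕ) + 1))) / Real.sqrt τ))
    push_cast at hstep ⊢
    rw [← hN] at hstep ⊢
    rw [hstep]
    set F : (ℕ → ℕ) → ℝ := fun s =>
      gaussCDF ((y - m * ((1 - r) * (treeCount 1 n s - a₁ * N))) / Real.sqrt (τ + v)) with hF
    have hpt : ∀ s, IsSizeVector n s →
        |(p * gaussCDF ((y - m * (treeCount 1 n s + 1 - a₁ * (N + 1))) / Real.sqrt τ) +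
          q / N * (treeCount 1 n s *
              gaussCDF ((y - m * (treeCount 1 n s - 1 - a₁ * (N + 1))) / Real.sqrt τ) +
            2 * treeCount 2 n s *
              gaussCDF ((y - m * (treeCount 1 n s - a₁ * (N + 1))) / Real.sqrt τ) +
            (N - treeCount 1 n s - 2 * treeCount 2 n s) *
              gaussCDF ((y - m * (treeCount 1 n s - a₁ * (N + 1))) / Real.sqrt τ))) - F s| ≤
        (A / (τ * Real.sqrt τ) + m ^ 2 / (2 * N * τ)) +
          3 * m ^ 2 / (2 * N * τ) * |treeCount 1 n s - a₁ * N| := by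
      intro s hs
      have hle := treeCount_one_add_two_le hs
      rw [← hN] at hle
      have hc1 := treeCount_nonneg 1 n s
      have hc2 := treeCount_nonneg 2 n s
      set x := treeCount 1 n s / N with hx
      have hxN : treeCount 1 n s = x * N := by rw [hx]; field_simp
      have hx0 : 0 ≤ x := by positivity
      have hx1 : x ≤ 1 := by rw [hx, div_le_one hN0]; linarith
      have hqx0 : 0 ≤ (q : ℝ) * x := by positivity
      have hqx1 : (q : ℝ) * x ≤ q := mul_le_of_le_one_right hq0 hx1
      have hbd : ∀ d : ℝ, |d| ≤ 1 → |m * (d - p + q * x)| ≤ 2 * |m| := by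
        intro d hd
        rw [abs_mul, mul_comm]
        gcongr
        rw [abs_le] at hd ⊢
        constructor <;> linarith [hd.1, hd.2]
      have h3 := abs_gaussCDF_threePoint_le (M := 2 * |m|) hτp hv00
        (y - m * ((1 - r) * (x * N - a₁ * N)))
        (w₁ := p) (w₂ := q * x) (w₃ := q * (1 - x)) (h₁ := m * (1 - p + q * x))
        (h₂ := m * (-1 - p + q * x)) (h₃ := m * (0 - p + q * x))
        hp0.le hqx0 (mul_nonneg hq0 (by linarith)) (by linarith)
        (by linear_combination m * (q * x - p) * hpq')
        (hbd 1 (by norm_num)) (hbd (-1) (by norm_num)) (hbd 0 (by norm_num))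
      -- Contracted deviation plus centred increment is the new deviation, by a₁(1 + q) = p.
      have earg : ∀ d : ℝ, y - m * ((1 - r) * (x * N - a₁ * N)) - m * (d - p + q * x) =
          y - m * (x * N + d - a₁ * (N + 1)) := by
        intro d
        rw [hrN] at h₁ ⊢
        linear_combination (-m) * h₁
      rw [earg, earg, earg] at h3
      simp only [hF, hxN]
      have hL : (p : ℝ) * gaussCDF ((y - m * (x * N + 1 - a₁ * (N + 1))) / Real.sqrt τ) +
          q / N * (x * N * gaussCDF ((y - m * (x * N - 1 - a₁ * (N + 1))) / Real.sqrt τ) +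
            2 * treeCount 2 n s * gaussCDF ((y - m * (x * N - a₁ * (N + 1))) / Real.sqrt τ) +
            (N - x * N - 2 * treeCount 2 n s) *
              gaussCDF ((y - m * (x * N - a₁ * (N + 1))) / Real.sqrt τ)) =
          p * gaussCDF ((y - m * (x * N + 1 - a₁ * (N + 1))) / Real.sqrt τ) +
          q * x * gaussCDF ((y - m * (x * N + -1 - a₁ * (N + 1))) / Real.sqrt τ) +
          q * (1 - x) * gaussCDF ((y - m * (x * N + 0 - a₁ * (N + 1))) / Real.sqrt τ) := by
        rw [add_zero, ← sub_eq_add_neg]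
        field_simp
        ring
      rw [hL]
      refine h3.trans ?_
      have hvar := abs_increment_variance_sub_le hq0 hp0.le hpq' ha0 ha1 hv0 hv1 h₁ hv₁ hx0 hx1 hN0
        m (v := v) (by rw [hv, hr])
      have eabs : |x * N - a₁ * N| = |x - a₁| * N := by
        rw [← sub_mul, abs_mul, abs_of_pos hN0]
      rw [eabs]
      have t2 : |p * (m * (1 - p + q * x)) ^ 2 + q * x * (m * (-1 - p + q * x)) ^ 2 +
          q * (1 - x) * (m * (0 - p + q * x)) ^ 2 - v| / (2 * τ) ≤
          m ^ 2 / (2 * N * τ) + 3 * m ^ 2 / (2 * N * τ) * (|x - a₁| * N) := by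
        calc _ ≤ m ^ 2 * (3 * |x - a₁| + 1 / N) / (2 * τ) := by gcongr
          _ = _ := by field_simp; ring
      have t3 := taylor_error_le hτ₀ hτ hv00 hv3
      rw [← hA] at t3
      linarith
    have hdiff := abs_sizeExp_le p q hpt
    rw [sizeExp_sub] at hdiff
    have hH := sizeExp_step_error_le hpq h₁ n (A / (τ * Real.sqrt τ)) m hτp
    rw [← hN] at hH
    have hfin := clt_error_step_le (A := A) (m := m) hN1 hτp hττ' hA0 rfl
    rw [← hK] at hfin
    refine (abs_sub_le _ (sizeExp p q n F) _).trans ?_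
    linarith

end SingletonCLT

/-! ### The two-colour urn inside one tree -/

section Urn

open scoped NNReal
open Finset

/-- The probability that a random recursive tree with `s` vertices has `b` vertices of even
height. -/
noncomputable def urnWeight : ℕ → ℕ → ℝ≥0
  | 0, b => if b = 0 then 1 else 0
  | 1, b => if b = 1 then 1 else 0
  | _ + 2, 0 => 0
  | s + 2, b + 1 => urnWeight (s + 1) (b + 1) * (b + 1 : ℕ) / (s + 1 : ℕ) +
      urnWeight (s + 1) b * (s + 1 - b : ℕ) / (s + 1 : ℕ)

theorem urnWeight_eq_zero {s b : ℕ} (h : s < b) : urnWeight s b = 0 := by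
  match s, b with
  | 0, b => rw [urnWeight, if_neg (by omega)]
  | 1, b => rw [urnWeight, if_neg (by omega)]
  | s + 2, b + 1 =>
    rw [urnWeight, urnWeight_eq_zero (s := s + 1) (b := b + 1) (by omega),
      urnWeight_eq_zero (s := s + 1) (b := b) (by omega)]
    simp

variable {V : Type*} [AddCommMonoid V] [Module ℝ≥0 V]

/-- The expectation of `F` applied to the number of vertices of even height in a random recursive
tree with `s` vertices. -/
noncomputable def urnExp (s : ℕ) (F : ℕ → V) : V := ∑ b ∈ range (s + 1), urnWeight s b • F b

theorem urnExp_zero (F : ℕ → V) : urnExp 0 F = F 0 := by simp [urnExp, urnWeight]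

theorem urnExp_one (F : ℕ → V) : urnExp 1 F = F 1 := by simp [urnExp, urnWeight]

theorem urnExp_congr {s : ℕ} {F G : ℕ → V} (h : ∀ b ≤ s, F b = G b) : urnExp s F = urnExp s G :=
  sum_congr rfl fun b hb => by rw [h b (by simpa [Nat.lt_succ_iff] using hb)]

/-- The new vertex has even height exactly when its parent has odd height, so b is kept with weight
b and raised with weight s - b. Multiplying by s avoids division and covers s = 0. -/
theorem smul_urnExp_succ (s : ℕ) (F : ℕ → V) :
    (s : ℝ≥0) • urnExp (s + 1) F =
      urnExp s fun b => (b : ℝ≥0) • F b + ((s - b : ℕ) : ℝ≥0) • F (b + 1) := by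
  rcases s with _ | s
  · simp [urnExp_zero]
  have hs : ((s + 1 : ℕ) : ℝ≥0) ≠ 0 := by positivity
  have h1 : urnExp (s + 1 + 1) F =
      ∑ b ∈ range (s + 2), (urnWeight (s + 1) (b + 1) * (b + 1 : ℕ) / (s + 1 : ℕ) +
        urnWeight (s + 1) b * (s + 1 - b : ℕ) / (s + 1 : ℕ)) • F (b + 1) := by
    rw [urnExp, sum_range_succ']
    simp only [urnWeight, zero_smul, add_zero]
  rw [h1, smul_sum]
  have h2 : ∀ b ∈ range (s + 2), ((s + 1 : ℕ) : ℝ≥0) •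
      ((urnWeight (s + 1) (b + 1) * (b + 1 : ℕ) / (s + 1 : ℕ) +
        urnWeight (s + 1) b * (s + 1 - b : ℕ) / (s + 1 : ℕ)) • F (b + 1)) =
      urnWeight (s + 1) (b + 1) • (((b + 1 : ℕ) : ℝ≥0) • F (b + 1)) +
      urnWeight (s + 1) b • (((s + 1 - b : ℕ) : ℝ≥0) • F (b + 1)) := by
    intro b _
    rw [smul_smul, smul_smul, smul_smul, ← add_smul]
    congr 1
    field_simp
  rw [sum_congr rfl h2, sum_add_distrib]
  have h3 : ∑ b ∈ range (s + 2), urnWeight (s + 1) (b + 1) • (((b + 1 : ℕ) : ℝ≥0) • F (b + 1)) =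
      ∑ b ∈ range (s + 2), urnWeight (s + 1) b • ((b : ℝ≥0) • F b) := by
    have := sum_range_succ' (fun b => urnWeight (s + 1) b • ((b : ℝ≥0) • F b)) (s + 2)
    rw [sum_range_succ, urnWeight_eq_zero (s := s + 1) (b := s + 2) (by omega)] at this
    simp only [zero_smul, add_zero, Nat.cast_zero, smul_zero] at this
    exact this.symm
  rw [h3, ← sum_add_distrib]
  simp only [← smul_add]
  rfl

theorem urnExp_real (s : ℕ) (F : ℕ → ℝ) :
    urnExp s F = ∑ b ∈ range (s + 1), (urnWeight s b : ℝ) * F b := rfl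

theorem urnExp_nonneg {s : ℕ} {F : ℕ → ℝ} (h : ∀ b, 0 ≤ F b) : 0 ≤ urnExp s F :=
  sum_nonneg fun b _ => mul_nonneg (urnWeight s b).2 (h b)

theorem urnExp_mono {s : ℕ} {F G : ℕ → ℝ} (h : ∀ b, F b ≤ G b) : urnExp s F ≤ urnExp s G :=
  sum_le_sum fun b _ => mul_le_mul_of_nonneg_left (h b) (urnWeight s b).2

theorem urnExp_add (s : ℕ) (F G : ℕ → V) :
    urnExp s (fun b => F b + G b) = urnExp s F + urnExp s G := by
  simp only [urnExp, smul_add, sum_add_distrib]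

theorem urnExp_const_mul (s : ℕ) (c : ℝ) (F : ℕ → ℝ) :
    urnExp s (fun b => c * F b) = c * urnExp s F := by
  simp only [urnExp_real, mul_sum]
  exact sum_congr rfl fun b _ => by ring

/-- The recursion of the urn expectations for functions of the signed sum `2 b - s`. -/
theorem mul_urnExp_succ_real (s : ℕ) (f : ℝ → ℝ) :
    (s : ℝ) * urnExp (s + 1) (fun b => f (2 * b - (s + 1 : ℕ))) =
      urnExp s fun b => (s + (2 * b - s)) / 2 * f (2 * b - s - 1) +
        (s - (2 * b - s)) / 2 * f (2 * b - s + 1) := by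
  have h := smul_urnExp_succ s (fun b => f (2 * b - (s + 1 : ℕ)))
  rw [NNReal.smul_def, smul_eq_mul, NNReal.coe_natCast] at h
  rw [h]
  refine urnExp_congr fun b hb => ?_
  simp only [NNReal.smul_def, smul_eq_mul, NNReal.coe_natCast, Nat.cast_sub hb]
  push_cast
  congr 1
  · congr 1
    · ring
    · congr 1
      ring
  · congr 1
    · ring
    · congr 1
      ring

theorem urnExp_const_one (s : ℕ) : urnExp s (fun _ => (1 : ℝ)) = 1 := by
  induction s with
  | zero => rw [urnExp_zero]
  | succ s ih =>
    rcases s with _ | s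
    · rw [urnExp_one]
    have h := mul_urnExp_succ_real (s + 1) (fun _ => 1)
    have h2 : urnExp (s + 1) (fun b => ((s + 1 : ℕ) + (2 * b - (s + 1 : ℕ))) / 2 * (1 : ℝ) +
        ((s + 1 : ℕ) - (2 * b - (s + 1 : ℕ))) / 2 * 1) = (s + 1 : ℕ) := by
      rw [urnExp_congr (G := fun _ => ((s + 1 : ℕ) : ℝ) * 1) fun b _ => by ring,
        urnExp_const_mul, ih, mul_one]
    rw [h2] at h
    have h0 : ((s + 1 : ℕ) : ℝ) ≠ 0 := by positivity
    exact mul_left_cancel₀ h0 (h.trans (mul_one _).symm)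

theorem sum_urnWeight (s : ℕ) : ∑ b ∈ range (s + 1), urnWeight s b = 1 := by
  have := urnExp_const_one s
  rw [urnExp_real] at this
  simp only [mul_one] at this
  exact_mod_cast this

/-- The moments of the signed sum of a random recursive tree with `s` vertices. -/
noncomputable def urnMoment (k s : ℕ) : ℝ := urnExp s fun b => (2 * (b : ℝ) - s) ^ k

/-- At signed sum d the next increment is -1 or +1 with probabilities (s + d)/(2s) and (s - d)/(2s).
This pull towards zero puts a factor s - k in front of the k-th moment. -/
theorem mul_urnMoment_one_succ (s : ℕ) : s * urnMoment 1 (s + 1) = (s - 1) * urnMoment 1 s := by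
  unfold urnMoment
  rw [mul_urnExp_succ_real s (fun x => x ^ 1), ← urnExp_const_mul]
  exact urnExp_congr fun b _ => by ring

theorem mul_urnMoment_two_succ (s : ℕ) :
    s * urnMoment 2 (s + 1) = (s - 2) * urnMoment 2 s + s := by
  unfold urnMoment
  rw [mul_urnExp_succ_real s (fun x => x ^ 2),
    urnExp_congr (G := fun b => ((s : ℝ) - 2) * (2 * b - s) ^ 2 + (s : ℝ) * 1)
      (fun b _ => by ring),
    urnExp_add, urnExp_const_mul, urnExp_const_mul, urnExp_const_one, mul_one]

theorem mul_urnMoment_four_succ (s : ℕ) :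
    s * urnMoment 4 (s + 1) = (s - 4) * urnMoment 4 s + ((6 * s - 4) * urnMoment 2 s + s) := by
  unfold urnMoment
  rw [mul_urnExp_succ_real s (fun x => x ^ 4),
    urnExp_congr (G := fun b => ((s : ℝ) - 4) * (2 * b - s) ^ 4 +
      ((6 * (s : ℝ) - 4) * (2 * b - s) ^ 2 + (s : ℝ) * 1)) (fun b _ => by ring),
    urnExp_add, urnExp_add, urnExp_const_mul, urnExp_const_mul, urnExp_const_mul,
    urnExp_const_one, mul_one]

theorem urnMoment_one_eq (s : ℕ) : urnMoment 1 s = if s = 1 then 1 else 0 := by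
  match s with
  | 0 => simp [urnMoment, urnExp_zero]
  | 1 => simp [urnMoment, urnExp_one]; norm_num
  | s + 2 =>
    rw [if_neg (by omega)]
    have h := mul_urnMoment_one_succ (s + 1)
    have h0 : ((s + 1 : ℕ) : ℝ) ≠ 0 := by positivity
    have h1 : ((s + 1 : ℕ) - 1 : ℝ) * urnMoment 1 (s + 1) = 0 := by
      rw [urnMoment_one_eq (s + 1)]
      split_ifs with h2
      · have : s = 0 := by omega
        simp [this]
      · simp
    rw [h1] at h
    exact (mul_eq_zero.1 h).resolve_left h0

/-- The value s/3 solves the recursion, and the factor s - 2 erases the initial condition at s = 2,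
so s/3 is exact from s = 3 on. The indicators make the sum over the trees an expression in N₁ and
N₂. -/
theorem urnMoment_two_eq (s : ℕ) :
    urnMoment 2 s = (s - (if s = 1 then 1 else 0) - 2 * (if s = 2 then 1 else 0)) / 3 +
      (if s = 1 then 1 else 0) := by
  have e1 : urnMoment 2 1 = 1 := by simp [urnMoment, urnExp_one]; norm_num
  have e2 : urnMoment 2 2 = 0 := by
    have := mul_urnMoment_two_succ 1
    rw [e1] at this
    norm_num at this
    exact this
  match s with
  | 0 => simp [urnMoment, urnExp_zero]
  | 1 => rw [e1]; norm_num
  | 2 => rw [e2]; norm_num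
  | s + 3 =>
    induction s with
    | zero =>
      have := mul_urnMoment_two_succ 2
      rw [e2] at this
      norm_num at this ⊢
      linarith
    | succ s ih =>
      have h := mul_urnMoment_two_succ (s + 3)
      rw [ih] at h
      rw [if_neg (by omega), if_neg (by omega)] at h ⊢
      have h0 : ((s + 3 : ℕ) : ℝ) ≠ 0 := by positivity
      refine mul_left_cancel₀ h0 (h.trans ?_)
      push_cast
      ring

theorem urnMoment_two_le (s : ℕ) : urnMoment 2 s ≤ s := by
  rw [urnMoment_two_eq]
  split_ifs with h1 h2 h2
  · omega
  · rw [h1]; norm_num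
  · rw [h2]; norm_num
  · have : (0 : ℝ) ≤ s := Nat.cast_nonneg s
    linarith

theorem urnMoment_four_le (s : ℕ) : urnMoment 4 s ≤ 3 * s ^ 2 := by
  induction s with
  | zero => simp [urnMoment, urnExp_zero]
  | succ s ih =>
    rcases s with _ | s
    · simp [urnMoment, urnExp_one]
      norm_num
    have h := mul_urnMoment_four_succ (s + 1)
    have h2 := urnMoment_two_le (s + 1)
    have h20 : 0 ≤ urnMoment 2 (s + 1) := urnExp_nonneg fun b => sq_nonneg _
    have h40 : 0 ≤ urnMoment 4 (s + 1) := urnExp_nonneg fun b => by positivity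
    set t : ℝ := ((s + 1 : ℕ) : ℝ) with ht
    have ht0 : 0 < t := by positivity
    have h3 : t * urnMoment 4 (s + 1 + 1) ≤ t * (3 * (t + 1) ^ 2) := by
      rw [h]
      nlinarith
    have := le_of_mul_le_mul_left h3 ht0
    push_cast at this ⊢
    rw [ht] at this
    push_cast at this
    linarith

/-- With c = √s, |d|³ ≤ (c/2)d² + d⁴/(2c), and the moment bounds s and 3s² give 1/2 + 3/2 = 2. -/
theorem urnExp_abs_pow_three_le (s : ℕ) :
    urnExp s (fun b => |2 * (b : ℝ) - s| ^ 3) ≤ 2 * (s * Real.sqrt s) := by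
  rcases Nat.eq_zero_or_pos s with rfl | hs
  · simp [urnExp_zero]
  have hs0 : (0 : ℝ) < s := by exact_mod_cast hs
  set c := Real.sqrt s with hc
  have hc0 : 0 < c := Real.sqrt_pos.2 hs0
  have hc2 : c ^ 2 = s := Real.sq_sqrt hs0.le
  have h : urnExp s (fun b => |2 * (b : ℝ) - s| ^ 3) ≤
      urnExp s (fun b => c / 2 * (2 * (b : ℝ) - s) ^ 2 + 1 / (2 * c) * (2 * (b : ℝ) - s) ^ 4) := by
    refine urnExp_mono fun b => ?_
    set d := 2 * (b : ℝ) - s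
    have e4 : d ^ 4 = |d| ^ 4 := by rw [← abs_pow, abs_of_nonneg (by positivity)]
    rw [← sq_abs d, e4, ← sub_nonneg]
    have : c / 2 * |d| ^ 2 + 1 / (2 * c) * |d| ^ 4 - |d| ^ 3 =
        |d| ^ 2 * (c - |d|) ^ 2 / (2 * c) := by field_simp; ring
    rw [this]
    positivity
  refine h.trans ?_
  rw [urnExp_add, urnExp_const_mul, urnExp_const_mul]
  have h2 : c / 2 * urnMoment 2 s ≤ c / 2 * s := by
    have := urnMoment_two_le s
    gcongr
  have h4 : 1 / (2 * c) * urnMoment 4 s ≤ 1 / (2 * c) * (3 * s ^ 2) := by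
    have := urnMoment_four_le s
    gcongr
  have e : 1 / (2 * c) * (3 * (s : ℝ) ^ 2) = 3 / 2 * (s * c) := by
    rw [← hc2]
    field_simp
  unfold urnMoment at h2 h4
  linarith

end Urn

/-! ### The genealogical forest of the walk -/

section Forest

open Finset Function

/-- The time at which the step repeated at time `n` was first drawn. -/
def treeRoot (e u : ℕ → ℕ) : ℕ → ℕ
  | 0 => 0
  | 1 => 1
  | (n + 2) =>
    if e (n + 2) = 0 then
      if _h : u (n + 2) < n + 2 then treeRoot e u (u (n + 2)) else 0
    else n + 2

/-- Whether the step at time `n` has the same sign as its root. -/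
def treeSign (e u : ℕ → ℕ) : ℕ → Bool
  | 0 => true
  | 1 => true
  | (n + 2) =>
    if e (n + 2) = 0 then
      if _h : u (n + 2) < n + 2 then !treeSign e u (u (n + 2)) else true
    else true

/-- The number of times at most `n` with root `k`. -/
def treeSize (e u : ℕ → ℕ) (n k : ℕ) : ℕ := #{v ∈ Icc 1 n | treeRoot e u v = k}

/-- The number of times at most `n` with root `k` and a positive sign. -/
def treePlus (e u : ℕ → ℕ) (n k : ℕ) : ℕ :=
  #{v ∈ Icc 1 n | treeRoot e u v = k ∧ treeSign e u v = true}

/-- The sequences `e` and `u` take admissible values up to time `n`. -/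
def IsAdmissible (e u : ℕ → ℕ) (n : ℕ) : Prop :=
  e 1 = 1 ∧ ∀ j, 2 ≤ j → j ≤ n → (e j = 0 ∨ e j = 1) ∧ 1 ≤ u j ∧ u j < j

variable {e u e' u' : ℕ → ℕ} {n : ℕ}

/-- The root depends only on the entries at times 2, …, n. This and its companions allow the driving
sequences to be replaced by a finite padded history. -/
theorem treeRoot_congr (he : ∀ j, 2 ≤ j → j ≤ n → e j = e' j)
    (hu : ∀ j, 2 ≤ j → j ≤ n → u j = u' j) {v : ℕ} (hv : v ≤ n) :
    treeRoot e u v = treeRoot e' u' v := by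
  induction v using Nat.strong_induction_on with
  | _ v ih =>
    match v with
    | 0 => rw [treeRoot, treeRoot]
    | 1 => rw [treeRoot, treeRoot]
    | v + 2 =>
      rw [treeRoot, treeRoot, he _ (by omega) hv, hu _ (by omega) hv]
      split_ifs with h1 h2
      · exact ih _ h2 (by omega)
      · rfl
      · rfl

theorem treeSign_congr (he : ∀ j, 2 ≤ j → j ≤ n → e j = e' j)
    (hu : ∀ j, 2 ≤ j → j ≤ n → u j = u' j) {v : ℕ} (hv : v ≤ n) :
    treeSign e u v = treeSign e' u' v := by
  induction v using Nat.strong_induction_on with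
  | _ v ih =>
    match v with
    | 0 => rw [treeSign, treeSign]
    | 1 => rw [treeSign, treeSign]
    | v + 2 =>
      rw [treeSign, treeSign, he _ (by omega) hv, hu _ (by omega) hv]
      split_ifs with h1 h2
      · rw [ih _ h2 (by omega)]
      · rfl
      · rfl

theorem treeSize_congr (he : ∀ j, 2 ≤ j → j ≤ n → e j = e' j)
    (hu : ∀ j, 2 ≤ j → j ≤ n → u j = u' j) : treeSize e u n = treeSize e' u' n := by
  funext k
  unfold treeSize
  congr 1
  refine filter_congr fun v hv => ?_
  rw [treeRoot_congr he hu (mem_Icc.1 hv).2]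

theorem treePlus_congr (he : ∀ j, 2 ≤ j → j ≤ n → e j = e' j)
    (hu : ∀ j, 2 ≤ j → j ≤ n → u j = u' j) : treePlus e u n = treePlus e' u' n := by
  funext k
  unfold treePlus
  congr 1
  refine filter_congr fun v hv => ?_
  rw [treeRoot_congr he hu (mem_Icc.1 hv).2, treeSign_congr he hu (mem_Icc.1 hv).2]

theorem negStep_congr {x : ℕ → ℝ} (he : ∀ j, 1 ≤ j → j ≤ n → e j = e' j)
    (hu : ∀ j, 2 ≤ j → j ≤ n → u j = u' j) {v : ℕ} (hv : v ≤ n) :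
    negStep x e u v = negStep x e' u' v := by
  induction v using Nat.strong_induction_on with
  | _ v ih =>
    match v with
    | 0 => rw [negStep, negStep]
    | 1 => rw [negStep, negStep]
    | v + 2 =>
      have hc : innovationCount e (v + 2) = innovationCount e' (v + 2) :=
        sum_congr rfl fun j hj => he j (mem_Icc.1 hj).1 ((mem_Icc.1 hj).2.trans hv)
      rw [negStep, negStep, he _ (by omega) hv, hu _ (by omega) hv, hc]
      split_ifs with h1 h2
      · rw [ih _ h2 (by omega)]
      · rfl
      · rfl

theorem IsAdmissible.treeRoot_mem (h : IsAdmissible e u n) {v : ℕ} (h1 : 1 ≤ v) (hv : v ≤ n) :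
    1 ≤ treeRoot e u v ∧ treeRoot e u v ≤ v ∧ e (treeRoot e u v) = 1 := by
  induction v using Nat.strong_induction_on with
  | _ v ih =>
    match v with
    | 1 =>
      rw [treeRoot]
      exact ⟨le_rfl, le_rfl, h.1⟩
    | v + 2 =>
      obtain ⟨he, hu1, hu⟩ := h.2 (v + 2) (by omega) hv
      rw [treeRoot, dif_pos hu]
      split_ifs with h0
      · obtain ⟨a, b, c⟩ := ih _ hu hu1 (by omega)
        exact ⟨a, by omega, c⟩
      · exact ⟨by omega, le_rfl, he.resolve_left h0⟩

theorem IsAdmissible.treeRoot_mem_Icc (h : IsAdmissible e u n) {v : ℕ} (hv : v ∈ Icc 1 n) :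
    treeRoot e u v ∈ Icc 1 n := by
  have hv := mem_Icc.1 hv
  obtain ⟨a, b, _⟩ := h.treeRoot_mem hv.1 hv.2
  exact mem_Icc.2 ⟨a, b.trans hv.2⟩

theorem IsAdmissible.negStep_eq (h : IsAdmissible e u n) (x : ℕ → ℝ) {v : ℕ} (h1 : 1 ≤ v)
    (hv : v ≤ n) : negStep x e u v =
      (if treeSign e u v = true then 1 else -1) * x (innovationCount e (treeRoot e u v)) := by
  induction v using Nat.strong_induction_on with
  | _ v ih =>
    match v with
    | 1 => simp [negStep, treeSign, treeRoot, innovationCount, h.1]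
    | v + 2 =>
      obtain ⟨he, hu1, hu⟩ := h.2 (v + 2) (by omega) hv
      rw [negStep, treeSign, treeRoot, dif_pos hu, dif_pos hu, dif_pos hu]
      by_cases h0 : e (v + 2) = 0
      · rw [if_pos h0, if_pos h0, if_pos h0, ih _ hu hu1 (by omega)]
        rcases treeSign e u (u (v + 2)) <;> simp
      · simp [h0]

theorem treePlus_le_treeSize (e u : ℕ → ℕ) (n k : ℕ) : treePlus e u n k ≤ treeSize e u n k :=
  card_le_card (monotone_filter_right _ fun _ _ h => h.1)

theorem card_filter_treeSign_false (e u : ℕ → ℕ) (n k : ℕ) :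
    #{v ∈ Icc 1 n | treeRoot e u v = k ∧ ¬ treeSign e u v = true} =
      treeSize e u n k - treePlus e u n k := by
  have h : treePlus e u n k + #{v ∈ Icc 1 n | treeRoot e u v = k ∧ ¬ treeSign e u v = true} =
      treeSize e u n k := by
    unfold treePlus treeSize
    rw [← filter_filter, ← filter_filter]
    exact card_filter_add_card_filter_not _
  omega

/-- Sums over vertices of functions of root and sign, grouped by root. -/
theorem IsAdmissible.sum_root_sign {M : Type*} [AddCommMonoid M] (h : IsAdmissible e u n)
    (G : ℕ → Bool → M) :
    ∑ v ∈ Icc 1 n, G (treeRoot e u v) (treeSign e u v) =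
      ∑ k ∈ Icc 1 n, (treePlus e u n k • G k true +
        (treeSize e u n k - treePlus e u n k) • G k false) := by
  rw [← sum_fiberwise_of_maps_to (g := treeRoot e u) (t := Icc 1 n)
    (fun v hv => h.treeRoot_mem_Icc hv)]
  refine sum_congr rfl fun k _ => ?_
  rw [← sum_filter_add_sum_filter_not _ (fun v => treeSign e u v = true), filter_filter,
    filter_filter]
  congr 1
  · rw [treePlus, ← sum_const]
    refine sum_congr rfl fun v hv => ?_
    obtain ⟨_, h1, h2⟩ := mem_filter.1 hv
    rw [h1, h2]
  · rw [← card_filter_treeSign_false, ← sum_const]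
    refine sum_congr rfl fun v hv => ?_
    obtain ⟨_, h1, h2⟩ := mem_filter.1 hv
    rw [h1, Bool.eq_false_of_not_eq_true h2]

theorem IsAdmissible.sum_negStep (h : IsAdmissible e u n) (x : ℕ → ℝ) :
    ∑ v ∈ Icc 1 n, negStep x e u v =
      ∑ k ∈ Icc 1 n, (2 * (treePlus e u n k : ℝ) - treeSize e u n k) *
        x (innovationCount e k) := by
  rw [sum_congr rfl fun v hv => h.negStep_eq x (mem_Icc.1 hv).1 (mem_Icc.1 hv).2,
    h.sum_root_sign fun k b => (if b = true then 1 else -1) * x (innovationCount e k)]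
  refine sum_congr rfl fun k _ => ?_
  have := treePlus_le_treeSize e u n k
  simp only [nsmul_eq_mul, Nat.cast_sub this, if_true]
  simp
  ring

theorem IsAdmissible.treeSize_eq_zero (h : IsAdmissible e u n) {k : ℕ} (hk : k ∉ Icc 1 n) :
    treeSize e u n k = 0 :=
  card_eq_zero.2 (filter_eq_empty_iff.2 fun _ hv hr => hk (hr ▸ h.treeRoot_mem_Icc hv))

theorem IsAdmissible.treeSize_eq_zero_of_ne (h : IsAdmissible e u n) {k : ℕ} (hk : e k ≠ 1) :
    treeSize e u n k = 0 :=
  card_eq_zero.2 (filter_eq_empty_iff.2 fun _ hv hr =>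
    hk (hr ▸ (h.treeRoot_mem (mem_Icc.1 hv).1 (mem_Icc.1 hv).2).2.2))

theorem treeSize_succ (e u : ℕ → ℕ) (n : ℕ) : treeSize e u (n + 1) =
    update (treeSize e u n) (treeRoot e u (n + 1))
      (treeSize e u n (treeRoot e u (n + 1)) + 1) := by
  funext k
  have hI : Icc 1 (n + 1) = insert (n + 1) (Icc 1 n) :=
    (insert_Icc_right_eq_Icc_add_one (by omega)).symm
  have hn : n + 1 ∉ Icc 1 n := by simp
  unfold treeSize
  rw [hI, filter_insert, update_apply]
  by_cases hk : treeRoot e u (n + 1) = k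
  · rw [if_pos hk, if_pos hk.symm, card_insert_of_notMem fun h => hn (mem_filter.1 h).1, hk]
  · rw [if_neg hk, if_neg (Ne.symm hk)]

theorem treePlus_succ (e u : ℕ → ℕ) (n : ℕ) : treePlus e u (n + 1) =
    if treeSign e u (n + 1) = true then
      update (treePlus e u n) (treeRoot e u (n + 1)) (treePlus e u n (treeRoot e u (n + 1)) + 1)
    else treePlus e u n := by
  funext k
  have hI : Icc 1 (n + 1) = insert (n + 1) (Icc 1 n) :=
    (insert_Icc_right_eq_Icc_add_one (by omega)).symm
  have hn : n + 1 ∉ Icc 1 n := by simp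
  unfold treePlus
  rw [hI, filter_insert]
  by_cases hs : treeSign e u (n + 1) = true
  · rw [if_pos hs, update_apply]
    by_cases hk : treeRoot e u (n + 1) = k
    · rw [if_pos ⟨hk, hs⟩, if_pos hk.symm, card_insert_of_notMem fun h => hn (mem_filter.1 h).1, hk]
    · rw [if_neg fun h => hk h.1, if_neg (Ne.symm hk)]
  · rw [if_neg hs, if_neg fun h => hs h.2]

theorem IsAdmissible.treeSize_succ_of_one (h : IsAdmissible e u (n + 1)) (he : e (n + 2) = 1) :
    treeSize e u (n + 2) = update (treeSize e u (n + 1)) (n + 2) 1 := by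
  have hr : treeRoot e u (n + 2) = n + 2 := by rw [treeRoot, he]; simp
  rw [treeSize_succ, hr, h.treeSize_eq_zero (by simp)]

theorem IsAdmissible.treePlus_succ_of_one (h : IsAdmissible e u (n + 1)) (he : e (n + 2) = 1) :
    treePlus e u (n + 2) = update (treePlus e u (n + 1)) (n + 2) 1 := by
  have hr : treeRoot e u (n + 2) = n + 2 := by rw [treeRoot, he]; simp
  have hs : treeSign e u (n + 2) = true := by rw [treeSign, he]; simp
  have h0 : treePlus e u (n + 1) (n + 2) = 0 :=
    Nat.le_zero.1 ((treePlus_le_treeSize e u _ _).trans_eq (h.treeSize_eq_zero (by simp)))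
  rw [treePlus_succ, hr, if_pos hs, h0]

theorem treeSize_succ_of_zero (he : e (n + 2) = 0) (hu : u (n + 2) < n + 2) :
    treeSize e u (n + 2) = update (treeSize e u (n + 1)) (treeRoot e u (u (n + 2)))
      (treeSize e u (n + 1) (treeRoot e u (u (n + 2))) + 1) := by
  have hr : treeRoot e u (n + 2) = treeRoot e u (u (n + 2)) := by
    rw [treeRoot, if_pos he, dif_pos hu]
  rw [treeSize_succ, hr]

/-- A repeated step flips the sign of its parent, so the positive count rises exactly when the
parent is negative. -/
theorem treePlus_succ_of_zero (he : e (n + 2) = 0) (hu : u (n + 2) < n + 2) :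
    treePlus e u (n + 2) = if treeSign e u (u (n + 2)) = true then treePlus e u (n + 1)
      else update (treePlus e u (n + 1)) (treeRoot e u (u (n + 2)))
        (treePlus e u (n + 1) (treeRoot e u (u (n + 2))) + 1) := by
  have hr : treeRoot e u (n + 2) = treeRoot e u (u (n + 2)) := by
    rw [treeRoot, if_pos he, dif_pos hu]
  have hs : treeSign e u (n + 2) = !treeSign e u (u (n + 2)) := by
    rw [treeSign, if_pos he, dif_pos hu]
  rw [treePlus_succ, hr, hs]
  rcases treeSign e u (u (n + 2)) <;> simp

theorem treeSize_one (e u : ℕ → ℕ) : treeSize e u 1 = update (0 : ℕ → ℕ) 1 1 := by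
  rw [treeSize_succ e u 0]
  simp [treeRoot, treeSize]
  rfl

theorem treePlus_one (e u : ℕ → ℕ) : treePlus e u 1 = update (0 : ℕ → ℕ) 1 1 := by
  rw [treePlus_succ e u 0]
  simp [treeRoot, treeSign, treePlus]
  rfl

/-- The counter jumps at every innovation time. Distinct roots therefore draw distinct, hence
independent, innovations. -/
theorem innovationCount_injOn (e : ℕ → ℕ) : Set.InjOn (innovationCount e)
    {k | 1 ≤ k ∧ e k = 1} := by
  have hlt : ∀ j k, j < k → 1 ≤ k ∧ e k = 1 → innovationCount e j < innovationCount e k := by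
    intro j k hjk hk
    have h1 : innovationCount e j ≤ innovationCount e (k - 1) :=
      sum_le_sum_of_subset (Icc_subset_Icc_right (by omega))
    have h2 : innovationCount e k = innovationCount e (k - 1) + 1 := by
      obtain ⟨k, rfl⟩ := Nat.exists_eq_add_of_le' hk.1
      rw [innovationCount, sum_Icc_succ_top (by omega), hk.2]
      rfl
    omega
  intro j hj k hk hjk
  rcases lt_trichotomy j k with h | h | h
  · exact absurd hjk (hlt j k h hk).ne
  · exact h
  · exact absurd hjk (hlt k j h hj).ne'

theorem one_le_innovationCount {k : ℕ} (hk : 1 ≤ k) (he : e k = 1) : 1 ≤ innovationCount e k :=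
  he ▸ single_le_sum (f := e) (fun _ _ => Nat.zero_le _) (mem_Icc.2 ⟨hk, le_rfl⟩)

end Forest

/-! ### The law of the forest -/

section ForestLaw

open scoped NNReal
open Finset Function

variable {Ω : Type*} [MeasurableSpace Ω] {P : Measure Ω}

theorem integrable_comp_of_ae_mem_finite [IsProbabilityMeasure P] {τ E : Type*} [MeasurableSpace τ] [Countable τ]
    [MeasurableSingletonClass τ] [NormedAddCommGroup E] [MeasurableSpace E] [BorelSpace E]
    [SecondCountableTopology E] {T : Ω → τ} (hT : Measurable T) {S : Set τ} (hS : S.Finite)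
    (h : ∀ᵐ ω ∂P, T ω ∈ S) (f : τ → E) : Integrable (fun ω => f (T ω)) P := by
  obtain ⟨C, hC⟩ := (hS.image fun t => ‖f t‖).bddAbove
  refine Integrable.of_bound ((measurable_of_countable f).comp hT).aestronglyMeasurable C ?_
  filter_upwards [h] with ω hω
  exact hC ⟨_, hω, rfl⟩

/-- All spaces being countable, it is enough to factor the joint law at single points. This
separates past (ε, U) from present (ε, U), given that ε and U are independent and each has
independent past and present. -/
theorem indepFun_prodMk_prodMk_swap [IsProbabilityMeasure P] {α β γ δ : Type*}
    [MeasurableSpace α] [MeasurableSpace β]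
    [MeasurableSpace γ] [MeasurableSpace δ] [Countable α] [Countable β] [Countable γ] [Countable δ]
    [MeasurableSingletonClass α] [MeasurableSingletonClass β] [MeasurableSingletonClass γ]
    [MeasurableSingletonClass δ] {A : Ω → α} {B : Ω → β} {a : Ω → γ} {b : Ω → δ}
    (hA : Measurable A) (hB : Measurable B) (ha : Measurable a) (hb : Measurable b)
    (hAa : IndepFun A a P) (hBb : IndepFun B b P)
    (h : IndepFun (fun ω => (A ω, a ω)) (fun ω => (B ω, b ω)) P) :
    IndepFun (fun ω => (A ω, B ω)) (fun ω => (a ω, b ω)) P := by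
  have hAB : IndepFun A B P := h.comp measurable_fst measurable_fst
  have hab : IndepFun a b P := h.comp measurable_snd measurable_snd
  rw [indepFun_iff_map_prod_eq_prod_map_map (hA.prodMk hB).aemeasurable
    (ha.prodMk hb).aemeasurable]
  refine Measure.ext_of_singleton ?_
  rintro ⟨⟨x, y⟩, ⟨s, t⟩⟩
  have sA := measurableSet_singleton x
  have sB := measurableSet_singleton y
  have sa := measurableSet_singleton s
  have sb := measurableSet_singleton t
  have e1 : (fun ω => ((A ω, B ω), (a ω, b ω))) ⁻¹' {((x, y), (s, t))} =
      (fun ω => (A ω, a ω)) ⁻¹' ({x} ×ˢ {s}) ∩ (fun ω => (B ω, b ω)) ⁻¹' ({y} ×ˢ {t}) := by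
    ext ω
    simp only [Set.mem_preimage, Set.mem_prod, Set.mem_singleton_iff, Prod.mk.injEq,
      Set.mem_inter_iff]
    tauto
  rw [Measure.map_apply ((hA.prodMk hB).prodMk (ha.prodMk hb)) (measurableSet_singleton _), e1,
    h.measure_inter_preimage_eq_mul _ _ (sA.prod sa) (sB.prod sb),
    ← Set.singleton_prod_singleton, Measure.prod_prod,
    Measure.map_apply (hA.prodMk hB) (measurableSet_singleton _),
    Measure.map_apply (ha.prodMk hb) (measurableSet_singleton _),
    ← Set.singleton_prod_singleton, ← Set.singleton_prod_singleton]
  simp only [Set.mk_preimage_prod]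
  rw [hAa.measure_inter_preimage_eq_mul _ _ sA sa, hBb.measure_inter_preimage_eq_mul _ _ sB sb,
    hAB.measure_inter_preimage_eq_mul _ _ sA sB, hab.measure_inter_preimage_eq_mul _ _ sa sb]
  ring

/-- The sequence with the entries `a` at the indices `2, …, n + 1`, and `1` elsewhere. -/
def padSeq {n : ℕ} (a : range n → ℕ) (j : ℕ) : ℕ :=
  if h : 2 ≤ j ∧ j - 2 < n then a ⟨j - 2, mem_range.2 h.2⟩ else 1

theorem padSeq_restrict (f : ℕ → ℕ) {n j : ℕ} (h2 : 2 ≤ j) (hj : j ≤ n + 1) :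
    padSeq (fun i : range n => f (i + 2)) j = f j := by
  rw [padSeq, dif_pos ⟨h2, by omega⟩]
  simp only
  congr 1
  omega

theorem padSeq_one {n : ℕ} (a : range n → ℕ) : padSeq a 1 = 1 := by
  rw [padSeq, dif_neg (by omega)]

theorem padSeq_restrict_succ (f : ℕ → ℕ) (n : ℕ) :
    padSeq (fun i : range (n + 1) => f (i + 2)) =
      update (padSeq (fun i : range n => f (i + 2))) (n + 2) (f (n + 2)) := by
  funext j
  rw [update_apply]
  split_ifs with h
  · rw [h, padSeq_restrict f (by omega) (by omega)]
  · by_cases hj : 2 ≤ j ∧ j ≤ n + 1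
    · rw [padSeq_restrict f hj.1 (by omega), padSeq_restrict f hj.1 (by omega)]
    · rw [padSeq, padSeq, dif_neg (by omega), dif_neg (by omega)]

/-- The values of `ε` and `U` at the times `2, …, n + 1`. -/
def reinforcementHistory (ε U : ℕ → Ω → ℕ) (n : ℕ) (ω : Ω) : (range n → ℕ) × (range n → ℕ) :=
  (fun i => ε (i + 2) ω, fun i => U (i + 2) ω)

variable {μ : Measure ℝ} {p q : ℝ≥0} {X : ℕ → Ω → ℝ} {ε U : ℕ → Ω → ℕ}

namespace IsReinforcementInput

theorem measurable_history (h : IsReinforcementInput P μ p X ε U) (n : ℕ) :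
    Measurable (reinforcementHistory ε U n) :=
  (measurable_pi_lambda _ fun i => h.measurable_ε _ (by omega)).prodMk
    (measurable_pi_lambda _ fun i => h.measurable_U _ (by omega))

theorem real_ε_one (h : IsReinforcementInput P μ p X ε U) (n : ℕ) :
    P.real (ε (n + 2) ⁻¹' {1}) = p := by
  have := h.prob_ε_one (n + 2) (by omega)
  rw [measureReal_def, show ε (n + 2) ⁻¹' {1} = {ω | ε (n + 2) ω = 1} from rfl, this,
    ENNReal.toReal_ofReal p.coe_nonneg]

theorem real_ε_zero (h : IsReinforcementInput P μ p X ε U) (hpq : p + q = 1) (n : ℕ) :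
    P.real (ε (n + 2) ⁻¹' {0}) = q := by
  have := h.prob_ε_zero (n + 2) (by omega)
  have hq : (1 : ℝ) - p = q := by
    have : (p : ℝ) + q = 1 := by exact_mod_cast hpq
    linarith
  rw [measureReal_def, show ε (n + 2) ⁻¹' {0} = {ω | ε (n + 2) ω = 0} from rfl, this, hq,
    ENNReal.toReal_ofReal q.coe_nonneg]

theorem real_U (h : IsReinforcementInput P μ p X ε U) {n v : ℕ} (hv : v ∈ Icc 1 (n + 1)) :
    P.real (U (n + 2) ⁻¹' {v}) = 1 / (n + 1) := by
  have hv := mem_Icc.1 hv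
  have := h.prob_U (n + 2) (by omega) v hv.1 (by omega)
  rw [measureReal_def, show U (n + 2) ⁻¹' {v} = {ω | U (n + 2) ω = v} from rfl, this,
    ENNReal.toReal_ofReal]
  · push_cast
    ring
  · push_cast
    have : (0 : ℝ) ≤ n := n.cast_nonneg
    exact div_nonneg zero_le_one (by linarith)

variable [IsProbabilityMeasure P]

/-- The probabilities prescribed for the values 0 and 1 already add up to one. -/
theorem ae_ε (h : IsReinforcementInput P μ p X ε U) (hpq : p + q = 1) (n : ℕ) :
    ∀ᵐ ω ∂P, ε (n + 2) ω = 0 ∨ ε (n + 2) ω = 1 := by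
  have hm := h.measurable_ε (n + 2) (by omega)
  have h1 : P.real (ε (n + 2) ⁻¹' ({0, 1} : Finset ℕ)) = 1 := by
    rw [← sum_measureReal_preimage_singleton _ fun y _ => hm (measurableSet_singleton y),
      sum_pair (by norm_num), h.real_ε_zero hpq, h.real_ε_one, add_comm]
    exact_mod_cast hpq
  have h2 := (mem_ae_iff_prob_eq_one (hm (Finset.measurableSet _))).2
    (by rwa [measureReal_def, ENNReal.toReal_eq_one_iff] at h1)
  filter_upwards [h2] with ω hω
  simpa using hω

theorem ae_U (h : IsReinforcementInput P μ p X ε U) (n : ℕ) :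
    ∀ᵐ ω ∂P, U (n + 2) ω ∈ Icc 1 (n + 1) := by
  have hm := h.measurable_U (n + 2) (by omega)
  have h1 : P.real (U (n + 2) ⁻¹' (Icc 1 (n + 1) : Finset ℕ)) = 1 := by
    rw [← sum_measureReal_preimage_singleton _ fun y _ => hm (measurableSet_singleton y),
      sum_congr rfl fun v hv => h.real_U hv]
    simp
    field_simp
  have h2 := (mem_ae_iff_prob_eq_one (hm (Finset.measurableSet _))).2
    (by rwa [measureReal_def, ENNReal.toReal_eq_one_iff] at h1)
  filter_upwards [h2] with ω hω
  simpa using hω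

theorem ae_isAdmissible (h : IsReinforcementInput P μ p X ε U) (hpq : p + q = 1) (n : ℕ) :
    ∀ᵐ ω ∂P, IsAdmissible (padSeq (reinforcementHistory ε U n ω).1)
      (padSeq (reinforcementHistory ε U n ω).2) (n + 1) := by
  filter_upwards [ae_all_iff.2 (h.ae_ε hpq), ae_all_iff.2 h.ae_U] with ω h1 h2
  refine ⟨padSeq_one _, fun j hj hjn => ?_⟩
  obtain ⟨k, rfl⟩ := Nat.exists_eq_add_of_le' hj
  have e1 := padSeq_restrict (fun k => ε k ω) hj hjn
  have e2 := padSeq_restrict (fun k => U k ω) hj hjn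
  have h2 := mem_Icc.1 (h2 k)
  simp only [reinforcementHistory]
  rw [e1, e2]
  exact ⟨h1 k, h2.1, by omega⟩

theorem integrable_history (h : IsReinforcementInput P μ p X ε U) (hpq : p + q = 1) (n : ℕ)
    (f : (range n → ℕ) × (range n → ℕ) → ℂ) :
    Integrable (fun ω => f (reinforcementHistory ε U n ω)) P := by
  refine integrable_comp_of_ae_mem_finite (h.measurable_history n)
    ((Set.finite_Icc (0 : range n → ℕ) fun _ => 1).prod
      (Set.finite_Icc (0 : range n → ℕ) fun _ => n + 1)) ?_ f
  filter_upwards [ae_all_iff.2 (h.ae_ε hpq), ae_all_iff.2 h.ae_U] with ω h1 h2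
  refine ⟨⟨zero_le, fun i => ?_⟩, ⟨zero_le, fun i => ?_⟩⟩
  · have := h1 i
    simp only [reinforcementHistory]
    omega
  · have := mem_Icc.1 (h2 i)
    have := mem_range.1 i.2
    simp only [reinforcementHistory]
    omega

theorem indepFun_history (h : IsReinforcementInput P μ p X ε U) (n : ℕ) :
    IndepFun (reinforcementHistory ε U n) (fun ω => (ε (n + 2) ω, U (n + 2) ω)) P := by
  have hd : Disjoint (range n) {n} := by simp
  have hmε : ∀ i, Measurable (ε (i + 2)) := fun i => h.measurable_ε _ (by omega)
  have hmU : ∀ i, Measurable (U (i + 2)) := fun i => h.measurable_U _ (by omega)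
  have mr : Measurable fun (f : ℕ → ℕ) => (fun i : range n => f i, f n) :=
    (measurable_pi_lambda _ fun i => measurable_pi_apply _).prodMk (measurable_pi_apply _)
  refine indepFun_prodMk_prodMk_swap (A := fun ω (i : range n) => ε (i + 2) ω)
    (B := fun ω (i : range n) => U (i + 2) ω) (measurable_pi_lambda _ fun i => hmε _)
    (measurable_pi_lambda _ fun i => hmU _) (hmε n) (hmU n) ?_ ?_ ?_
  · exact (h.iIndepFun_ε.indepFun_finset (range n) {n} hd hmε).comp measurable_id
      (measurable_pi_apply (⟨n, by simp⟩ : ({n} : Finset ℕ)))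
  · exact (h.iIndepFun_U.indepFun_finset (range n) {n} hd hmU).comp measurable_id
      (measurable_pi_apply (⟨n, by simp⟩ : ({n} : Finset ℕ)))
  · exact h.indepFun_ε_U.comp mr mr

theorem integral_history_indicator (h : IsReinforcementInput P μ p X ε U) (n e v : ℕ)
    (f : (range n → ℕ) × (range n → ℕ) → ℂ) :
    ∫ ω, f (reinforcementHistory ε U n ω) *
      (if ε (n + 2) ω = e ∧ U (n + 2) ω = v then 1 else 0) ∂P =
    (∫ ω, f (reinforcementHistory ε U n ω) ∂P) *
      (P.real (ε (n + 2) ⁻¹' {e}) * P.real (U (n + 2) ⁻¹' {v}) : ℝ) := by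
  have hmε := h.measurable_ε (n + 2) (by omega)
  have hmU := h.measurable_U (n + 2) (by omega)
  have hi := (h.indepFun_history n).comp (measurable_of_countable f)
    (measurable_of_countable fun x : ℕ × ℕ => if x.1 = e ∧ x.2 = v then (1 : ℂ) else 0)
  have hi2 : IndepFun (ε (n + 2)) (U (n + 2)) P :=
    h.indepFun_ε_U.comp (measurable_pi_apply n) (measurable_pi_apply n)
  have := hi.integral_fun_mul_eq_mul_integral
    ((measurable_of_countable f).comp (h.measurable_history n)).aestronglyMeasurable
    ((measurable_of_countable _).comp (hmε.prodMk hmU)).aestronglyMeasurable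
  refine this.trans ?_
  congr 1
  change ∫ ω, (if ε (n + 2) ω = e ∧ U (n + 2) ω = v then (1 : ℂ) else 0) ∂P = _
  have hs : (fun ω => if ε (n + 2) ω = e ∧ U (n + 2) ω = v then (1 : ℂ) else 0) =
      (ε (n + 2) ⁻¹' {e} ∩ U (n + 2) ⁻¹' {v}).indicator fun _ => 1 := by
    funext ω
    classical
    rw [Set.indicator_apply]
    exact if_congr Iff.rfl rfl rfl
  have hms : MeasurableSet (ε (n + 2) ⁻¹' {e} ∩ U (n + 2) ⁻¹' {v}) :=
    (hmε (measurableSet_singleton _)).inter (hmU (measurableSet_singleton _))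
  rw [hs, integral_indicator_const _ hms, measureReal_def,
    hi2.measure_inter_preimage_eq_mul _ _ (measurableSet_singleton _) (measurableSet_singleton _),
    ENNReal.toReal_mul]
  simp [measureReal_def]

/-- One step of the chain driven by `ε` and `U`. -/
theorem integral_history_succ (h : IsReinforcementInput P μ p X ε U) (hpq : p + q = 1) (n : ℕ)
    (g : (range n → ℕ) × (range n → ℕ) → ℕ → ℕ → ℂ) :
    ∫ ω, g (reinforcementHistory ε U n ω) (ε (n + 2) ω) (U (n + 2) ω) ∂P =
      ∑ v ∈ Icc 1 (n + 1), ((p / (n + 1) : ℝ) * ∫ ω, g (reinforcementHistory ε U n ω) 1 v ∂P +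
        (q / (n + 1) : ℝ) * ∫ ω, g (reinforcementHistory ε U n ω) 0 v ∂P) := by
  have hmε := h.measurable_ε (n + 2) (by omega)
  have hmU := h.measurable_U (n + 2) (by omega)
  have hI : ∀ e v, Integrable (fun ω => g (reinforcementHistory ε U n ω) e v *
      (if ε (n + 2) ω = e ∧ U (n + 2) ω = v then 1 else 0)) P := by
    intro e v
    refine (h.integrable_history hpq n fun t => g t e v).mul_bdd (c := 1)
      ((measurable_of_countable fun x : ℕ × ℕ =>
        if x.1 = e ∧ x.2 = v then (1 : ℂ) else 0).comp (hmε.prodMk hmU)).aestronglyMeasurable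
      (Filter.Eventually.of_forall fun ω => ?_)
    change ‖(if ε (n + 2) ω = e ∧ U (n + 2) ω = v then (1 : ℂ) else 0)‖ ≤ 1
    split_ifs <;> simp
  have hae : (fun ω => g (reinforcementHistory ε U n ω) (ε (n + 2) ω) (U (n + 2) ω)) =ᵐ[P]
      fun ω => ∑ v ∈ Icc 1 (n + 1), (g (reinforcementHistory ε U n ω) 1 v *
        (if ε (n + 2) ω = 1 ∧ U (n + 2) ω = v then 1 else 0) +
        g (reinforcementHistory ε U n ω) 0 v *
        (if ε (n + 2) ω = 0 ∧ U (n + 2) ω = v then 1 else 0)) := by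
    filter_upwards [h.ae_ε hpq n, h.ae_U n] with ω h1 h2
    rw [sum_eq_single_of_mem _ h2]
    · rcases h1 with h1 | h1 <;> simp [h1]
    · intro v _ hv
      simp [hv.symm]
  rw [integral_congr_ae hae, integral_finsetSum _ fun v _ => by
    exact (hI 1 v).add (hI 0 v)]
  refine sum_congr rfl fun v hv => ?_
  rw [integral_add (hI 1 v) (hI 0 v), h.integral_history_indicator n 1 v fun t => g t 1 v,
    h.integral_history_indicator n 0 v fun t => g t 0 v, h.real_ε_one, h.real_ε_zero hpq,
    h.real_U hv]
  push_cast
  ring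

end IsReinforcementInput

end ForestLaw

-- Conditional independence of the trees given their sizes.

section ForestLaw

open scoped NNReal
open Finset Function

theorem sizeExp_sum {V ι : Type*} [AddCommMonoid V] [Module ℝ≥0 V] {p q : ℝ≥0} (hpq : p + q = 1)
    (n : ℕ) (t : Finset ι) (G : ι → (ℕ → ℕ) → V) :
    sizeExp p q n (fun s => ∑ i ∈ t, G i s) = ∑ i ∈ t, sizeExp p q n (G i) := by
  classical
  induction t using Finset.induction_on with
  | empty => simpa using sizeExp_const hpq n (0 : V)
  | insert i t hi ih =>
    simp only [sum_insert hi]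
    rw [sizeExp_add, ih]

theorem sizeExp_const_mul_complex (p q : ℝ≥0) (n : ℕ) (c : ℂ) (G : (ℕ → ℕ) → ℂ) :
    sizeExp p q n (fun s => c * G s) = c * sizeExp p q n G :=
  (sizeExp_map ((LinearMap.mulLeft ℂ c).restrictScalars ℝ≥0) p q n G).symm

/-- The average of `h` over the two ways in which a tree of size `s` can grow. -/
def urnStep (h : ℕ → ℕ → ℂ) (s b : ℕ) : ℂ := b * h (s + 1) b + (s - b : ℕ) * h (s + 1) (b + 1)

theorem urnExp_urnStep (h : ℕ → ℕ → ℂ) (s : ℕ) :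
    urnExp s (urnStep h s) = s * urnExp (s + 1) (h (s + 1)) := by
  have := smul_urnExp_succ s (h (s + 1))
  simp only [NNReal.smul_def, Complex.real_smul, NNReal.coe_natCast, Complex.ofReal_natCast]
    at this
  exact this.symm

/-- Of the σ_j possible parents in tree j, the β_j positive ones leave the positive count unchanged
and the others raise it; no other factor changes. A growth step is thereby turned into a change of
the j-th test function alone. -/
theorem prod_update_urnStep (h : ℕ → ℕ → ℕ → ℂ) (σ β : ℕ → ℕ) {t : Finset ℕ} {j : ℕ} (hj : j ∈ t) :
    ∏ k ∈ t, update h j (urnStep (h j)) k (σ k) (β k) =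
      β j • (∏ k ∈ t, h k (update σ j (σ j + 1) k) (β k)) +
      (σ j - β j) • ∏ k ∈ t, h k (update σ j (σ j + 1) k) (update β j (β j + 1) k) := by
  have e1 : ∏ k ∈ t.erase j, update h j (urnStep (h j)) k (σ k) (β k) =
      ∏ k ∈ t.erase j, h k (σ k) (β k) :=
    prod_congr rfl fun k hk => by rw [update_of_ne (ne_of_mem_erase hk)]
  have e2 : ∏ k ∈ t.erase j, h k (update σ j (σ j + 1) k) (β k) =
      ∏ k ∈ t.erase j, h k (σ k) (β k) :=
    prod_congr rfl fun k hk => by rw [update_of_ne (ne_of_mem_erase hk)]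
  have e3 : ∏ k ∈ t.erase j, h k (update σ j (σ j + 1) k) (update β j (β j + 1) k) =
      ∏ k ∈ t.erase j, h k (σ k) (β k) :=
    prod_congr rfl fun k hk => by
      rw [update_of_ne (ne_of_mem_erase hk), update_of_ne (ne_of_mem_erase hk)]
  rw [← mul_prod_erase t _ hj, ← mul_prod_erase t (fun k => h k (update σ j (σ j + 1) k) (β k)) hj,
    ← mul_prod_erase t (fun k => h k (update σ j (σ j + 1) k) (update β j (β j + 1) k)) hj,
    e1, e2, e3, update_self, update_self, update_self, urnStep, nsmul_eq_mul, nsmul_eq_mul]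
  ring

theorem prod_urnExp_update_urnStep (h : ℕ → ℕ → ℕ → ℂ) (s : ℕ → ℕ) {t : Finset ℕ} {j : ℕ}
    (hj : j ∈ t) :
    ∏ k ∈ t, urnExp (s k) (update h j (urnStep (h j)) k (s k)) =
      s j * ∏ k ∈ t, urnExp (update s j (s j + 1) k) (h k (update s j (s j + 1) k)) := by
  have e1 : ∏ k ∈ t.erase j, urnExp (s k) (update h j (urnStep (h j)) k (s k)) =
      ∏ k ∈ t.erase j, urnExp (s k) (h k (s k)) :=
    prod_congr rfl fun k hk => by rw [update_of_ne (ne_of_mem_erase hk)]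
  have e2 : ∏ k ∈ t.erase j, urnExp (update s j (s j + 1) k) (h k (update s j (s j + 1) k)) =
      ∏ k ∈ t.erase j, urnExp (s k) (h k (s k)) :=
    prod_congr rfl fun k hk => by rw [update_of_ne (ne_of_mem_erase hk)]
  rw [← mul_prod_erase t _ hj, ← mul_prod_erase t (fun k => urnExp (update s j (s j + 1) k)
    (h k (update s j (s j + 1) k))) hj, e1, e2, update_self, update_self, urnExp_urnStep]
  ring

variable {Ω : Type*} [MeasurableSpace Ω] {P : Measure Ω} [IsProbabilityMeasure P]
  {μ : Measure ℝ} {p q : ℝ≥0} {X : ℕ → Ω → ℝ} {ε U : ℕ → Ω → ℕ}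

/-- The tree sizes as a function of the history. -/
def historySize {n : ℕ} (t : (range n → ℕ) × (range n → ℕ)) : ℕ → ℕ :=
  treeSize (padSeq t.1) (padSeq t.2) (n + 1)

/-- The numbers of vertices of positive sign as a function of the history. -/
def historyPlus {n : ℕ} (t : (range n → ℕ) × (range n → ℕ)) : ℕ → ℕ :=
  treePlus (padSeq t.1) (padSeq t.2) (n + 1)

theorem prod_Icc_succ_succ {M : Type*} [CommMonoid M] (f : ℕ → M) (n : ℕ) :
    ∏ k ∈ Icc 1 (n + 1 + 1), f k = f (n + 2) * ∏ k ∈ Icc 1 (n + 1), f k := by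
  rw [Icc_succ_eq_insert, prod_insert (succ_succ_notMem_Icc n)]

theorem treeSize_update_one {e u : ℕ → ℕ} {n : ℕ} (h : IsAdmissible e u (n + 1)) (v : ℕ) :
    treeSize (update e (n + 2) 1) (update u (n + 2) v) (n + 2) =
      update (treeSize e u (n + 1)) (n + 2) 1 ∧
    treePlus (update e (n + 2) 1) (update u (n + 2) v) (n + 2) =
      update (treePlus e u (n + 1)) (n + 2) 1 := by
  have he : ∀ j, j ≤ n + 1 → update e (n + 2) 1 j = e j := fun j hj =>
    update_of_ne (by omega) _ _
  have hu : ∀ j, j ≤ n + 1 → update u (n + 2) v j = u j := fun j hj =>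
    update_of_ne (by omega) _ _
  have ha : IsAdmissible (update e (n + 2) 1) (update u (n + 2) v) (n + 1) := by
    refine ⟨by rw [he 1 (by omega), h.1], fun j h2 hj => ?_⟩
    rw [he j hj, hu j hj]
    exact h.2 j h2 hj
  rw [ha.treeSize_succ_of_one (update_self _ _ _), ha.treePlus_succ_of_one (update_self _ _ _),
    treeSize_congr (fun j _ hj => he j hj) fun j _ hj => hu j hj,
    treePlus_congr (fun j _ hj => he j hj) fun j _ hj => hu j hj]
  exact ⟨rfl, rfl⟩

theorem treeSize_update_zero (e u : ℕ → ℕ) {n v : ℕ} (hv : v ≤ n + 1) :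
    treeSize (update e (n + 2) 0) (update u (n + 2) v) (n + 2) =
      update (treeSize e u (n + 1)) (treeRoot e u v) (treeSize e u (n + 1) (treeRoot e u v) + 1) ∧
    treePlus (update e (n + 2) 0) (update u (n + 2) v) (n + 2) =
      if treeSign e u v = true then treePlus e u (n + 1)
      else update (treePlus e u (n + 1)) (treeRoot e u v)
        (treePlus e u (n + 1) (treeRoot e u v) + 1) := by
  have he : ∀ j, 2 ≤ j → j ≤ n + 1 → update e (n + 2) 0 j = e j := fun j _ hj =>
    update_of_ne (by omega) _ _
  have hu : ∀ j, 2 ≤ j → j ≤ n + 1 → update u (n + 2) v j = u j := fun j _ hj =>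
    update_of_ne (by omega) _ _
  have hv' : update u (n + 2) v (n + 2) < n + 2 := by
    rw [update_self]
    omega
  rw [treeSize_succ_of_zero (update_self _ _ _) hv', treePlus_succ_of_zero (update_self _ _ _) hv',
    update_self, treeSize_congr he hu, treePlus_congr he hu, treeRoot_congr he hu hv,
    treeSign_congr he hu hv]
  exact ⟨rfl, rfl⟩

/-- Given the tree sizes, the numbers of vertices of positive sign in the trees are independent
and distributed as in a random recursive tree. -/
theorem IsReinforcementInput.integral_prod_forest (hX : IsReinforcementInput P μ p X ε U)
    (hpq : p + q = 1) (n : ℕ) (h : ℕ → ℕ → ℕ → ℂ) :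
    ∫ ω, ∏ k ∈ Icc 1 (n + 1), h k (historySize (reinforcementHistory ε U n ω) k)
      (historyPlus (reinforcementHistory ε U n ω) k) ∂P =
    sizeExp p q n fun s => ∏ k ∈ Icc 1 (n + 1), urnExp (s k) (h k (s k)) := by
  induction n generalizing h with
  | zero => simp [historySize, historyPlus, treeSize_one, treePlus_one, sizeExp, urnExp_one]
  | succ n ih =>
    set T := reinforcementHistory ε U n with hT
    set g : (range n → ℕ) × (range n → ℕ) → ℕ → ℕ → ℂ := fun t e v =>
      ∏ k ∈ Icc 1 (n + 1 + 1), h k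
        (treeSize (update (padSeq t.1) (n + 2) e) (update (padSeq t.2) (n + 2) v) (n + 2) k)
        (treePlus (update (padSeq t.1) (n + 2) e) (update (padSeq t.2) (n + 2) v) (n + 2) k) with hg
    have hg1 : ∀ ω, ∏ k ∈ Icc 1 (n + 1 + 1),
        h k (historySize (reinforcementHistory ε U (n + 1) ω) k)
          (historyPlus (reinforcementHistory ε U (n + 1) ω) k) =
        g (T ω) (ε (n + 2) ω) (U (n + 2) ω) := by
      intro ω
      have e1 := padSeq_restrict_succ (fun k => ε k ω) n
      have e2 := padSeq_restrict_succ (fun k => U k ω) n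
      simp only [hg, historySize, historyPlus, hT, reinforcementHistory]
      rw [e1, e2]
    have hadm := hX.ae_isAdmissible hpq n
    -- An innovation adds an independent one-vertex tree, whatever the unused value v.
    have hone : ∀ v, ∫ ω, g (T ω) 1 v ∂P = h (n + 2) 1 1 * sizeExp p q n fun s =>
        ∏ k ∈ Icc 1 (n + 1), urnExp (s k) (h k (s k)) := by
      intro v
      rw [← ih h, ← integral_const_mul]
      refine integral_congr_ae ?_
      filter_upwards [hadm] with ω hω
      obtain ⟨h1, h2⟩ := treeSize_update_one hω v
      simp only [hg]
      rw [prod_Icc_succ_succ, h1, h2, update_self, update_self]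
      congr 1
      refine prod_congr rfl fun k hk => ?_
      have hk : k ≠ n + 2 := by
        have := mem_Icc.1 hk
        omega
      rw [update_of_ne hk, update_of_ne hk]
      rfl
    -- The parents v are grouped by root and sign, and the induction hypothesis is applied to the
    -- modified test functions, which is why `h` is generalised. The factor `h (n + 2) 0 0` belongs
    -- to the index n + 2, which carries no tree.
    have hzero : ∑ v ∈ Icc 1 (n + 1), ∫ ω, g (T ω) 0 v ∂P = h (n + 2) 0 0 *
        ∑ j ∈ Icc 1 (n + 1), sizeExp p q n fun s =>
          ∏ k ∈ Icc 1 (n + 1), urnExp (s k) (update h j (urnStep (h j)) k (s k)) := by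
      have hint := fun f => hX.integrable_history hpq n f
      rw [← integral_finsetSum _ fun v _ => hint fun t => g t 0 v]
      simp only [← ih]
      rw [← integral_finsetSum _ fun j _ => hint fun t => ∏ k ∈ Icc 1 (n + 1),
        update h j (urnStep (h j)) k (historySize t k) (historyPlus t k), ← integral_const_mul]
      refine integral_congr_ae ?_
      filter_upwards [hadm] with ω hω
      set σ := historySize (T ω) with hσ
      set β := historyPlus (T ω) with hβ
      have hσ0 : σ (n + 2) = 0 := hω.treeSize_eq_zero (by simp)
      have hβ0 : β (n + 2) = 0 :=
        Nat.le_zero.1 ((treePlus_le_treeSize _ _ _ _).trans_eq hσ0)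
      let G : ℕ → Bool → ℂ := fun r b => ∏ k ∈ Icc 1 (n + 1), h k (update σ r (σ r + 1) k)
        ((if b = true then β else update β r (β r + 1)) k)
      have hG : ∀ v ∈ Icc 1 (n + 1), g (T ω) 0 v = h (n + 2) 0 0 *
          G (treeRoot (padSeq (T ω).1) (padSeq (T ω).2) v)
            (treeSign (padSeq (T ω).1) (padSeq (T ω).2) v) := by
        intro v hv
        obtain ⟨h1, h2⟩ := treeSize_update_zero (padSeq (T ω).1) (padSeq (T ω).2) (mem_Icc.1 hv).2
        have hr : n + 2 ≠ treeRoot (padSeq (T ω).1) (padSeq (T ω).2) v := by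
          have : treeRoot (padSeq (T ω).1) (padSeq (T ω).2) v ≤ n + 1 :=
            (mem_Icc.1 (hω.treeRoot_mem_Icc hv)).2
          omega
        simp only [hg]
        rw [prod_Icc_succ_succ, h1, h2]
        change h (n + 2) (update σ _ _ (n + 2)) ((if _ then β else update β _ _) (n + 2)) * _ = _
        have e : (if treeSign (padSeq (T ω).1) (padSeq (T ω).2) v = true then β
            else update β (treeRoot (padSeq (T ω).1) (padSeq (T ω).2) v)
              (β (treeRoot (padSeq (T ω).1) (padSeq (T ω).2) v) + 1)) (n + 2) = 0 := by
          split_ifs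
          · exact hβ0
          · rw [update_of_ne hr, hβ0]
        rw [update_of_ne hr, hσ0]
        refine congrArg₂ (· * ·) (congrArg _ e) rfl
      rw [sum_congr rfl hG, ← mul_sum, hω.sum_root_sign G]
      congr 1
      refine sum_congr rfl fun j hj => ?_
      rw [prod_update_urnStep h σ β hj]
      simp [G]
      rfl
    rw [integral_congr_ae (Filter.Eventually.of_forall hg1), hX.integral_history_succ hpq n g,
      sum_add_distrib, ← mul_sum, ← mul_sum, hzero, sum_congr rfl fun v _ => hone v,
      sum_const, Nat.card_Icc, sizeExp]
    have hRHS : ∀ s, IsSizeVector n s →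
        (p • ∏ k ∈ Icc 1 (n + 1 + 1), urnExp (update s (n + 2) 1 k) (h k (update s (n + 2) 1 k)) +
          ∑ j ∈ Icc 1 (n + 1), (q * s j / (n + 1)) • ∏ k ∈ Icc 1 (n + 1 + 1),
            urnExp (update s j (s j + 1) k) (h k (update s j (s j + 1) k))) =
        (((p : ℝ) : ℂ) * h (n + 2) 1 1) * ∏ k ∈ Icc 1 (n + 1), urnExp (s k) (h k (s k)) +
          ∑ j ∈ Icc 1 (n + 1), (((q / (n + 1) : ℝ) : ℂ) * h (n + 2) 0 0) *
            ∏ k ∈ Icc 1 (n + 1), urnExp (s k) (update h j (urnStep (h j)) k (s k)) := by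
      intro s hs
      congr 1
      · rw [prod_Icc_succ_succ, update_self, urnExp_one, NNReal.smul_def, Complex.real_smul,
          mul_assoc]
        congr 2
        refine prod_congr rfl fun k hk => ?_
        rw [update_of_ne]
        have := mem_Icc.1 hk
        omega
      · refine sum_congr rfl fun j hj => ?_
        have hne : n + 2 ≠ j := by
          have := mem_Icc.1 hj
          omega
        rw [prod_Icc_succ_succ, update_of_ne hne, hs.1 _ (succ_succ_notMem_Icc n), urnExp_zero,
          prod_urnExp_update_urnStep h s hj, NNReal.smul_def, Complex.real_smul]
        push_cast
        ring
    rw [sizeExp_congr p q hRHS, sizeExp_add, sizeExp_const_mul_complex, sizeExp_sum hpq]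
    simp only [sizeExp_const_mul_complex]
    rw [← mul_sum]
    have hn : ((n : ℂ) + 1) ≠ 0 := by exact_mod_cast n.succ_ne_zero
    simp only [nsmul_eq_mul]
    push_cast
    field_simp

end ForestLaw

/-! ### The law of the walk as a mixture -/

section WalkLaw

open scoped NNReal
open Finset Function

theorem integral_sizeExp_measure {α E : Type*} [MeasurableSpace α] [NormedAddCommGroup E]
    [NormedSpace ℝ E] (p q : ℝ≥0) (n : ℕ) {ρ : (ℕ → ℕ) → Measure α} {f : α → E}
    (hf : ∀ s, Integrable f (ρ s)) :
    ∫ x, f x ∂(sizeExp p q n ρ) = sizeExp p q n fun s => ∫ x, f x ∂(ρ s) := by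
  induction n generalizing ρ with
  | zero => rfl
  | succ n ih =>
    have hs : ∀ (c : ℝ≥0) s, Integrable f (c • ρ s) := fun c s => (hf s).smul_measure_nnreal
    have hsum : ∀ s, Integrable f (∑ j ∈ Icc 1 (n + 1),
        (q * s j / (n + 1)) • ρ (update s j (s j + 1))) := fun s =>
      integrable_finsetSum_measure.2 fun j _ => hs _ _
    rw [sizeExp, sizeExp, ih fun s => (hs _ _).add_measure (hsum s)]
    refine sizeExp_congr p q fun s _ => ?_
    rw [integral_add_measure (hs _ _) (hsum s), integral_finsetSum_measure fun j _ => hs _ _]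
    simp only [integral_smul_nnreal_measure]

/-- Total mass is linear in the measure, so it commutes with the averaging. -/
theorem isProbabilityMeasure_sizeExp {α : Type*} [MeasurableSpace α] {p q : ℝ≥0}
    (hpq : p + q = 1) (n : ℕ) {ρ : (ℕ → ℕ) → Measure α} (h : ∀ s, IsProbabilityMeasure (ρ s)) :
    IsProbabilityMeasure (sizeExp p q n ρ) := by
  let L : Measure α →ₗ[ℝ≥0] ENNReal :=
    { toFun := fun m => m Set.univ
      map_add' := fun _ _ => rfl
      map_smul' := fun _ _ => rfl }
  refine ⟨(sizeExp_map L p q n ρ).trans ?_⟩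
  have : (fun s => L (ρ s)) = fun _ => 1 := funext fun s => (h s).measure_univ
  rw [this, sizeExp_const hpq]

theorem measureReal_sizeExp {α : Type*} [MeasurableSpace α] (p q : ℝ≥0)
    (n : ℕ) {ρ : (ℕ → ℕ) → Measure α} (h : ∀ s, IsProbabilityMeasure (ρ s)) {A : Set α}
    (hA : MeasurableSet A) :
    (sizeExp p q n ρ).real A = sizeExp p q n fun s => (ρ s).real A := by
  have hf : ∀ s, Integrable (A.indicator (1 : α → ℝ)) (ρ s) := fun s =>
    (integrable_indicator_iff hA).2 (integrable_const _).integrableOn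
  have := integral_sizeExp_measure p q n hf
  simpa only [integral_indicator_one hA] using this

theorem integrable_exp_mul_I (ρ : Measure ℝ) [IsFiniteMeasure ρ] (θ : ℝ) :
    Integrable (fun x : ℝ => Complex.exp (θ * x * Complex.I)) ρ := by
  refine Integrable.of_bound (by fun_prop) 1 (Filter.Eventually.of_forall fun x => ?_)
  rw [← Complex.ofReal_mul, Complex.norm_exp_ofReal_mul_I]

theorem charFun_sizeExp (p q : ℝ≥0) (n : ℕ) {ρ : (ℕ → ℕ) → Measure ℝ}
    (h : ∀ s, IsProbabilityMeasure (ρ s)) (θ : ℝ) :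
    charFun (sizeExp p q n ρ) θ = sizeExp p q n fun s => charFun (ρ s) θ := by
  simp only [charFun_apply_real]
  exact integral_sizeExp_measure p q n fun s => integrable_exp_mul_I _ θ

/-- The law of the contribution of one tree of size `s` to the walk. -/
noncomputable def treeLaw (μ : Measure ℝ) (s : ℕ) : Measure ℝ :=
  urnExp s fun b => μ.map fun x => (2 * (b : ℝ) - s) * x

variable (μ : Measure ℝ)

instance isProbabilityMeasure_treeLaw [IsProbabilityMeasure μ] (s : ℕ) : IsProbabilityMeasure (treeLaw μ s) := by
  have hb : ∀ b : ℕ, IsProbabilityMeasure (μ.map fun x => (2 * (b : ℝ) - s) * x) := fun b =>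
    Measure.isProbabilityMeasure_map (by fun_prop)
  refine ⟨?_⟩
  rw [treeLaw, urnExp, Measure.finsetSum_apply]
  simp only [Measure.smul_apply, measure_univ]
  rw [← sum_smul, sum_urnWeight, one_smul]

theorem integrable_treeLaw {E : Type*} [NormedAddCommGroup E] {s : ℕ} {f : ℝ → E}
    (hf : ∀ b : ℕ, Integrable f (μ.map fun x => (2 * (b : ℝ) - s) * x)) :
    Integrable f (treeLaw μ s) :=
  integrable_finsetSum_measure.2 fun b _ => (hf b).smul_measure_nnreal

theorem integral_treeLaw {E : Type*} [NormedAddCommGroup E] [NormedSpace ℝ E] {s : ℕ} {f : ℝ → E}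
    (hf : ∀ b : ℕ, Integrable f (μ.map fun x => (2 * (b : ℝ) - s) * x)) :
    ∫ x, f x ∂(treeLaw μ s) = urnExp s fun b => ∫ x, f ((2 * (b : ℝ) - s) * x) ∂μ := by
  rw [treeLaw, urnExp, integral_finsetSum_measure fun b _ => (hf b).smul_measure_nnreal]
  refine sum_congr rfl fun b _ => ?_
  rw [integral_smul_nnreal_measure, integral_map (by fun_prop) (hf b).aestronglyMeasurable]

variable [IsProbabilityMeasure μ]

theorem charFun_treeLaw (s : ℕ) (θ : ℝ) :
    charFun (treeLaw μ s) θ = urnExp s fun b => charFun μ ((2 * (b : ℝ) - s) * θ) := by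
  have hb : ∀ b : ℕ, IsProbabilityMeasure (μ.map fun x => (2 * (b : ℝ) - s) * x) := fun b =>
    Measure.isProbabilityMeasure_map (by fun_prop)
  rw [charFun_apply_real, integral_treeLaw μ fun b => integrable_exp_mul_I _ θ]
  refine urnExp_congr fun b _ => ?_
  rw [charFun_apply_real]
  refine integral_congr_ae (Filter.Eventually.of_forall fun x => ?_)
  simp only
  congr 1
  push_cast
  ring

/-- The law of the walk at time `n + 1` given the tree sizes. -/
noncomputable def forestLaw (n : ℕ) (s : ℕ → ℕ) : Measure ℝ :=
  -- An index with s k = 0 carries the point mass at zero, so the product may run over all indices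
  -- and not only over roots.
  (Measure.pi fun k : Icc 1 (n + 1) => treeLaw μ (s k)).map fun x => ∑ k, x k

instance isProbabilityMeasure_forestLaw (n : ℕ) (s : ℕ → ℕ) :
    IsProbabilityMeasure (forestLaw μ n s) :=
  Measure.isProbabilityMeasure_map (by fun_prop)

theorem charFun_forestLaw (n : ℕ) (s : ℕ → ℕ) (θ : ℝ) :
    charFun (forestLaw μ n s) θ =
      ∏ k ∈ Icc 1 (n + 1), urnExp (s k) fun b => charFun μ ((2 * (b : ℝ) - s k) * θ) := by
  rw [forestLaw, charFun_map_sum_pi_eq_prod, Finset.prod_apply]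
  simp only [charFun_treeLaw]
  exact prod_coe_sort (Icc 1 (n + 1))
    fun k => urnExp (s k) fun b => charFun μ ((2 * (b : ℝ) - s k) * θ)

/-- The walk as a function of the innovations and the history. -/
noncomputable def historyWalk {n : ℕ} (x : ℕ → ℝ) (t : (range n → ℕ) × (range n → ℕ)) : ℝ :=
  -- Here `x k` stands for X_{k+1}, hence the shift by one. At roots the counter is at least 1;
  -- elsewhere the coefficient vanishes on admissible histories.
  ∑ k ∈ Icc 1 (n + 1), (2 * (historyPlus t k : ℝ) - historySize t k) *
    x (innovationCount (padSeq t.1) k - 1)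

theorem measurable_historyWalk_left {n : ℕ} (t : (range n → ℕ) × (range n → ℕ)) :
    Measurable fun x : ℕ → ℝ => historyWalk x t := by
  simp only [historyWalk]
  fun_prop

theorem measurable_historyWalk (n : ℕ) : Measurable fun z : (ℕ → ℝ) ×
    ((range n → ℕ) × (range n → ℕ)) => historyWalk z.1 z.2 :=
  measurable_from_prod_countable_left fun t => measurable_historyWalk_left t

theorem measurable_exp_mul_I (θ : ℝ) :
    Measurable fun x : ℝ => Complex.exp (θ * x * Complex.I) := by
  fun_prop

end WalkLaw

-- Identification of the law of the walk by characteristic functions.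

section WalkLaw

open scoped NNReal
open Finset Function

variable {μ : Measure ℝ} {Ω : Type*} [MeasurableSpace Ω] {P : Measure Ω}
  {p q : ℝ≥0} {X : ℕ → Ω → ℝ} {ε U : ℕ → Ω → ℕ}

namespace IsReinforcementInput

theorem measurable_innovations (hX : IsReinforcementInput P μ p X ε U) :
    Measurable fun ω k => X (k + 1) ω :=
  measurable_pi_lambda _ fun k => hX.measurable_X _ (by omega)

theorem indepFun_innovations_history (hX : IsReinforcementInput P μ p X ε U) (n : ℕ) :
    IndepFun (fun ω k => X (k + 1) ω) (reinforcementHistory ε U n) P := by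
  have mr : Measurable fun (f : (ℕ → ℕ) × (ℕ → ℕ)) =>
      ((fun i : range n => f.1 i, fun i : range n => f.2 i) : (range n → ℕ) × (range n → ℕ)) := by
    fun_prop
  exact hX.indepFun_X_εU.comp measurable_id mr

/-- With `e` frozen, the indices of nonzero coefficient are innovation times. They use different
members of the i.i.d. sequence, so the characteristic function factors. -/
theorem charFun_sum_innovation [IsProbabilityMeasure μ] (hX : IsReinforcementInput P μ p X ε U) (e : ℕ → ℕ) (N : ℕ)
    (c : ℕ → ℝ) (hc : ∀ k, e k ≠ 1 → c k = 0) (θ : ℝ) :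
    charFun (P.map fun ω => ∑ k ∈ Icc 1 N, c k * X (innovationCount e k - 1 + 1) ω) θ =
      ∏ k ∈ Icc 1 N, charFun μ (c k * θ) := by
  set S := {k ∈ Icc 1 N | e k = 1} with hS
  have hsum : ∀ ω, ∑ k ∈ Icc 1 N, c k * X (innovationCount e k - 1 + 1) ω =
      ∑ k ∈ S, c k * X (innovationCount e k - 1 + 1) ω := fun ω =>
    (sum_filter_of_ne fun k _ hk => by
      by_contra h
      exact hk (by rw [hc k h, zero_mul])).symm
  have hprod : ∏ k ∈ Icc 1 N, charFun μ (c k * θ) = ∏ k ∈ S, charFun μ (c k * θ) :=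
    (prod_filter_of_ne fun k _ hk => by
      by_contra h
      exact hk (by rw [hc k h, zero_mul, charFun_zero]; simp)).symm
  have hm : ∀ k, Measurable (X (k + 1)) := fun k => hX.measurable_X _ (by omega)
  have hmem : ∀ k ∈ S, 1 ≤ k ∧ e k = 1 := fun k hk =>
    ⟨(mem_Icc.1 (mem_filter.1 hk).1).1, (mem_filter.1 hk).2⟩
  have hinj : Injective fun k : S => innovationCount e k - 1 := by
    intro j k hjk
    have hj := hmem j j.2
    have hk := hmem k k.2
    have h1 := one_le_innovationCount hj.1 hj.2
    have h2 := one_le_innovationCount hk.1 hk.2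
    refine Subtype.ext (innovationCount_injOn e hj hk ?_)
    simp only at hjk
    omega
  have hind := (hX.iIndepFun_X.precomp hinj).comp (fun (k : S) x => c k * x)
    fun k => measurable_const_mul _
  simp only [hsum]
  rw [iIndepFun.charFun_map_fun_finsetSum_eq_prod
    (fun k _ => ((hm _).const_mul _).aemeasurable) hind, Finset.prod_apply, hprod]
  refine prod_congr rfl fun k _ => ?_
  rw [charFun_map_mul_comp (hm _).aemeasurable, hX.map_X _ (by omega)]

theorem integral_exp_historyWalk [IsProbabilityMeasure μ] (hX : IsReinforcementInput P μ p X ε U)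
    {n : ℕ} {t : (range n → ℕ) × (range n → ℕ)}
    (ht : IsAdmissible (padSeq t.1) (padSeq t.2) (n + 1)) (θ : ℝ) :
    ∫ x, Complex.exp (θ * historyWalk x t * Complex.I) ∂(P.map fun ω k => X (k + 1) ω) =
      ∏ k ∈ Icc 1 (n + 1), charFun μ ((2 * (historyPlus t k : ℝ) - historySize t k) * θ) := by
  have mX := hX.measurable_innovations
  have mt := measurable_historyWalk_left t
  have mtX := mt.comp mX
  have mE := measurable_exp_mul_I θ
  have hc : ∀ k, padSeq t.1 k ≠ 1 → 2 * (historyPlus t k : ℝ) - historySize t k = 0 := by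
    intro k he
    have h0 : historySize t k = 0 := ht.treeSize_eq_zero_of_ne he
    have h1 : historyPlus t k = 0 := Nat.le_zero.1 ((treePlus_le_treeSize _ _ _ _).trans_eq h0)
    rw [h0, h1]
    simp
  have h := hX.charFun_sum_innovation (padSeq t.1) (n + 1) _ hc θ
  have he : (fun ω => ∑ k ∈ Icc 1 (n + 1), (2 * (historyPlus t k : ℝ) - historySize t k) *
      X (innovationCount (padSeq t.1) k - 1 + 1) ω) =
      (fun x => historyWalk x t) ∘ fun ω k => X (k + 1) ω := by
    funext ω
    simp only [comp_apply, historyWalk]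
  rw [he, charFun_apply_real, integral_map mtX.aemeasurable mE.aestronglyMeasurable] at h
  rw [← h]
  exact integral_map mX.aemeasurable (mE.comp mt).aestronglyMeasurable

variable [IsProbabilityMeasure P]

/-- Fubini for the joint law of innovations and history, which are independent: the innovations are
integrated out first. -/
theorem integral_exp_negWalk (hX : IsReinforcementInput P μ p X ε U) (n : ℕ) (θ : ℝ) :
    ∫ ω, Complex.exp (θ * historyWalk (fun k => X (k + 1) ω)
      (reinforcementHistory ε U n ω) * Complex.I) ∂P =
    ∫ ω, ∫ x, Complex.exp (θ * historyWalk x (reinforcementHistory ε U n ω) * Complex.I)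
      ∂(P.map fun ω k => X (k + 1) ω) ∂P := by
  have mX := hX.measurable_innovations
  have mT := hX.measurable_history n
  have mE := measurable_exp_mul_I θ
  have mF := mE.comp (measurable_historyWalk n)
  have hprob1 := Measure.isProbabilityMeasure_map mX.aemeasurable (μ := P)
  have hprob2 := Measure.isProbabilityMeasure_map mT.aemeasurable (μ := P)
  have hint : Integrable ((fun x : ℝ => Complex.exp (θ * x * Complex.I)) ∘
      fun z : (ℕ → ℝ) × ((range n → ℕ) × (range n → ℕ)) => historyWalk z.1 z.2)
      ((P.map fun ω k => X (k + 1) ω).prod (P.map (reinforcementHistory ε U n))) := by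
    refine Integrable.of_bound mF.aestronglyMeasurable 1 (Filter.Eventually.of_forall fun x => ?_)
    rw [comp_apply, ← Complex.ofReal_mul, Complex.norm_exp_ofReal_mul_I]
  have hmap := (indepFun_iff_map_prod_eq_prod_map_map mX.aemeasurable mT.aemeasurable).1
    (hX.indepFun_innovations_history n)
  have h1 := integral_map (mX.prodMk mT).aemeasurable (μ := P) mF.aestronglyMeasurable
  rw [hmap, integral_prod_symm _ hint,
    integral_map mT.aemeasurable (measurable_of_countable _).aestronglyMeasurable] at h1
  exact h1.symm

theorem negWalk_ae_eq (hX : IsReinforcementInput P μ p X ε U) (hpq : p + q = 1) (n : ℕ) :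
    negWalk X ε U (n + 1) =ᵐ[P]
      fun ω => historyWalk (fun k => X (k + 1) ω) (reinforcementHistory ε U n ω) := by
  filter_upwards [hX.ae_isAdmissible hpq n] with ω hω
  have hstep : ∀ v ∈ Icc 1 (n + 1),
      negStep (fun k => X k ω) (fun k => ε k ω) (fun k => U k ω) v =
      negStep (fun k => X k ω) (padSeq (reinforcementHistory ε U n ω).1)
        (padSeq (reinforcementHistory ε U n ω).2) v := by
    intro v hv
    refine negStep_congr (fun j h1 hj => ?_) (fun j h2 hj => ?_) (mem_Icc.1 hv).2
    · rcases h1.eq_or_lt with rfl | h2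
      · rw [padSeq_one, hX.ε_one]
      · exact (padSeq_restrict (fun k => ε k ω) h2 hj).symm
    · exact (padSeq_restrict (fun k => U k ω) h2 hj).symm
  rw [negWalk, sum_congr rfl hstep, hω.sum_negStep]
  refine sum_congr rfl fun k hk => ?_
  by_cases he : padSeq (reinforcementHistory ε U n ω).1 k = 1
  · have := one_le_innovationCount (mem_Icc.1 hk).1 he
    simp only
    rw [Nat.sub_add_cancel this]
    rfl
  · have h0 := hω.treeSize_eq_zero_of_ne he
    have h1 : treePlus _ _ _ k = 0 := Nat.le_zero.1 ((treePlus_le_treeSize _ _ _ _).trans_eq h0)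
    simp only [historySize, historyPlus]
    rw [h0, h1]
    simp

variable [IsProbabilityMeasure μ]

/-- Integrating out the innovations leaves a product over the trees of functions of size and
positive count, which is what `integral_prod_forest` evaluates. -/
theorem charFun_map_negWalk (hX : IsReinforcementInput P μ p X ε U) (hpq : p + q = 1) (n : ℕ)
    (θ : ℝ) :
    charFun (P.map (negWalk X ε U (n + 1))) θ = charFun (sizeExp p q n (forestLaw μ n)) θ := by
  have mW := (measurable_historyWalk n).comp
    (hX.measurable_innovations.prodMk (hX.measurable_history n))
  have mE := measurable_exp_mul_I θ
  have h2 : ∀ᵐ ω ∂P, ∫ x, Complex.exp (θ * historyWalk x (reinforcementHistory ε U n ω) *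
      Complex.I) ∂(P.map fun ω k => X (k + 1) ω) =
      ∏ k ∈ Icc 1 (n + 1), charFun μ ((2 * (historyPlus (reinforcementHistory ε U n ω) k : ℝ) -
        historySize (reinforcementHistory ε U n ω) k) * θ) := by
    filter_upwards [hX.ae_isAdmissible hpq n] with ω hω
    exact hX.integral_exp_historyWalk hω θ
  rw [Measure.map_congr (hX.negWalk_ae_eq hpq n), charFun_apply_real]
  refine (integral_map mW.aemeasurable mE.aestronglyMeasurable).trans ?_
  simp only [comp_apply]
  rw [hX.integral_exp_negWalk, integral_congr_ae h2, hX.integral_prod_forest hpq n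
    fun _ s b => charFun μ ((2 * (b : ℝ) - s) * θ),
    charFun_sizeExp p q n fun s => isProbabilityMeasure_forestLaw μ n s]
  simp only [charFun_forestLaw]

theorem real_negWalk_le (hX : IsReinforcementInput P μ p X ε U) (hpq : p + q = 1) (n : ℕ)
    (y : ℝ) : P.real {ω | negWalk X ε U (n + 1) ω ≤ y} =
      sizeExp p q n fun s => (forestLaw μ n s).real (Set.Iic y) := by
  have mW' := (measurable_historyWalk n).comp
    (hX.measurable_innovations.prodMk (hX.measurable_history n))
  have mW : AEMeasurable (negWalk X ε U (n + 1)) P := mW'.aemeasurable.congr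
    (hX.negWalk_ae_eq hpq n).symm
  have h1 := Measure.isProbabilityMeasure_map mW
  have h2 := isProbabilityMeasure_sizeExp hpq n fun s => isProbabilityMeasure_forestLaw μ n s
  have h3 := Measure.ext_of_charFun (funext (hX.charFun_map_negWalk hpq n))
  rw [← measureReal_sizeExp p q n (fun s => isProbabilityMeasure_forestLaw μ n s)
    measurableSet_Iic]
  rw [show sizeExp p q n (fun s => forestLaw μ n s) = _ from h3.symm, measureReal_def,
    measureReal_def, Measure.map_apply_of_aemeasurable mW measurableSet_Iic]
  rfl

end IsReinforcementInput

end WalkLaw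

/-! ### Normal approximation given the tree sizes -/

section Conditional

open Finset

/-- The coordinates are centred and divided by √W; the factor 4 comes from (a + b)³ ≤ 4(a³ + b³). -/
theorem berryEsseen_pi {ι : Type*} [Fintype ι] (ρ : ι → Measure ℝ)
    [∀ i, IsProbabilityMeasure (ρ i)] (h3 : ∀ i, MemLp (fun x : ℝ => x) 3 (ρ i)) {W K : ℝ}
    (hW : ∑ i, (∫ x, x ^ 2 ∂(ρ i) - (∫ x, x ∂(ρ i)) ^ 2) = W) (hW0 : 0 < W) (hK0 : 0 < K)
    (hK : ∑ i, 4 * (∫ x, |x| ^ 3 ∂(ρ i) + |∫ x, x ∂(ρ i)| ^ 3) ≤ K) (y : ℝ) :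
    |((Measure.pi ρ).map fun x => ∑ i, x i).real (Set.Iic y) -
      gaussCDF ((y - ∑ i, ∫ x, x ∂(ρ i)) / Real.sqrt W)| ≤ 26 * (K / (W * Real.sqrt W)) := by
  set c := Real.sqrt W with hc
  have hc0 : 0 < c := Real.sqrt_pos.2 hW0
  have hc2 : c ^ 2 = W := Real.sq_sqrt hW0.le
  set m : ι → ℝ := fun i => ∫ x, x ∂(ρ i) with hm
  set f : ι → ℝ → ℝ := fun i x => (x - m i) / c with hf
  have mf : ∀ i, Measurable (f i) := fun i => by fun_prop
  have h2 : ∀ i, MemLp (fun x : ℝ => x) 2 (ρ i) := fun i => (h3 i).mono_exponent (by norm_num)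
  have h1 : ∀ i, Integrable (fun x : ℝ => x) (ρ i) := fun i =>
    (h3 i).integrable (by norm_num)
  have i2 : ∀ i, Integrable (fun x : ℝ => x ^ 2) (ρ i) := fun i => (h2 i).integrable_sq
  have i3 : ∀ i, Integrable (fun x : ℝ => |x| ^ 3) (ρ i) := fun i =>
    integrable_abs_pow_three (h3 i)
  have f3 : ∀ i, MemLp (f i) 3 (ρ i) := fun i => by
    have := ((h3 i).sub (memLp_const (m i))).const_mul c⁻¹
    refine this.congr_norm (mf i).aestronglyMeasurable (Filter.Eventually.of_forall fun x => ?_)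
    simp only [hf, Pi.sub_apply, div_eq_inv_mul]
  have hev : ∀ i (g : ℝ → ℝ), Measurable g →
      ∫ x, g (x i) ∂(Measure.pi ρ) = ∫ x, g x ∂(ρ i) := fun i g hg =>
    integral_comp_eval (μ := ρ) hg.aestronglyMeasurable
  have e1 : ∀ i, ∫ x, f i x ∂(ρ i) = 0 := fun i => by
    simp only [hf]
    rw [integral_div, integral_sub (h1 i) (integrable_const _)]
    simp [hm]
  have e2 : ∀ i, ∫ x, f i x ^ 2 ∂(ρ i) = (∫ x, x ^ 2 ∂(ρ i) - m i ^ 2) / W := fun i => by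
    have : ∀ x, f i x ^ 2 = (x ^ 2 - 2 * m i * x + m i ^ 2) / W := fun x => by
      simp only [hf]
      rw [div_pow, hc2]
      ring
    simp only [this]
    have i12 : Integrable (fun x : ℝ => x ^ 2 - 2 * m i * x) (ρ i) :=
      (i2 i).sub ((h1 i).const_mul _)
    rw [integral_div, integral_add i12 (integrable_const _), integral_sub (i2 i) ((h1 i).const_mul _), integral_const_mul]
    simp only [integral_const, probReal_univ, one_smul]
    congr 1
    simp only [hm]
    ring
  have e3 : ∀ i, ∫ x, |f i x| ^ 3 ∂(ρ i) ≤
      4 * (∫ x, |x| ^ 3 ∂(ρ i) + |m i| ^ 3) / (W * c) := fun i => by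
    have hb : ∀ x, |f i x| ^ 3 ≤ 4 * (|x| ^ 3 + |m i| ^ 3) / (W * c) := fun x => by
      simp only [hf]
      rw [abs_div, div_pow, abs_of_pos hc0, show c ^ 3 = W * c by rw [← hc2]; ring]
      have h4 : |x - m i| ^ 3 ≤ (|x| + |m i|) ^ 3 := by
        gcongr
        exact abs_sub x (m i)
      have h5 : (|x| + |m i|) ^ 3 ≤ 4 * (|x| ^ 3 + |m i| ^ 3) := by
        have ha := abs_nonneg x
        have hb := abs_nonneg (m i)
        nlinarith [mul_nonneg (add_nonneg ha hb) (sq_nonneg (|x| - |m i|))]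
      gcongr
      exact h4.trans h5
    refine (integral_mono (integrable_abs_pow_three (f3 i))
      ((((i3 i).add (integrable_const (|m i| ^ 3))).const_mul 4).div_const (W * c)) hb).trans_eq ?_
    simp only [Pi.add_apply]
    rw [integral_div, integral_const_mul, integral_add (i3 i) (integrable_const _)]
    simp
  have key := berryEsseen_of_iIndepFun (P := Measure.pi ρ) (ξ := fun i x => f i (x i))
    (fun i => (mf i).comp (measurable_pi_apply i))
    (iIndepFun_pi fun i => (mf i).aemeasurable)
    (fun i => (f3 i).comp_measurePreserving (measurePreserving_eval ρ i))
    (fun i => by rw [hev i (f i) (mf i), e1]) ?_ (γ := K / (W * c)) (by positivity) ?_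
    ((y - ∑ i, m i) / c)
  · rw [map_measureReal_apply (by fun_prop) measurableSet_Iic]
    refine le_of_eq_of_le (congrArg (fun t => |t - _|) (congrArg _ ?_)) key
    ext x
    simp only [Set.mem_preimage, Set.mem_Iic, Set.mem_ofPred_eq, hf]
    rw [← sum_div, sum_sub_distrib, div_le_div_iff_of_pos_right hc0, sub_le_sub_iff_right]
  · rw [sum_congr rfl fun i _ => (hev i (fun x => f i x ^ 2) ((mf i).pow_const 2)).trans (e2 i),
      ← sum_div, hW, div_self hW0.ne']
  · rw [sum_congr rfl fun i _ => hev i (fun x => |f i x| ^ 3) ((mf i).abs.pow_const 3)]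
    refine (sum_le_sum fun i _ => e3 i).trans ?_
    rw [← sum_div]
    gcongr

variable {μ : Measure ℝ}

theorem memLp_three_of_integrable (hμ : Integrable (fun x : ℝ => |x| ^ 3) μ) :
    MemLp (fun x : ℝ => x) 3 μ := by
  refine (integrable_norm_rpow_iff (p := 3) (by fun_prop) (by norm_num) (by norm_num)).1 ?_
  refine hμ.congr (Filter.Eventually.of_forall fun x => ?_)
  simp only [Real.norm_eq_abs, ENNReal.toReal_ofNat]
  exact (Real.rpow_ofNat _ _).symm

theorem memLp_three_map_const_mul (h3 : MemLp (fun x : ℝ => x) 3 μ) (a : ℝ) :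
    MemLp (fun x : ℝ => x) 3 (μ.map fun x => a * x) :=
  (memLp_map_measure_iff (by fun_prop) (by fun_prop)).2 (h3.const_mul a)

theorem memLp_three_treeLaw (h3 : MemLp (fun x : ℝ => x) 3 μ) (s : ℕ) :
    MemLp (fun x : ℝ => x) 3 (treeLaw μ s) := by
  refine memLp_three_of_integrable (integrable_treeLaw μ fun b => ?_)
  exact integrable_abs_pow_three (memLp_three_map_const_mul h3 _)

theorem integral_abs_pow_three_treeLaw_le (h3 : MemLp (fun x : ℝ => x) 3 μ) (s : ℕ) :
    ∫ x, |x| ^ 3 ∂(treeLaw μ s) ≤ 2 * (∫ x, |x| ^ 3 ∂μ) * (s * Real.sqrt s) := by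
  have h0 : 0 ≤ ∫ x, |x| ^ 3 ∂μ := integral_nonneg fun x => by positivity
  rw [integral_treeLaw μ fun b => integrable_abs_pow_three (memLp_three_map_const_mul h3 _),
    urnExp_congr (G := fun b => (∫ x, |x| ^ 3 ∂μ) * |2 * (b : ℝ) - s| ^ 3) fun b _ => by
      simp only [abs_mul, mul_pow]
      rw [integral_const_mul]
      ring, urnExp_const_mul]
  calc _ ≤ (∫ x, |x| ^ 3 ∂μ) * (2 * (s * Real.sqrt s)) :=
        mul_le_mul_of_nonneg_left (urnExp_abs_pow_three_le s) h0
    _ = _ := by ring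

variable [IsProbabilityMeasure μ]

theorem integral_id_treeLaw (h3 : MemLp (fun x : ℝ => x) 3 μ) (s : ℕ) :
    ∫ x, x ∂(treeLaw μ s) = if s = 1 then stepMoment μ 1 else 0 := by
  have hb : ∀ b : ℕ, IsProbabilityMeasure (μ.map fun x => (2 * (b : ℝ) - s) * x) := fun b =>
    Measure.isProbabilityMeasure_map (by fun_prop)
  rw [integral_treeLaw μ fun b => (memLp_three_map_const_mul h3 _).integrable (by norm_num),
    urnExp_congr (G := fun b => stepMoment μ 1 * (2 * (b : ℝ) - s) ^ 1) fun b _ => by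
      rw [integral_const_mul, stepMoment]
      simp only [pow_one]
      ring, urnExp_const_mul]
  change stepMoment μ 1 * urnMoment 1 s = _
  rw [urnMoment_one_eq]
  split_ifs <;> simp

theorem integral_sq_treeLaw (h3 : MemLp (fun x : ℝ => x) 3 μ) (s : ℕ) :
    ∫ x, x ^ 2 ∂(treeLaw μ s) = stepMoment μ 2 * urnMoment 2 s := by
  have hb : ∀ b : ℕ, IsProbabilityMeasure (μ.map fun x => (2 * (b : ℝ) - s) * x) := fun b =>
    Measure.isProbabilityMeasure_map (by fun_prop)
  rw [integral_treeLaw μ fun b => ((memLp_three_map_const_mul h3 _).mono_exponent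
      (by norm_num)).integrable_sq,
    urnExp_congr (G := fun b => stepMoment μ 2 * (2 * (b : ℝ) - s) ^ 2) fun b _ => by
      simp only [mul_pow]
      rw [integral_const_mul, stepMoment]
      ring, urnExp_const_mul]
  rfl

/-- The variance of the walk at time `n + 1` given the tree sizes. -/
noncomputable def forestVariance (μ : Measure ℝ) (n : ℕ) (s : ℕ → ℕ) : ℝ :=
  stepMoment μ 2 * (n + 1 - treeCount 1 n s - 2 * treeCount 2 n s) / 3 +
    (stepMoment μ 2 - stepMoment μ 1 ^ 2) * treeCount 1 n s

theorem le_sizeThreeHalves {n : ℕ} {s : ℕ → ℕ} (hs : IsSizeVector n s) :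
    (n : ℝ) + 1 ≤ sizeThreeHalves n s := by
  rw [← hs.sum_cast, sizeThreeHalves]
  refine sum_le_sum fun k _ => ?_
  rcases Nat.eq_zero_or_pos (s k) with h | h
  · simp [h]
  · have h1 : (1 : ℝ) ≤ s k := by exact_mod_cast h
    have h2 : 1 ≤ Real.sqrt (s k) := Real.one_le_sqrt.2 h1
    nlinarith

/-- The constant in the conditional normal approximation. -/
noncomputable def forestConst (μ : Measure ℝ) : ℝ :=
  -- The factor 4 of `berryEsseen_pi` meets the factor 2 of the urn's third moment; the final 1
  -- keeps the constant positive.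
  8 * ∫ x, |x| ^ 3 ∂μ + 4 * |stepMoment μ 1| ^ 3 + 1

theorem forestConst_pos (μ : Measure ℝ) : 0 < forestConst μ := by
  have h0 : 0 ≤ ∫ x, |x| ^ 3 ∂μ := integral_nonneg fun x => by positivity
  unfold forestConst
  positivity

/-- Only trees of size one have a nonzero mean, and the exact second moments of the urn sum to
`forestVariance`. -/
theorem abs_forestLaw_sub_gaussCDF_le (h3 : MemLp (fun x : ℝ => x) 3 μ) {n : ℕ} {s : ℕ → ℕ}
    (hs : IsSizeVector n s) (hW : 0 < forestVariance μ n s) (y : ℝ) :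
    |(forestLaw μ n s).real (Set.Iic y) - gaussCDF ((y - stepMoment μ 1 * treeCount 1 n s) /
      Real.sqrt (forestVariance μ n s))| ≤
    26 * (forestConst μ * sizeThreeHalves n s /
      (forestVariance μ n s * Real.sqrt (forestVariance μ n s))) := by
  have hmean : ∑ k : Icc 1 (n + 1), ∫ x, x ∂(treeLaw μ (s k)) =
      stepMoment μ 1 * treeCount 1 n s := by
    rw [sum_coe_sort (Icc 1 (n + 1)) fun k => ∫ x, x ∂(treeLaw μ (s k)), treeCount, mul_sum]
    refine sum_congr rfl fun k _ => ?_
    rw [integral_id_treeLaw h3]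
    split_ifs <;> simp
  have hvar : ∑ k : Icc 1 (n + 1), (∫ x, x ^ 2 ∂(treeLaw μ (s k)) -
      (∫ x, x ∂(treeLaw μ (s k))) ^ 2) = forestVariance μ n s := by
    rw [sum_coe_sort (Icc 1 (n + 1)) fun k => ∫ x, x ^ 2 ∂(treeLaw μ (s k)) -
      (∫ x, x ∂(treeLaw μ (s k))) ^ 2, forestVariance, ← hs.sum_cast, treeCount, treeCount]
    simp only [mul_sum, sum_div, ← sum_sub_distrib, ← sum_add_distrib]
    refine sum_congr rfl fun k _ => ?_
    rw [integral_id_treeLaw h3, integral_sq_treeLaw h3, urnMoment_two_eq]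
    split_ifs <;> ring
  have hR := le_sizeThreeHalves hs
  have hn : (0 : ℝ) < n + 1 := by positivity
  have hthird : ∑ k : Icc 1 (n + 1), 4 * (∫ x, |x| ^ 3 ∂(treeLaw μ (s k)) +
      |∫ x, x ∂(treeLaw μ (s k))| ^ 3) ≤ forestConst μ * sizeThreeHalves n s := by
    rw [sum_coe_sort (Icc 1 (n + 1)) fun k => 4 * (∫ x, |x| ^ 3 ∂(treeLaw μ (s k)) +
      |∫ x, x ∂(treeLaw μ (s k))| ^ 3), sizeThreeHalves, mul_sum]
    refine sum_le_sum fun k _ => ?_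
    have h1 := integral_abs_pow_three_treeLaw_le h3 (s k)
    have h2 : |∫ x, x ∂(treeLaw μ (s k))| ^ 3 ≤
        |stepMoment μ 1| ^ 3 * ((s k : ℝ) * Real.sqrt (s k)) := by
      rw [integral_id_treeLaw h3]
      split_ifs with h
      · simp [h]
      · rw [abs_zero, zero_pow (by norm_num)]
        positivity
    have h4 : 0 ≤ (s k : ℝ) * Real.sqrt (s k) := by positivity
    unfold forestConst
    nlinarith
  have := berryEsseen_pi (fun k : Icc 1 (n + 1) => treeLaw μ (s k))
    (fun k => memLp_three_treeLaw h3 _) hvar hW (mul_pos (forestConst_pos μ) (hn.trans_le hR))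
    hthird y
  rw [hmean] at this
  exact this

end Conditional

/-! ### The Berry-Esseen bound -/

section Assembly

open scoped NNReal
open Finset

variable {μ : Measure ℝ} [IsProbabilityMeasure μ]

/-- The error is quadratic in the deviation of the conditional variance, so that only a second
moment bound is needed afterwards and no size vector has to be excluded. -/
theorem abs_forestLaw_sub_gaussCDF_const_le (h3 : MemLp (fun x : ℝ => x) 3 μ) {n : ℕ} {s : ℕ → ℕ}
    (hs : IsSizeVector n s) {w : ℝ} (hw : 0 < w) (y : ℝ) :
    |(forestLaw μ n s).real (Set.Iic y) - gaussCDF ((y - stepMoment μ 1 * treeCount 1 n s) /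
      Real.sqrt (w * (n + 1)))| ≤
    208 * forestConst μ / (w * Real.sqrt w * ((n + 1) * Real.sqrt (n + 1))) * sizeThreeHalves n s +
      (1 / (w * Real.sqrt (n + 1)) + (1 / (w * ((n + 1) * Real.sqrt (n + 1))) +
        16 / (w ^ 2 * (n + 1) ^ 2)) * (forestVariance μ n s - w * (n + 1)) ^ 2) := by
  set N : ℝ := (n : ℝ) + 1 with hN
  have hN0 : 0 < N := by positivity
  set W := forestVariance μ n s with hW
  set R := sizeThreeHalves n s with hR
  have hR0 : 0 ≤ R := sizeThreeHalves_nonneg n s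
  have hF := forestConst_pos μ
  set F := forestConst μ
  set r := Real.sqrt N with hr
  have hr0 : 0 < r := Real.sqrt_pos.2 hN0
  have hr2 : r ^ 2 = N := Real.sq_sqrt hN0.le
  set v := Real.sqrt w with hv
  have hv0 : 0 < v := Real.sqrt_pos.2 hw
  set z := W - w * N with hz
  set c := w * N / 4 with hc
  have hc0 : 0 < c := by positivity
  have hsc : Real.sqrt c = v * r / 2 := by
    rw [hc, Real.sqrt_div (by positivity), Real.sqrt_mul hw.le,
      show (4 : ℝ) = 2 ^ 2 by norm_num, Real.sqrt_sq (by norm_num)]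
  set Y := y - stepMoment μ 1 * treeCount 1 n s
  have hB0 : 0 ≤ 208 * F / (w * v * (N * r)) * R := by positivity
  have hB1 : 0 ≤ 1 / (w * r) := by positivity
  have hB2 : 0 ≤ 1 / (w * (N * r)) * z ^ 2 := by positivity
  have hB3 : 16 / (w ^ 2 * N ^ 2) * z ^ 2 = (z / c) ^ 2 := by
    rw [hc]
    field_simp
    ring
  -- If W is below a quarter of wN, the deviation exceeds c and (z/c)² ≥ 1 dominates the trivial
  -- bound. Otherwise W ≥ c, which costs a factor 8 in W^(3/2), and 208 = 26 · 8.
  rcases lt_or_ge W c with hlt | hge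
  · have hz1 : c ≤ |z| := by
      rw [le_abs]
      right
      rw [hz]
      linarith
    have h1 : 1 ≤ (z / c) ^ 2 := by
      rw [one_le_sq_iff_one_le_abs, abs_div, abs_of_pos hc0, one_le_div hc0]
      exact hz1
    have a1 := measureReal_nonneg (μ := forestLaw μ n s) (s := Set.Iic y)
    have a2 := measureReal_le_one (μ := forestLaw μ n s) (s := Set.Iic y)
    have a3 := gaussCDF_nonneg (Y / Real.sqrt (w * N))
    have a4 := gaussCDF_le_one (Y / Real.sqrt (w * N))
    have : |(forestLaw μ n s).real (Set.Iic y) - gaussCDF (Y / Real.sqrt (w * N))| ≤ 1 := by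
      rw [abs_le]
      constructor <;> linarith
    rw [add_mul (1 / (w * (N * r))), hB3]
    linarith
  · have hW0 : 0 < W := hc0.trans_le hge
    have h1 := abs_forestLaw_sub_gaussCDF_le h3 hs hW0 y
    have h2 := abs_gaussCDF_div_sqrt_sub_le Y hc0 (s := w * N) (t := W)
      (by rw [hc]; have := mul_pos hw hN0; linarith) hge
    have h4 : 26 * (F * R / (W * Real.sqrt W)) ≤ 208 * F / (w * v * (N * r)) * R := by
      have e : 208 * F / (w * v * (N * r)) * R = 26 * (F * R / (c * Real.sqrt c)) := by
        rw [hsc, hc]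
        field_simp
        ring
      rw [e]
      gcongr
    have h5 : 1 / (2 * c) * |z| ≤ 1 / (w * r) + 1 / (w * (N * r)) * z ^ 2 := by
      -- The weight r = √N balances the two terms, since z² has expectation of order N.
      have h6 : |z| ≤ (r + z ^ 2 / r) / 2 := by
        rw [← sq_abs z, ← sub_nonneg]
        have : (r + |z| ^ 2 / r) / 2 - |z| = (r - |z|) ^ 2 / (2 * r) := by
          field_simp
          ring
        rw [this]
        positivity
      calc 1 / (2 * c) * |z| ≤ 1 / (2 * c) * ((r + z ^ 2 / r) / 2) := by gcongr
        _ = 1 / (w * r) + 1 / (w * (N * r)) * z ^ 2 := by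
          rw [hc, ← hr2]
          field_simp
          ring
    have h6 := abs_sub_le ((forestLaw μ n s).real (Set.Iic y)) (gaussCDF (Y / Real.sqrt W))
      (gaussCDF (Y / Real.sqrt (w * N)))
    have h7 : 0 ≤ 16 / (w ^ 2 * N ^ 2) * z ^ 2 := by positivity
    rw [add_mul (1 / (w * (N * r)))]
    linarith

/-- The conditional variance is affine in N₁ and N₂, and w is its slope at N₁ = a₁N, N₂ = a₂N; the
deviation is a linear combination of the two centred counts. -/
theorem sizeExp_forestVariance_sq_le (μ : Measure ℝ) {p q : ℝ≥0} (hpq : p + q = 1) {a₁ a₂ w : ℝ}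
    (h₁ : a₁ * (1 + q) = p) (h₂ : a₂ * (1 + 2 * q) = q * a₁)
    (hw : w = stepMoment μ 2 * (1 - a₁ - 2 * a₂) / 3 +
      (stepMoment μ 2 - stepMoment μ 1 ^ 2) * a₁) (n : ℕ) :
    sizeExp p q n (fun s => (forestVariance μ n s - w * (n + 1)) ^ 2) ≤
      (2 * (2 / 3 * stepMoment μ 2 - stepMoment μ 1 ^ 2) ^ 2 +
        8 * (2 / 3 * stepMoment μ 2) ^ 2) * (n + 1) := by
  set A := 2 / 3 * stepMoment μ 2 - stepMoment μ 1 ^ 2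
  set B := 2 / 3 * stepMoment μ 2
  have h : sizeExp p q n (fun s => (forestVariance μ n s - w * (n + 1)) ^ 2) ≤
      sizeExp p q n (fun s => 2 * A ^ 2 * (treeCount 1 n s - a₁ * (n + 1)) ^ 2 +
        2 * B ^ 2 * (treeCount 2 n s - a₂ * (n + 1)) ^ 2) := by
    refine sizeExp_mono p q fun s _ => ?_
    have e : forestVariance μ n s - w * (n + 1) = A * (treeCount 1 n s - a₁ * (n + 1)) -
        B * (treeCount 2 n s - a₂ * (n + 1)) := by
      simp only [forestVariance, hw, A, B]
      ring
    rw [e]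
    nlinarith [sq_nonneg (A * (treeCount 1 n s - a₁ * (n + 1)) +
        B * (treeCount 2 n s - a₂ * (n + 1)))]
  rw [sizeExp_add, sizeExp_const_mul, sizeExp_const_mul] at h
  have hA := mul_le_mul_of_nonneg_left (sizeExp_treeCount_one_sq_le hpq h₁ n)
    (show 0 ≤ 2 * A ^ 2 by positivity)
  have hB := mul_le_mul_of_nonneg_left (sizeExp_treeCount_two_sq_le hpq h₁ h₂ n)
    (show 0 ≤ 2 * B ^ 2 by positivity)
  refine h.trans ((add_le_add hA hB).trans_eq ?_)
  ring

theorem abs_sizeExp_forestLaw_sub_le (h3 : MemLp (fun x : ℝ => x) 3 μ) {p q : ℝ≥0}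
    (hpq : p + q = 1) {w D : ℝ} (hw : 0 < w) (n : ℕ)
    (hD : sizeExp p q n (fun s => (forestVariance μ n s - w * (n + 1)) ^ 2) ≤ D * (n + 1))
    (y : ℝ) :
    |sizeExp p q n (fun s => (forestLaw μ n s).real (Set.Iic y)) -
      sizeExp p q n (fun s => gaussCDF ((y - stepMoment μ 1 * treeCount 1 n s) /
        Real.sqrt (w * (n + 1))))| ≤
    208 * forestConst μ / (w * Real.sqrt w) *
      (sizeExp p q n (sizeThreeHalves n) / ((n + 1) * Real.sqrt (n + 1))) +
      (1 / w + D / w + 16 * D / w ^ 2) * (1 / Real.sqrt (n + 1)) := by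
  rw [← sizeExp_sub]
  refine (abs_sizeExp_le p q fun s hs =>
    abs_forestLaw_sub_gaussCDF_const_le h3 hs hw y).trans ?_
  rw [sizeExp_add, sizeExp_const_mul, sizeExp_add, sizeExp_const hpq, sizeExp_const_mul]
  have hN1 : (1 : ℝ) ≤ n + 1 := by
    have : (0 : ℝ) ≤ n := n.cast_nonneg
    linarith
  set N : ℝ := (n : ℝ) + 1
  have hN0 : 0 < N := by positivity
  have hD0 : 0 ≤ D := by
    have h0 : 0 ≤ sizeExp p q n (fun s => (forestVariance μ n s - w * N) ^ 2) := by
      have := sizeExp_mono p q (n := n) (G := fun _ => (0 : ℝ))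
        (H := fun s => (forestVariance μ n s - w * N) ^ 2) fun s _ => sq_nonneg _
      rwa [sizeExp_const hpq] at this
    exact nonneg_of_mul_nonneg_left (h0.trans hD) hN0
  set r := Real.sqrt N
  have hr1 : 1 ≤ r := Real.one_le_sqrt.2 hN1
  have hr0 : 0 < r := by linarith
  have hr2 : r ^ 2 = N := Real.sq_sqrt hN0.le
  have h1 : (1 / (w * (N * r)) + 16 / (w ^ 2 * N ^ 2)) *
      sizeExp p q n (fun s => (forestVariance μ n s - w * N) ^ 2) ≤
      (1 / (w * (N * r)) + 16 / (w ^ 2 * N ^ 2)) * (D * N) := by gcongr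
  have h2 : 16 * D / (w ^ 2 * N) ≤ 16 * D / (w ^ 2 * r) := by
    have : r ≤ N := by nlinarith
    gcongr
  have e1 : (1 / (w * (N * r)) + 16 / (w ^ 2 * N ^ 2)) * (D * N) =
      D / (w * r) + 16 * D / (w ^ 2 * N) := by
    field_simp
  have e2 : (1 / w + D / w + 16 * D / w ^ 2) * (1 / r) =
      1 / (w * r) + (D / (w * r) + 16 * D / (w ^ 2 * r)) := by
    field_simp
    ring
  have e3 : 208 * forestConst μ / (w * Real.sqrt w * (N * r)) * sizeExp p q n (sizeThreeHalves n) =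
      208 * forestConst μ / (w * Real.sqrt w) *
        (sizeExp p q n (sizeThreeHalves n) / (N * r)) := by
    field_simp
  rw [e3, e2]
  linarith

theorem stepMoment_two_pos (hμ3 : Integrable (fun x : ℝ => |x| ^ 3) μ) (hμ0 : μ ≠ Measure.dirac 0) :
    0 < stepMoment μ 2 := by
  have h2 : Integrable (fun x : ℝ => x ^ 2) μ :=
    ((memLp_three_of_integrable hμ3).mono_exponent (by norm_num)).integrable_sq
  refine lt_of_le_of_ne (integral_nonneg fun x => sq_nonneg x) fun h => hμ0 ?_
  have h0 := (integral_eq_zero_iff_of_nonneg (fun x => sq_nonneg x) h2).1 h.symm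
  have h1 : (fun x : ℝ => x) =ᵐ[μ] fun _ => (0 : ℝ) := by
    filter_upwards [h0] with x hx
    simpa using hx
  have : μ.map (fun x : ℝ => x) = μ.map fun _ => (0 : ℝ) := Measure.map_congr h1
  rw [Measure.map_const, measure_univ, one_smul] at this
  rw [← this]
  exact Measure.map_id'.symm

theorem stepMoment_one_sq_le (hμ3 : Integrable (fun x : ℝ => |x| ^ 3) μ) :
    stepMoment μ 1 ^ 2 ≤ stepMoment μ 2 := by
  have h2 : MemLp (fun x : ℝ => x) 2 μ :=
    (memLp_three_of_integrable hμ3).mono_exponent (by norm_num)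
  have := variance_nonneg (fun x : ℝ => x) μ
  rw [variance_eq_sub h2] at this
  simp only [stepMoment, pow_one]
  simpa using this

/-- The conditional approximation leaves a mixture of normal laws of variance wN; the smoothed limit
theorem for N₁ is applied with τ = wN ≥ w, where all three parts of its error profile become
multiples of N^(-1/2). -/
theorem exists_abs_sizeExp_forestLaw_sub_le (h3 : MemLp (fun x : ℝ => x) 3 μ) {p q : ℝ≥0}
    (hpq : p + q = 1) (hp : 0 < p) {a₁ a₂ v₁ w m : ℝ} (hm : stepMoment μ 1 = m)
    (h₁ : a₁ * (1 + q) = p) (h₂ : a₂ * (1 + 2 * q) = q * a₁)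
    (hv : v₁ * (1 + 2 * q) = a₁ * (1 + 2 * q) - a₁ ^ 2) (hv0 : 0 ≤ v₁)
    (hw : w = stepMoment μ 2 * (1 - a₁ - 2 * a₂) / 3 +
      (stepMoment μ 2 - stepMoment μ 1 ^ 2) * a₁) (hw0 : 0 < w) :
    ∃ C, 0 < C ∧ ∀ (n : ℕ) (x : ℝ),
      |sizeExp p q n (fun s => (forestLaw μ n s).real
        (Set.Iic (m * a₁ * (n + 1) + x * (Real.sqrt (w + m ^ 2 * v₁) * Real.sqrt (n + 1))))) -
        gaussCDF x| ≤
      C * (sizeExp p q n (sizeThreeHalves n) / ((n + 1) * Real.sqrt (n + 1)) +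
        1 / Real.sqrt (n + 1)) := by
  have hF := forestConst_pos μ
  have hsw : 0 < Real.sqrt w := Real.sqrt_pos.2 hw0
  have hs0 : 0 < w + m ^ 2 * v₁ := by positivity
  have hσ0 : 0 < Real.sqrt (w + m ^ 2 * v₁) := Real.sqrt_pos.2 hs0
  obtain ⟨D, hD⟩ : ∃ D : ℝ, D = 2 * (2 / 3 * stepMoment μ 2 - stepMoment μ 1 ^ 2) ^ 2 +
    8 * (2 / 3 * stepMoment μ 2) ^ 2 := ⟨_, rfl⟩
  obtain ⟨C₁, hC₁⟩ : ∃ C : ℝ, C = 208 * forestConst μ / (w * Real.sqrt w) := ⟨_, rfl⟩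
  obtain ⟨C₂, hC₂⟩ : ∃ C : ℝ, C = 1 / w + D / w + 16 * D / w ^ 2 := ⟨_, rfl⟩
  obtain ⟨E, hE⟩ : ∃ C : ℝ, C = 8 * |m| ^ 3 + 18 * m ^ 4 / Real.sqrt w + 6 * m ^ 2 + |m| :=
    ⟨_, rfl⟩
  obtain ⟨C₃, hC₃⟩ : ∃ C : ℝ, C = E * (1 / (w * Real.sqrt w) + 1 / w + 1 / Real.sqrt w) :=
    ⟨_, rfl⟩
  have hD0 : 0 ≤ D := by rw [hD]; positivity
  have hE0 : 0 ≤ E := by rw [hE]; positivity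
  have hC₁0 : 0 < C₁ := by rw [hC₁]; positivity
  have hC₂0 : 0 ≤ C₂ := by rw [hC₂]; positivity
  have hC₃0 : 0 ≤ C₃ := by rw [hC₃]; positivity
  refine ⟨C₁ + C₂ + C₃, by positivity, fun n x => ?_⟩
  obtain ⟨σ, hσ⟩ : ∃ σ : ℝ, σ = Real.sqrt (w + m ^ 2 * v₁) := ⟨_, rfl⟩
  rw [← hσ] at hσ0 ⊢
  have hN1 : (1 : ℝ) ≤ n + 1 := by
    have : (0 : ℝ) ≤ n := n.cast_nonneg
    linarith
  have hD' := sizeExp_forestVariance_sq_le μ hpq h₁ h₂ hw n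
  rw [← hD] at hD'
  have hcond := abs_sizeExp_forestLaw_sub_le h3 hpq hw0 n hD'
    (m * a₁ * (n + 1) + x * (σ * Real.sqrt (n + 1)))
  have hmix := abs_sizeExp_gaussCDF_treeCount_le hpq hp h₁ hv m hw0 n
    (x * (σ * Real.sqrt (n + 1))) (w * (n + 1)) (le_mul_of_one_le_right hw0.le hN1)
  have hfun : ∀ s, x * (σ * Real.sqrt (n + 1)) - m * (treeCount 1 n s - a₁ * (n + 1)) =
      m * a₁ * (n + 1) + x * (σ * Real.sqrt (n + 1)) - m * treeCount 1 n s := fun s => by ring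
  simp only [hfun] at hmix
  have hT0 : 0 ≤ sizeExp p q n (sizeThreeHalves n) := by
    have h0 := sizeExp_mono p q (n := n) (G := fun _ => (0 : ℝ)) (H := sizeThreeHalves n)
      fun s _ => sizeThreeHalves_nonneg n s
    rwa [sizeExp_const hpq] at h0
  have hN0 : (0 : ℝ) < n + 1 := by linarith
  have hr0 : 0 < Real.sqrt ((n : ℝ) + 1) := Real.sqrt_pos.2 hN0
  have hr2 : Real.sqrt ((n : ℝ) + 1) ^ 2 = n + 1 := Real.sq_sqrt hN0.le
  have hx : x * (σ * Real.sqrt (n + 1)) / Real.sqrt (w * (n + 1) + m ^ 2 * v₁ * (n + 1)) = x := by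
    rw [← add_mul, Real.sqrt_mul hs0.le, ← hσ, mul_div_assoc, div_self (by positivity), mul_one]
  have hC : E * ((n + 1) / (w * (n + 1) * Real.sqrt (w * (n + 1))) +
      Real.sqrt (n + 1) / (w * (n + 1)) + 1 / Real.sqrt (w * (n + 1))) =
      C₃ * (1 / Real.sqrt (n + 1)) := by
    rw [hC₃, Real.sqrt_mul hw0.le]
    generalize Real.sqrt ((n : ℝ) + 1) = r at hr0 hr2
    generalize Real.sqrt w = t at hsw
    rw [← hr2]
    field_simp
  rw [hx, ← hE, hC] at hmix
  rw [← hC₁, ← hC₂, hm] at hcond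
  have hT : 0 ≤ sizeExp p q n (sizeThreeHalves n) / ((n + 1) * Real.sqrt (n + 1)) := by positivity
  have hr1 : 0 ≤ 1 / Real.sqrt ((n : ℝ) + 1) := by positivity
  refine (abs_sub_le _ _ _).trans ((add_le_add hcond hmix).trans ?_)
  generalize sizeExp p q n (sizeThreeHalves n) / ((n + 1) * Real.sqrt (n + 1)) = T at hT
  generalize 1 / Real.sqrt ((n : ℝ) + 1) = r at hr1
  have g1 := mul_nonneg hC₂0 hT
  have g2 := mul_nonneg hC₃0 hT
  have g3 := mul_nonneg hC₁0.le hr1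
  linarith

/-- The normal approximation of the walk at time `n + 1`, with an error expressed through the
expected sum of the tree sizes to the power `3 / 2`. -/
theorem exists_abs_sizeExp_forestLaw_check_sub_le (hμ3 : Integrable (fun x : ℝ => |x| ^ 3) μ)
    (hμ0 : μ ≠ Measure.dirac 0) {p q : ℝ≥0} (hpq : p + q = 1) (hp : 0 < p) (hq : 0 < q) :
    0 < sigmaCheck μ p ∧ ∃ C, 0 < C ∧ ∀ (n : ℕ) (x : ℝ),
      |sizeExp p q n (fun s => (forestLaw μ n s).real
        (Set.Iic (bCheck μ p * (n + 1) + x * (sigmaCheck μ p * Real.sqrt (n + 1))))) -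
        gaussCDF x| ≤
      C * (sizeExp p q n (sizeThreeHalves n) / ((n + 1) * Real.sqrt (n + 1)) +
        1 / Real.sqrt (n + 1)) := by
  have hm2 := stepMoment_two_pos hμ3 hμ0
  have hm12 := stepMoment_one_sq_le hμ3
  have hp0 : (0 : ℝ) < p := hp
  have hq0 : (0 : ℝ) < q := hq
  have hpq' : (p : ℝ) + q = 1 := by exact_mod_cast hpq
  have hpe : (p : ℝ) = 1 - q := by linarith
  obtain ⟨a₁, ha₁⟩ : ∃ a : ℝ, a = p / (1 + q) := ⟨_, rfl⟩
  obtain ⟨a₂, ha₂⟩ : ∃ a : ℝ, a = q * a₁ / (1 + 2 * q) := ⟨_, rfl⟩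
  obtain ⟨v₁, hv₁⟩ : ∃ a : ℝ, a = a₁ - a₁ ^ 2 / (1 + 2 * q) := ⟨_, rfl⟩
  obtain ⟨w, hw⟩ : ∃ w : ℝ, w = stepMoment μ 2 * (1 - a₁ - 2 * a₂) / 3 +
    (stepMoment μ 2 - stepMoment μ 1 ^ 2) * a₁ := ⟨_, rfl⟩
  have e₁ : a₁ * (1 + q) = p := by rw [ha₁]; field_simp
  have e₂ : a₂ * (1 + 2 * q) = q * a₁ := by rw [ha₂]; field_simp
  have ev : v₁ * (1 + 2 * q) = a₁ * (1 + 2 * q) - a₁ ^ 2 := by rw [hv₁]; field_simp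
  have ha₁0 : 0 < a₁ := by rw [ha₁]; positivity
  -- This is the limiting fraction of vertices in trees of size at least three. It is positive since
  -- q > 0, so w > 0 even when μ is a point mass.
  have h12 : 1 - a₁ - 2 * a₂ = 6 * q ^ 2 / ((1 + q) * (1 + 2 * q)) := by
    rw [ha₂, ha₁, hpe]
    field_simp
    ring
  have hw0 : 0 < w := by
    have h1 : 0 < stepMoment μ 2 * (1 - a₁ - 2 * a₂) / 3 := by
      rw [h12]
      positivity
    have h2 : 0 ≤ (stepMoment μ 2 - stepMoment μ 1 ^ 2) * a₁ :=
      mul_nonneg (by linarith) ha₁0.le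
    linarith
  have hv0 : 0 ≤ v₁ := by
    have h1 : a₁ ≤ 1 := by
      rw [ha₁, div_le_one (by positivity)]
      linarith
    have h2 : 0 ≤ v₁ * (1 + 2 * q) := by
      rw [ev]
      nlinarith
    exact nonneg_of_mul_nonneg_left h2 (by positivity)
  have hb : bCheck μ p = stepMoment μ 1 * a₁ := by
    rw [bCheck, ha₁, show (2 : ℝ) - p = 1 + q by linarith]
    ring
  -- The law of total variance: w is the mean conditional variance per step, and m₁²v₁ the
  -- asymptotic variance of the conditional mean.
  have hσ : sigmaCheck μ p = Real.sqrt (w + stepMoment μ 1 ^ 2 * v₁) := by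
    rw [sigmaCheck, hb, show (3 : ℝ) - 2 * p = 1 + 2 * q by linarith, hw, hv₁, ha₂, ha₁, hpe]
    congr 1
    field_simp
    ring
  rw [hb, hσ]
  exact ⟨Real.sqrt_pos.2 (by positivity), exists_abs_sizeExp_forestLaw_sub_le
    (memLp_three_of_integrable hμ3) hpq hp rfl e₁ e₂ ev hv0 hw hw0⟩

theorem one_div_sqrt_eq_rpow {N : ℝ} (hN : 0 < N) :
    1 / Real.sqrt N = N ^ (-(1 / 2) : ℝ) := by
  rw [Real.sqrt_eq_rpow, Real.rpow_neg hN.le, one_div]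

/-- The rate of the expected sum of the tree sizes to the power `3 / 2`. -/
theorem exists_sizeThreeHalves_le_delta2 {p q : ℝ≥0} (hpq : p + q = 1) :
    ∃ C, 0 < C ∧ ∀ n : ℕ, ((p : ℝ) = 1 / 3 → 2 ≤ n + 1) →
      sizeExp p q n (sizeThreeHalves n) / ((n + 1) * Real.sqrt (n + 1)) +
        1 / Real.sqrt (n + 1) ≤ C * delta2 p (n + 1) := by
  have hp0 : (0 : ℝ) ≤ p := p.2
  have hq0 : (0 : ℝ) ≤ q := q.2
  have hpq' : (p : ℝ) + q = 1 := by exact_mod_cast hpq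
  have h0 := sizeExp_zero_sizeThreeHalves p q
  have hr := sizeExp_succ_sizeThreeHalves_le hpq
  rcases lt_trichotomy (1 / 3 : ℝ) p with h | h | h
  · have hα : 3 / 2 * (q : ℝ) < 1 := by linarith
    have hK : 0 < (1 - 3 / 2 * (q : ℝ))⁻¹ := inv_pos.2 (by linarith)
    refine ⟨(1 - 3 / 2 * (q : ℝ))⁻¹ + 1, by positivity, fun n _ => ?_⟩
    have hg := growth_of_lt_one (r := fun n => sizeExp p q n (sizeThreeHalves n)) (by positivity) hα h0 hr n
    have hN0 : (0 : ℝ) < n + 1 := by positivity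
    rw [delta2, if_pos h, Nat.cast_add_one, ← one_div_sqrt_eq_rpow hN0,
      add_mul (1 - 3 / 2 * (q : ℝ))⁻¹ 1, one_mul]
    gcongr
    rw [mul_one_div, div_le_div_iff₀ (by positivity) (by positivity)]
    have hs : 0 ≤ Real.sqrt ((n : ℝ) + 1) := Real.sqrt_nonneg _
    nlinarith [mul_le_mul_of_nonneg_right hg hs]
  · have hq : (q : ℝ) = 2 / 3 := by linarith
    -- For N ≥ 2, log N ≥ 1/2, so 2 + log N ≤ 5 log N; at N = 1 the rate would vanish.
    refine ⟨5, by norm_num, fun n hn => ?_⟩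
    have hn := hn h.symm
    have hg := growth_of_eq_one (r := fun n => sizeExp p q n (sizeThreeHalves n)) h0 (fun n => by
      have := hr n
      rwa [hq, show (3 / 2 * (2 / 3) : ℝ) = 1 by norm_num] at this) n
    have hN0 : (0 : ℝ) < n + 1 := by positivity
    have hN2 : (2 : ℝ) ≤ n + 1 := by exact_mod_cast hn
    have hlog : 1 ≤ 2 * Real.log ((n : ℝ) + 1) := by
      have h1 := Real.log_le_log (by norm_num) hN2
      have h2 := Real.log_two_gt_d9
      linarith
    rw [delta2, if_neg h.not_lt, if_pos h.symm, Nat.cast_add_one, ← one_div_sqrt_eq_rpow hN0]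
    have hs : 0 < Real.sqrt ((n : ℝ) + 1) := Real.sqrt_pos.2 hN0
    have h1 : sizeExp p q n (sizeThreeHalves n) / ((n + 1) * Real.sqrt (n + 1)) ≤
        (1 + Real.log (n + 1)) * (1 / Real.sqrt ((n : ℝ) + 1)) := by
      rw [mul_one_div, div_le_div_iff₀ (by positivity) hs]
      nlinarith [mul_le_mul_of_nonneg_right hg hs.le]
    have h2 : 0 ≤ 1 / Real.sqrt ((n : ℝ) + 1) := by positivity
    nlinarith
  · have hα : 1 < 3 / 2 * (q : ℝ) := by linarith
    have hK : 0 < (3 / 2 * (q : ℝ) - 1)⁻¹ := inv_pos.2 (by linarith)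
    refine ⟨(1 + (3 / 2 * (q : ℝ) - 1)⁻¹) + 1, by positivity, fun n _ => ?_⟩
    have hg := growth_of_one_lt (r := fun n => sizeExp p q n (sizeThreeHalves n)) hα h0 hr n
    have hN0 : (0 : ℝ) < n + 1 := by positivity
    have hN1 : (1 : ℝ) ≤ n + 1 := by
      have : (0 : ℝ) ≤ n := n.cast_nonneg
      linarith
    rw [delta2, if_neg h.not_gt, if_neg h.ne, Nat.cast_add_one,
      add_mul (1 + (3 / 2 * (q : ℝ) - 1)⁻¹) 1, one_mul]
    have h1 : 1 / Real.sqrt ((n : ℝ) + 1) ≤ ((n : ℝ) + 1) ^ (-(3 * p / 2) : ℝ) := by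
      rw [one_div_sqrt_eq_rpow hN0]
      exact Real.rpow_le_rpow_of_exponent_le hN1 (by linarith)
    have h2 : ((n : ℝ) + 1) * Real.sqrt (n + 1) = ((n : ℝ) + 1) ^ (3 / 2 : ℝ) := by
      rw [Real.sqrt_eq_rpow]
      nth_rewrite 1 [← Real.rpow_one ((n : ℝ) + 1)]
      rw [← Real.rpow_add hN0]
      norm_num
    refine add_le_add ?_ h1
    rw [h2, div_le_iff₀ (by positivity), mul_assoc, ← Real.rpow_add hN0,
      show (-(3 * (p : ℝ) / 2) + 3 / 2) = 3 / 2 * q by linarith]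
    exact hg

end Assembly

theorem mainTheorem2 (μ : Measure ℝ) [IsProbabilityMeasure μ]
    (hμ3 : Integrable (fun x : ℝ => |x| ^ 3) μ) (hμ0 : μ ≠ Measure.dirac 0)
    (p : ℝ) (hp : p ∈ Set.Ioo (0 : ℝ) 1) :
    ∃ C : ℝ, 0 < C ∧
      ∀ (Ω : Type*) [MeasurableSpace Ω] (P : Measure Ω) [IsProbabilityMeasure P]
        (X : ℕ → Ω → ℝ) (ε U : ℕ → Ω → ℕ), IsReinforcementInput P μ p X ε U →
        ∀ n : ℕ, 1 ≤ n → (p = 1 / 3 → 2 ≤ n) →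
          kolmogorovDistNormal P
            (fun ω => (negWalk X ε U n ω - bCheck μ p * n) / (sigmaCheck μ p * Real.sqrt n))
          ≤ C * delta2 p n := by
  lift p to NNReal using hp.1.le
  have hp0 : 0 < p := by exact_mod_cast hp.1
  have hp1 : p < 1 := by exact_mod_cast hp.2
  have hpq : p + (1 - p) = 1 := add_tsub_cancel_of_le hp1.le
  obtain ⟨hσ, C, hC, hbound⟩ := exists_abs_sizeExp_forestLaw_check_sub_le hμ3 hμ0 hpq hp0
    (tsub_pos_of_lt hp1)
  obtain ⟨C', hC', hrate⟩ := exists_sizeThreeHalves_le_delta2 hpq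
  -- Both constants come from the size chain and μ, before any probability space is chosen.
  refine ⟨C * C', mul_pos hC hC', fun Ω _ P _ X ε U hX n hn hn3 => ?_⟩
  obtain ⟨n, rfl⟩ := Nat.exists_eq_add_of_le' hn
  refine ciSup_le fun x => ?_
  have hs : 0 < Real.sqrt ((n : ℝ) + 1) := Real.sqrt_pos.2 (by positivity)
  have hset : {ω | (negWalk X ε U (n + 1) ω - bCheck μ p * ((n + 1 : ℕ) : ℝ)) /
      (sigmaCheck μ p * Real.sqrt ((n + 1 : ℕ) : ℝ)) ≤ x} =
      {ω | negWalk X ε U (n + 1) ω ≤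
        bCheck μ p * (n + 1) + x * (sigmaCheck μ p * Real.sqrt (n + 1))} := by
    ext ω
    simp only [Set.mem_ofPred_eq, Nat.cast_add_one]
    rw [div_le_iff₀ (mul_pos hσ hs), sub_le_iff_le_add']
  rw [hset, hX.real_negWalk_le hpq]
  refine (hbound n x).trans ?_
  rw [mul_assoc]
  exact mul_le_mul_of_nonneg_left (hrate n hn3) hC.le
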